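/- Let $\Lambda$ be the von Mangoldt function, $\Gamma$ the Euler Gamma-function, and for $n\ge 1$ let $R_G(n)=\sum_{m_1+m_2=n}\Lambda(m_1)\Lambda(m_2)$, the sum being over positive integers $m_1,m_2$. There is an integer $N_0$ such that for every real number $k>1$ there is a constant $C_k$ depending only on $k$ with the following property. For every integer $N\ge N_0$ the two series over zeros below converge absolutely (the second one as a double series over pairs $(\rho_1,\rho_2)$), and $$ \sum_{n \le N} R_G(n)\,\frac{(1-n/N)^k}{\Gamma(k+1)} = \frac{N^2}{\Gamma(k+3)} - 2\sum_{\rho}\frac{\Gamma(\rho)}{\Gamma(\rho+k+2)}\,N^{\rho+1} + \sum_{\rho_1}\sum_{\rho_2}\frac{\Gamma(\rho_1)\Gamma(\rho_2)}{\Gamma(\rho_1+\rho_2+k+1)}\,N^{\rho_1+\rho_2} + E_k(N), \qquad |E_k(N)|\le C_k N, $$ where $\rho$, with or without subscripts, runs over the non-trivial zeros of the Riemann zeta-function $\zeta(s)$ (those with $0<\Re(s)<1$), counted with multiplicity. -/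

import Mathlib

/-- The weighted number of representations of `n` as a sum of two prime powers:
`∑_{m₁ + m₂ = n} Λ(m₁) Λ(m₂)`, where `Λ` is the von Mangoldt function (and `Λ(0) = 0`). -/
noncomputable def goldbachR (n : ℕ) : ℝ :=
  ∑ m ∈ Finset.HasAntidiagonal.antidiagonal n,
    ArithmeticFunction.vonMangoldt m.1 * ArithmeticFunction.vonMangoldt m.2

/-- The set of non-trivial zeros of the Riemann zeta-function. -/
def zetaZeros : Set ℂ := {ρ : ℂ | riemannZeta ρ = 0 ∧ 0 < ρ.re ∧ ρ.re < 1}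

/-- The multiplicity of a point as a zero of the Riemann zeta-function. -/
noncomputable def zetaMult (ρ : ℂ) : ℕ := analyticOrderNatAt riemannZeta ρ

/-- The Cesàro average `∑_{n ≤ N} R_G(n) (1 - n/N)^k / Γ(k+1)`. -/
noncomputable def goldbachCesaro (k : ℝ) (N : ℕ) : ℝ :=
  ∑ n ∈ Finset.Icc 1 N, goldbachR n * ((1 - (n : ℝ) / (N : ℝ)) ^ k / Real.Gamma (k + 1))

/-- The contribution `Γ(ρ) / Γ(ρ + k + 2) * N^(ρ + 1)` of the zero `ρ`, taken as often as
its multiplicity indicates. -/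
noncomputable def singleTerm (k : ℝ) (N : ℕ) (ρ : ℂ) : ℂ :=
  (zetaMult ρ : ℂ) *
    (Complex.Gamma ρ / Complex.Gamma (ρ + (k : ℂ) + 2) * (N : ℂ) ^ (ρ + 1))

/-- The contribution `Γ(ρ₁) Γ(ρ₂) / Γ(ρ₁ + ρ₂ + k + 1) * N^(ρ₁ + ρ₂)` of a pair of zeros, taken
as often as their multiplicities indicate. -/
noncomputable def doubleTerm (k : ℝ) (N : ℕ) (ρ₁ ρ₂ : ℂ) : ℂ :=
  (zetaMult ρ₁ : ℂ) * (zetaMult ρ₂ : ℂ) *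
    (Complex.Gamma ρ₁ * Complex.Gamma ρ₂ / Complex.Gamma (ρ₁ + ρ₂ + (k : ℂ) + 1) *
      (N : ℂ) ^ (ρ₁ + ρ₂))

/-! The sum is a convolution square. Write k = 2a - 1, so that k > 1 means a > 1, and let S(x) = ∑
Λ(n) (x - n)₊^(a-1). Two truncated powers of exponent a - 1 convolve to B(a,a) times one of exponent
2a - 1, so ∫₀^N S(x) S(N-x) dx is Γ(a)² N^k times the Cesàro average
(`integral_rieszSum_eq_goldbachCesaro`). Into both factors goes the explicit formula S(x) = x^a/a -
∑_ρ B(ρ,a) x^(ρ+a-1) + O(N^(a-1)), uniform in 0 ≤ x ≤ N (`exists_norm_rieszSum_sub_le`). The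
products of main parts integrate termwise to Beta integrals and give exactly the three main terms;
termwise integration is legitimate because ∑ |B(ρ,a)| converges for a > 1. Chebyshev gives S ≪ N^a,
so the error is N · N^a · N^(a-1) = N^(2a), which is N after division by N^k.

The explicit formula is proved without shifting a contour. `hasSum_LSeries_vonMangoldt` expands ζ'/ζ
in partial fractions (m_z/z) · s/(s-z) over all zeros z of (s-1)ζ(s), with m_z the multiplicity.
Multiply by B(s,a), the Mellin transform of (1-t)₊^(a-1). Since s B(s,a) = (a-1) B(s+1,a-1), every
fraction becomes the Mellin transform of a multiple of the kernel t^(-z) ∫_t^1 (1-u)^(a-2) u^z du.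
Both sides then have the same Mellin transform in a half-plane, and Mellin inversion yields an exact
identity for 0 < t < 1 (`cesaro_vonMangoldt_eq`). Completing the integral to [0,1] at a non-trivial
zero produces B(ρ,a) t^(-ρ). For t < 1/2 what is left, trivial zeros included, is O(|z|^(-1-δ)) per
zero with δ = min(1, a-1), uniformly in t, and this is summable because (s-1)ζ(s) has order at most
one.

The partial fractions hold for any entire f with f(0) ≠ 0 and log|f| ≪ (1+|z|)^p, p < 2
(`hasSum_logDeriv_sub`). Divide out the zeros in |z| ≤ n; by Borel–Carathéodory the logarithmic
derivative of the quotient changes between 0 and s by O(n^(p-2)). The growth of (s-1)ζ(s) comes from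
a series valid for Re s ≥ 1/2 and the functional equation. -/

open Complex Metric Filter Topology MeasureTheory intervalIntegral

/-! ### Entire functions of finite order: counting zeros, partial fractions -/

/-- An entire function that is not identically zero has finite order everywhere. -/
theorem Differentiable.analyticOrderAt_ne_top {f : ℂ → ℂ} (hf : Differentiable ℂ f) {w : ℂ}
    (hw : f w ≠ 0) (z : ℂ) : analyticOrderAt f z ≠ ⊤ := by
  have hA : AnalyticOnNhd ℂ f Set.univ := fun x _ => hf.analyticAt x
  refine hA.analyticOrderAt_ne_top_of_isPreconnected isPreconnected_univ (Set.mem_univ w)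
    (Set.mem_univ z) ?_
  rw [(hf.analyticAt w).analyticOrderAt_eq_zero.2 hw]
  exact ENat.zero_ne_top

/-- Dividing out one zero of an entire function. -/
theorem Differentiable.exists_eq_pow_mul {f : ℂ → ℂ} (hf : Differentiable ℂ f) {w : ℂ}
    (hw : f w ≠ 0) {ρ : ℂ} (hρ : ρ ≠ 0) :
    ∃ g : ℂ → ℂ, Differentiable ℂ g ∧
      (∀ z, f z = (1 - z / ρ) ^ analyticOrderNatAt f ρ * g z) ∧ g ρ ≠ 0 := by
  obtain ⟨h, hh, hh0, hfh⟩ :=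
    (hf.analyticAt ρ).analyticOrderAt_ne_top.1 (hf.analyticOrderAt_ne_top hw ρ)
  set n := analyticOrderNatAt f ρ with hn
  classical
  have hfac : ∀ z, 1 - z / ρ = (z - ρ) * (-ρ)⁻¹ := by
    intro z; field_simp; ring
  have hne : ∀ z, z ≠ ρ → 1 - z / ρ ≠ 0 := by
    intro z hz
    rw [hfac]
    exact mul_ne_zero (sub_ne_zero.2 hz) (inv_ne_zero (neg_ne_zero.2 hρ))
  have hρn : ((-ρ) ^ n) ≠ 0 := pow_ne_zero _ (neg_ne_zero.2 hρ)
  -- The value at ρ removes the singularity: (1 - z/ρ)^n = (z - ρ)^n (-ρ)^(-n), and f = (z - ρ)^n h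
  -- near ρ.
  refine ⟨fun z => if z = ρ then h ρ * (-ρ) ^ n else f z / (1 - z / ρ) ^ n, ?_, ?_, ?_⟩
  · intro z
    rcases eq_or_ne z ρ with rfl | hz
    · have : (fun w => if w = z then h z * (-z) ^ n else f w / (1 - w / z) ^ n)
          =ᶠ[𝓝 z] fun w => h w * (-z) ^ n := by
        filter_upwards [hfh] with w hw
        split_ifs with hwz
        · rw [hwz]
        · rw [hw, hfac, mul_pow, smul_eq_mul, inv_pow]
          have : (w - z) ^ n ≠ 0 := pow_ne_zero _ (sub_ne_zero.2 hwz)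
          field_simp
      exact (hh.differentiableAt.mul_const _).congr_of_eventuallyEq this
    · have : (fun w => if w = ρ then h ρ * (-ρ) ^ n else f w / (1 - w / ρ) ^ n)
          =ᶠ[𝓝 z] fun w => f w / (1 - w / ρ) ^ n := by
        filter_upwards [isOpen_ne.mem_nhds hz] with w hw
        exact if_neg hw
      refine DifferentiableAt.congr_of_eventuallyEq ?_ this
      exact (hf z).div (by fun_prop) (pow_ne_zero _ (hne z hz))
  · intro z
    rcases eq_or_ne z ρ with rfl | hz
    · have h1 : f z = (z - z) ^ n • h z := hfh.eq_of_nhds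
      simp only [if_true]
      rw [h1, hfac, mul_pow, inv_pow, smul_eq_mul]
      field_simp
    · simp only [if_neg hz]
      field_simp [hne z hz]
  · simpa using ⟨hh0, fun h => absurd h hρ⟩

/-- Dividing out finitely many zeros of an entire function. -/
theorem Differentiable.exists_eq_prod_mul {f : ℂ → ℂ} (hf : Differentiable ℂ f)
    (h0 : f 0 ≠ 0) (S : Finset ℂ) (hS : (0 : ℂ) ∉ S) :
    ∃ g : ℂ → ℂ, Differentiable ℂ g ∧
      (∀ z, f z = (∏ ρ ∈ S, (1 - z / ρ) ^ analyticOrderNatAt f ρ) * g z) ∧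
      ∀ ρ ∈ S, g ρ ≠ 0 := by
  classical
  induction S using Finset.induction_on with
  | empty => exact ⟨f, hf, by simp, by simp⟩
  | insert ρ S hρS ih =>
    obtain ⟨g, hg, hfg, hgS⟩ := ih (fun h => hS (Finset.mem_insert_of_mem h))
    have hρ : ρ ≠ 0 := fun h => hS (h ▸ Finset.mem_insert_self _ _)
    have hg0 : g 0 ≠ 0 := fun h => h0 (by rw [hfg, h, mul_zero])
    obtain ⟨k, hk, hgk, hkρ⟩ := hg.exists_eq_pow_mul hg0 hρ
    set P : ℂ → ℂ := fun z => ∏ ρ ∈ S, (1 - z / ρ) ^ analyticOrderNatAt f ρ with hP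
    have hPd : Differentiable ℂ P := by
      rw [hP]
      exact Differentiable.fun_finsetProd (fun i _ => by fun_prop)
    have hPρ : P ρ ≠ 0 := by
      refine Finset.prod_ne_zero_iff.2 fun σ hσ => pow_ne_zero _ ?_
      have hσ0 : σ ≠ 0 := fun h => hS (h ▸ Finset.mem_insert_of_mem hσ)
      intro h
      have : ρ = σ := by
        field_simp at h
        linear_combination -h
      exact hρS (this ▸ hσ)
    have hord : analyticOrderNatAt g ρ = analyticOrderNatAt f ρ := by
      have : f = P * g := funext hfg
      rw [this, analyticOrderNatAt, analyticOrderNatAt,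
        analyticOrderAt_mul (hPd.analyticAt ρ) (hg.analyticAt ρ),
        (hPd.analyticAt ρ).analyticOrderAt_eq_zero.2 hPρ, zero_add]
    refine ⟨k, hk, fun z => ?_, fun σ hσ => ?_⟩
    · rw [Finset.prod_insert hρS, hfg z, hgk z, hord]
      ring
    · rcases Finset.mem_insert.1 hσ with rfl | hσ
      · exact hkρ
      · exact fun h => hgS σ hσ (by rw [hgk, h, mul_zero])

/-- If finitely many zeros of size at most `R` are divided out of an entire function, then the
quotient gains a power of `2` on the ball of radius `3 * R`. -/
theorem two_pow_mul_norm_le_of_eq_prod_mul {f g : ℂ → ℂ} (hg : Differentiable ℂ g) {R M : ℝ}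
    (hR : 0 < R) {S : Finset ℂ} {m : ℂ → ℕ} (hS0 : (0 : ℂ) ∉ S) (hS : ∀ ρ ∈ S, ‖ρ‖ ≤ R)
    (hfg : ∀ z, f z = (∏ ρ ∈ S, (1 - z / ρ) ^ m ρ) * g z)
    (hM : ∀ z, ‖z‖ = 3 * R → ‖f z‖ ≤ M) {z : ℂ} (hz : ‖z‖ ≤ 3 * R) :
    2 ^ (∑ ρ ∈ S, m ρ) * ‖g z‖ ≤ M := by
  have hsph : ∀ w ∈ frontier (ball (0 : ℂ) (3 * R)), ‖g w‖ ≤ M / 2 ^ (∑ ρ ∈ S, m ρ) := by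
    intro w hw
    have hw : ‖w‖ = 3 * R := by
      simpa using frontier_ball_subset_sphere hw
    rw [le_div_iff₀ (by positivity)]
    -- On |w| = 3R every factor has |1 - w/ρ| ≥ 3 - 1 = 2. The maximum principle then carries the
    -- bound for g into the disc.
    have h1 : (2 : ℝ) ^ (∑ ρ ∈ S, m ρ) ≤ ‖∏ ρ ∈ S, (1 - w / ρ) ^ m ρ‖ := by
      rw [norm_prod, ← Finset.prod_pow_eq_pow_sum]
      refine Finset.prod_le_prod (fun _ _ => by positivity) fun ρ hρ => ?_
      rw [norm_pow]
      have hρ0 : ρ ≠ 0 := fun h => hS0 (h ▸ hρ)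
      have hρp : 0 < ‖ρ‖ := norm_pos_iff.2 hρ0
      have h3 : 3 ≤ ‖w / ρ‖ := by
        rw [norm_div, le_div_iff₀ hρp, hw]
        linarith [hS ρ hρ]
      have h4 : ‖w / ρ‖ - ‖(1 : ℂ)‖ ≤ ‖1 - w / ρ‖ := by
        rw [norm_sub_rev]; exact norm_sub_norm_le _ _
      rw [norm_one] at h4
      exact pow_le_pow_left₀ (by norm_num) (by linarith) _
    calc ‖g w‖ * 2 ^ (∑ ρ ∈ S, m ρ) ≤ ‖g w‖ * ‖∏ ρ ∈ S, (1 - w / ρ) ^ m ρ‖ := by gcongr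
      _ = ‖f w‖ := by rw [hfg w, norm_mul, mul_comm]
      _ ≤ M := hM w hw
  have := Complex.norm_le_of_forall_mem_frontier_norm_le isBounded_ball
    hg.diffContOnCl hsph (z := z) (by rw [closure_ball _ (by positivity)]; simpa using hz)
  rw [le_div_iff₀ (by positivity)] at this
  linarith

/-- The number of zeros of an entire function of finite order in a ball. -/
theorem exists_sum_analyticOrderNatAt_le {f : ℂ → ℂ} (hf : Differentiable ℂ f) (h0 : f 0 ≠ 0)
    {p C : ℝ} (hp : 0 ≤ p) (hC : 0 ≤ C) (hb : ∀ z, ‖f z‖ ≤ Real.exp (C * (1 + ‖z‖) ^ p)) :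
    ∃ K : ℝ, 0 ≤ K ∧ ∀ (R : ℝ), 0 ≤ R → ∀ S : Finset ℂ, (∀ ρ ∈ S, ‖ρ‖ ≤ R) →
      ∑ ρ ∈ S, (analyticOrderNatAt f ρ : ℝ) ≤ K * (1 + R) ^ p := by
  refine ⟨(C * 4 ^ p + |Real.log ‖f 0‖|) / Real.log 2, by positivity, fun R hR S hS => ?_⟩
  classical
  have hord0 : analyticOrderNatAt f 0 = 0 := by
    rw [analyticOrderNatAt, (hf.analyticAt 0).analyticOrderAt_eq_zero.2 h0]; rfl
  have hS' : ∑ ρ ∈ S, (analyticOrderNatAt f ρ : ℝ)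
      = ∑ ρ ∈ S.erase 0, (analyticOrderNatAt f ρ : ℝ) := by
    symm; apply Finset.sum_erase; simp [hord0]
  rw [hS']
  obtain ⟨g, hg, hfg, -⟩ := hf.exists_eq_prod_mul h0 (S.erase 0) (by simp)
  have h1R : (0 : ℝ) < 1 + R := by linarith
  -- A substitute for Jensen's formula: at z = 0 the quotient equals f 0, so 2^(number of zeros) ·
  -- |f 0| ≤ M. The radius 1 + R instead of R keeps it positive.
  have key := two_pow_mul_norm_le_of_eq_prod_mul hg (R := 1 + R)
    (M := Real.exp (C * (1 + 3 * (1 + R)) ^ p)) h1R (by simp)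
    (fun ρ hρ => (hS ρ (Finset.mem_of_mem_erase hρ)).trans (by linarith)) hfg
    (fun z hz => by rw [← hz]; exact hb z) (z := 0) (by simp; positivity)
  have hg0 : g 0 = f 0 := by rw [hfg 0]; simp
  have hlog2 : 0 < Real.log 2 := Real.log_pos (by norm_num)
  have h4 : (1 + 3 * (1 + R)) ^ p ≤ 4 ^ p * (1 + R) ^ p := by
    rw [← Real.mul_rpow (by norm_num) h1R.le]
    exact Real.rpow_le_rpow (by positivity) (by linarith) hp
  have h5 : (1 : ℝ) ≤ (1 + R) ^ p := Real.one_le_rpow (by linarith) hp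
  rw [hg0] at key
  have hpos : 0 < ‖f 0‖ := norm_pos_iff.2 h0
  have hl := Real.log_le_log (by positivity) key
  rw [Real.log_mul (by positivity) hpos.ne', Real.log_pow, Real.log_exp] at hl
  push_cast at hl
  rw [div_mul_eq_mul_div, le_div_iff₀ hlog2]
  have h6 := neg_abs_le (Real.log ‖f 0‖)
  have h7 : C * (1 + 3 * (1 + R)) ^ p ≤ C * (4 ^ p * (1 + R) ^ p) := by gcongr
  have h8 : |Real.log ‖f 0‖| ≤ |Real.log ‖f 0‖| * (1 + R) ^ p :=
    le_mul_of_one_le_right (abs_nonneg _) h5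
  nlinarith

/-- A family whose counting function grows like `R ^ p` is summable against `(1 + r) ^ (-q)` for
every `q > p`. -/
theorem summable_mul_rpow_of_sum_le {ι : Type*} {m r : ι → ℝ} (hm : ∀ i, 0 ≤ m i)
    (hr : ∀ i, 0 ≤ r i) {p q K : ℝ} (hq : 0 ≤ q) (hpq : p < q)
    (h : ∀ R : ℝ, 0 ≤ R → ∀ S : Finset ι, (∀ i ∈ S, r i ≤ R) → ∑ i ∈ S, m i ≤ K * (1 + R) ^ p) :
    Summable fun i => m i * (1 + r i) ^ (-q) := by
  classical
  have hgeo : Summable fun j : ℕ => K * 2 ^ p * ((2 : ℝ) ^ (p - q)) ^ j := by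
    refine (summable_geometric_of_lt_one (by positivity) ?_).mul_left _
    exact Real.rpow_lt_one_of_one_lt_of_neg (by norm_num) (by linarith)
  have hK : 0 ≤ K := by simpa using h 0 le_rfl ∅ (by simp)
  refine summable_of_sum_le (c := ∑' j : ℕ, K * 2 ^ p * ((2 : ℝ) ^ (p - q)) ^ j)
    (fun i => mul_nonneg (hm i) (Real.rpow_nonneg (by linarith [hr i]) _)) fun S => ?_
  -- Dyadic blocks: J i = j means 2^j ≤ 1 + r i ≤ 2^(j+1). A block contributes at most K 2^p ·
  -- 2^(j(p-q)).
  set J : ι → ℕ := fun i => Nat.log 2 ⌊1 + r i⌋₊ with hJ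
  have hlow : ∀ i, (2 : ℝ) ^ J i ≤ 1 + r i := by
    intro i
    have h1 : 2 ^ J i ≤ ⌊1 + r i⌋₊ := Nat.pow_log_le_self 2 (by
      have : 1 ≤ ⌊1 + r i⌋₊ := Nat.le_floor (by simpa using hr i)
      omega)
    calc (2 : ℝ) ^ J i = ((2 ^ J i : ℕ) : ℝ) := by push_cast; rfl
      _ ≤ (⌊1 + r i⌋₊ : ℝ) := by exact_mod_cast h1
      _ ≤ 1 + r i := Nat.floor_le (by linarith [hr i])
  have hup : ∀ i, 1 + r i ≤ (2 : ℝ) ^ (J i + 1) := by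
    intro i
    have h1 : ⌊1 + r i⌋₊ < 2 ^ (J i + 1) := Nat.lt_pow_succ_log_self (by norm_num) _
    have h2 : ((⌊1 + r i⌋₊ + 1 : ℕ) : ℝ) ≤ ((2 ^ (J i + 1) : ℕ) : ℝ) := by exact_mod_cast h1
    push_cast at h2
    linarith [Nat.lt_floor_add_one (1 + r i)]
  rw [← Finset.sum_fiberwise_of_maps_to (s := S) (t := S.image J) (g := J)
    (fun i hi => Finset.mem_image_of_mem _ hi)]
  refine le_trans (Finset.sum_le_sum fun j _ => ?_)
    (hgeo.sum_le_tsum (S.image J) (fun j _ => by positivity))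
  calc ∑ i ∈ S with J i = j, m i * (1 + r i) ^ (-q)
      ≤ ∑ i ∈ S with J i = j, m i * ((2 : ℝ) ^ j) ^ (-q) := by
        refine Finset.sum_le_sum fun i hi => mul_le_mul_of_nonneg_left ?_ (hm i)
        have hi := (Finset.mem_filter.1 hi).2
        refine Real.rpow_le_rpow_of_nonpos (by positivity) ?_ (by linarith)
        rw [← hi]; exact hlow i
    _ = (∑ i ∈ S with J i = j, m i) * ((2 : ℝ) ^ j) ^ (-q) := by rw [Finset.sum_mul]
    _ ≤ (K * (1 + ((2 : ℝ) ^ (j + 1) - 1)) ^ p) * ((2 : ℝ) ^ j) ^ (-q) := by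
        refine mul_le_mul_of_nonneg_right (h _ ?_ _ fun i hi => ?_) (by positivity)
        · linarith [one_le_pow₀ (M₀ := ℝ) (n := j + 1) (one_le_two)]
        · have hi := (Finset.mem_filter.1 hi).2
          have := hup i
          rw [hi] at this
          linarith
    _ = K * 2 ^ p * ((2 : ℝ) ^ (p - q)) ^ j := by
        rw [add_sub_cancel, pow_succ, Real.mul_rpow (by positivity) (by norm_num),
          ← Real.rpow_natCast 2 j, ← Real.rpow_mul (by norm_num), ← Real.rpow_mul (by norm_num),
          ← Real.rpow_natCast _ j, ← Real.rpow_mul (by norm_num)]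
        have : (2 : ℝ) ^ ((p - q) * j) = 2 ^ (j * p) * 2 ^ (j * -q) := by
          rw [← Real.rpow_add (by norm_num)]; ring_nf
        rw [this]; ring

/-- A variant of the Borel–Carathéodory theorem for the logarithmic derivative of a function
without zeros in a ball. -/
theorem norm_logDeriv_sub_le {g : ℂ → ℂ} (hg : Differentiable ℂ g) {R M : ℝ} (hR : 0 < R)
    (hM : 0 < M) (hne : ∀ z ∈ ball (0 : ℂ) R, g z ≠ 0)
    (hb : ∀ z ∈ ball (0 : ℂ) R, ‖g z‖ ≤ ‖g 0‖ * Real.exp M) {s : ℂ} (hs : ‖s‖ < R / 4) :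
    ‖logDeriv g s - logDeriv g 0‖ ≤ 64 * M / R ^ 2 * ‖s‖ := by
  have hdl : DifferentiableOn ℂ (logDeriv g) (ball 0 R) := fun z hz =>
    ((hg.deriv z).div (hg z) (hne z hz)).differentiableWithinAt
  -- L is the branch of log (g / g 0) vanishing at 0; the bound on g says Re L ≤ M.
  obtain ⟨L, hL0, hL⟩ := hdl.isExactOn_ball.with_val_at 0 0
  have h0 : (0 : ℂ) ∈ ball (0 : ℂ) R := by simpa using hR
  have hexp : ∀ z ∈ ball (0 : ℂ) R, g z = g 0 * exp (L z) := by
    have hd : ∀ z ∈ ball (0 : ℂ) R, HasDerivAt (fun z => g z * exp (-L z)) 0 z := by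
      intro z hz
      have := (hg z).hasDerivAt.mul ((hL z hz).neg.cexp)
      refine this.congr_deriv ?_
      rw [logDeriv_apply]
      field_simp [hne z hz]
      ring
    intro z hz
    have := (convex_ball (0 : ℂ) R).is_const_of_fderivWithin_eq_zero (𝕜 := ℂ)
      (f := fun z => g z * exp (-L z))
      (fun z hz => (hd z hz).differentiableAt.differentiableWithinAt) (fun z hz => ?_) hz h0
    · simp only [hL0, neg_zero, exp_zero, mul_one] at this
      rw [← this, mul_assoc, ← exp_add]; simp
    · rw [fderivWithin_of_isOpen isOpen_ball hz]
      ext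
      simpa using (hd z hz).deriv
  have hLd : DifferentiableOn ℂ L (ball 0 R) :=
    fun z hz => (hL z hz).differentiableAt.differentiableWithinAt
  have hg0 : 0 < ‖g 0‖ := norm_pos_iff.2 (hne 0 h0)
  have hre : Set.MapsTo L (ball 0 R) {z | z.re ≤ M} := by
    intro z hz
    have h1 := hb z hz
    rw [hexp z hz, norm_mul, norm_exp] at h1
    exact Real.exp_le_exp.1 (le_of_mul_le_mul_left h1 hg0)
  -- Borel–Carathéodory bounds |L| by 2M on radius R/2, Cauchy's estimate bounds L' by 8M/R on
  -- radius R/4, and the Schwarz lemma for L' - L' 0 yields the factor 16M/R divided by R/4.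
  have hLb : ∀ z, ‖z‖ ≤ R / 2 → ‖L z‖ ≤ 2 * M := by
    intro z hz
    refine (borelCaratheodory_zero hM hLd hre hR (by simp; linarith) hL0).trans ?_
    rw [div_le_iff₀ (by linarith)]
    nlinarith
  have hderiv : ∀ z ∈ ball (0 : ℂ) (R / 4), ‖logDeriv g z‖ ≤ 8 * M / R := by
    intro z hz
    have hz' : ‖z‖ < R / 4 := by simpa using hz
    have hzR : z ∈ ball (0 : ℂ) R := by simp; linarith
    rw [← (hL z hzR).deriv]
    have := Complex.norm_deriv_le_of_forall_mem_sphere_norm_le (f := L) (c := z) (R := R / 4)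
      (C := 2 * M) (by linarith) ?_ ?_
    · refine this.trans (le_of_eq ?_); field_simp; ring
    · refine (hLd.mono ?_).diffContOnCl
      rw [closure_ball _ (by linarith)]
      intro w hw
      have : ‖w - z‖ ≤ R / 4 := by simpa [dist_eq_norm] using hw
      have := norm_add_le (w - z) z
      simp at this ⊢
      linarith
    · intro w hw
      have : ‖w - z‖ = R / 4 := by simpa [dist_eq_norm] using hw
      have := norm_add_le (w - z) z
      simp at this
      exact hLb w (by linarith)
  have hR4 : (0 : ℝ) < R / 4 := by linarith
  have := Complex.dist_le_div_mul_dist_of_mapsTo_ball (f := logDeriv g) (c := 0) (z := s)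
    (R₁ := R / 4) (R₂ := 16 * M / R) (hdl.mono (ball_subset_ball (by linarith)))
    (fun z hz => ?_) (by simpa using hs)
  · rw [dist_eq_norm, dist_zero_right] at this
    refine this.trans (le_of_eq ?_)
    field_simp; ring
  · rw [mem_closedBall, dist_eq_norm]
    refine (norm_sub_le _ _).trans ?_
    have h1 := hderiv z hz
    have h2 := hderiv 0 (by simpa using hR4)
    calc _ ≤ 8 * M / R + 8 * M / R := add_le_add h1 h2
      _ = _ := by ring

theorem analyticOrderNatAt_ne_zero_of_eq_zero {f : ℂ → ℂ} (hf : Differentiable ℂ f)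
    (h0 : f 0 ≠ 0) {z : ℂ} (hz : f z = 0) : analyticOrderNatAt f z ≠ 0 := by
  have h1 := (hf.analyticAt z).analyticOrderAt_ne_zero.2 hz
  have h2 := hf.analyticOrderAt_ne_top h0 z
  rw [analyticOrderNatAt, ne_eq, ENat.toNat_eq_zero]
  tauto

/-- The zeros of an entire function of finite order are summable with multiplicity. -/
theorem summable_analyticOrderNatAt_mul_rpow {f : ℂ → ℂ} (hf : Differentiable ℂ f)
    (h0 : f 0 ≠ 0) {p q C : ℝ} (hp : 0 ≤ p) (hpq : p < q) (hC : 0 ≤ C)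
    (hb : ∀ z, ‖f z‖ ≤ Real.exp (C * (1 + ‖z‖) ^ p)) :
    Summable fun z : ℂ => (analyticOrderNatAt f z : ℝ) * (1 + ‖z‖) ^ (-q) := by
  obtain ⟨K, -, hK⟩ := exists_sum_analyticOrderNatAt_le hf h0 hp hC hb
  exact summable_mul_rpow_of_sum_le (fun _ => Nat.cast_nonneg _) (fun _ => norm_nonneg _)
    (hp.trans hpq.le) hpq hK

theorem finite_zeros_norm_le {f : ℂ → ℂ} (hf : Differentiable ℂ f)
    (h0 : f 0 ≠ 0) (R : ℝ) : {z : {z // f z = 0} | ‖(z : ℂ)‖ ≤ R}.Finite := by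
  have hA : AnalyticOnNhd ℂ f Set.univ := fun x _ => hf.analyticAt x
  have h1 := hA.preimage_zero_mem_codiscreteWithin (x := 0) h0 (Set.mem_univ _) isConnected_univ
  have h2 := mem_codiscrete'.1 h1
  have h3 : (closedBall (0 : ℂ) R ∩ {z | f z = 0}).Finite := by
    have e : (f ⁻¹' {0}ᶜ)ᶜ = {z | f z = 0} := by ext; simp
    rw [e] at h2
    refine ((isCompact_closedBall 0 R).inter_right ?_).finite (h2.2.mono Set.inter_subset_right)
    exact isClosed_singleton.preimage hf.continuous
  refine Set.Finite.of_finite_image (f := Subtype.val) (h3.subset ?_)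
    Subtype.val_injective.injOn
  rintro _ ⟨z, hz, rfl⟩
  exact ⟨by simpa using hz, z.2⟩

/-- The partial fraction expansion of the logarithmic derivative of an entire function of order
less than two. -/
theorem hasSum_logDeriv_sub {f : ℂ → ℂ} (hf : Differentiable ℂ f)
    (h0 : f 0 ≠ 0) {p C : ℝ} (hp : 0 ≤ p) (hp2 : p < 2) (hC : 0 < C)
    (hb : ∀ z, ‖f z‖ ≤ Real.exp (C * (1 + ‖z‖) ^ p)) {s : ℂ} (hs : f s ≠ 0) :
    HasSum (fun z : {z // f z = 0} => (analyticOrderNatAt f z : ℂ) * (1 / (s - z) + 1 / z))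
      (logDeriv f s - logDeriv f 0) := by
  classical
  have hz0 : ∀ z : {z // f z = 0}, (z : ℂ) ≠ 0 := fun z h => h0 (by
    have := z.2; rwa [h] at this)
  have hzs : ∀ z : {z // f z = 0}, s - (z : ℂ) ≠ 0 := fun z h => hs (by
    rw [sub_eq_zero.1 h]; exact z.2)
  have hsum : Summable fun z : {z // f z = 0} =>
      (analyticOrderNatAt f z : ℂ) * (1 / (s - z) + 1 / z) := by
    have h1 := (summable_analyticOrderNatAt_mul_rpow hf h0 hp hp2 hC.le hb).comp_injective
      (Subtype.val_injective (p := fun z => f z = 0))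
    refine Summable.of_norm_bounded_eventually (h1.mul_left (8 * ‖s‖)) ?_
    rw [Filter.eventually_cofinite]
    -- Outside this disc |s - z| ≥ |z|/2, so the term s/((s-z)z) is at most 8|s|/(1+|z|)², summable
    -- since p < 2. The finitely many zeros inside do not matter.
    refine (finite_zeros_norm_le hf h0 (1 + 2 * ‖s‖)).subset fun z hz => ?_
    by_contra hlt
    refine hz ?_
    have hlt : 1 + 2 * ‖s‖ < ‖(z : ℂ)‖ := by simpa using hlt
    have hn := norm_nonneg s
    have e1 : (1 / (s - z) + 1 / z : ℂ) = s / ((s - z) * z) := by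
      field_simp [hz0 z, hzs z]; ring
    have h2 : ‖(z : ℂ)‖ / 2 ≤ ‖s - z‖ := by
      have := norm_sub_norm_le (z : ℂ) s
      rw [norm_sub_rev] at this
      linarith
    simp only [Function.comp]
    rw [norm_mul, e1, norm_div, norm_mul, Complex.norm_natCast]
    have h3 : (1 + ‖(z : ℂ)‖) ^ (-2 : ℝ) = 1 / (1 + ‖(z : ℂ)‖) ^ 2 := by
      rw [Real.rpow_neg (by positivity)]; norm_num
    rw [h3]
    have h4 : ‖s‖ / (‖s - z‖ * ‖(z : ℂ)‖) ≤ 8 * ‖s‖ * (1 / (1 + ‖(z : ℂ)‖) ^ 2) := by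
      have hp1 : 0 < ‖s - z‖ * ‖(z : ℂ)‖ := mul_pos (by linarith) (by linarith)
      rw [mul_one_div, div_le_div_iff₀ hp1 (by positivity)]
      have : (1 + ‖(z : ℂ)‖) ^ 2 ≤ 8 * (‖s - z‖ * ‖(z : ℂ)‖) := by nlinarith
      nlinarith
    calc _ ≤ (analyticOrderNatAt f z : ℝ) * (8 * ‖s‖ * (1 / (1 + ‖(z : ℂ)‖) ^ 2)) := by gcongr
      _ = _ := by ring
  set S : ℕ → Finset {z // f z = 0} := fun n => (finite_zeros_norm_le hf h0 n).toFinset with hS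
  have hSt : Tendsto S atTop atTop := by
    refine tendsto_atTop_finset_of_monotone (fun m n hmn z hz => ?_) fun z => ?_
    · simp only [hS, Set.Finite.mem_toFinset, Set.mem_ofPred_eq] at hz ⊢
      exact hz.trans (by exact_mod_cast hmn)
    · obtain ⟨n, hn⟩ := exists_nat_ge ‖(z : ℂ)‖
      exact ⟨n, by simpa [hS] using hn⟩
  have hlim := hsum.hasSum.comp hSt
  -- Summability is already known, so the value of the sum may be computed along the discs |z| ≤ n.
  suffices hlim2 : Tendsto (fun n => ∑ z ∈ S n, (analyticOrderNatAt f z : ℂ) *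
      (1 / (s - z) + 1 / z)) atTop (𝓝 (logDeriv f s - logDeriv f 0)) by
    have := tendsto_nhds_unique hlim hlim2
    rw [← this]; exact hsum.hasSum
  rw [tendsto_iff_norm_sub_tendsto_zero]
  -- The constant c makes 1 ≤ |f 0| e^c, which turns an absolute bound for the quotient g into one
  -- relative to |g 0| = |f 0|.
  set c := |Real.log ‖f 0‖| with hc
  have hlim3 : Tendsto (fun n : ℕ => 64 * (C * (1 + 3 * (n : ℝ)) ^ p + c) / (n : ℝ) ^ 2 * ‖s‖)
      atTop (𝓝 0) := by
    have h1 : Tendsto (fun n : ℕ => 64 * (C * 4 ^ p + c) * ‖s‖ * (n : ℝ) ^ (-(2 - p)))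
        atTop (𝓝 0) := by
      simpa using ((tendsto_rpow_neg_atTop (by linarith : 0 < 2 - p)).comp
        tendsto_natCast_atTop_atTop).const_mul (64 * (C * 4 ^ p + c) * ‖s‖)
    refine squeeze_zero' (Eventually.of_forall fun _ => by positivity) ?_ h1
    filter_upwards [eventually_ge_atTop 1] with n hn
    have hn1 : (1 : ℝ) ≤ n := by exact_mod_cast hn
    have hn0 : (0 : ℝ) < n := by linarith
    have h2 : (1 + 3 * (n : ℝ)) ^ p ≤ 4 ^ p * (n : ℝ) ^ p := by
      rw [← Real.mul_rpow (by norm_num) hn0.le]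
      exact Real.rpow_le_rpow (by positivity) (by linarith) hp
    have h3 : c ≤ c * (n : ℝ) ^ p :=
      le_mul_of_one_le_right (abs_nonneg _) (Real.one_le_rpow hn1 hp)
    have h4 : (n : ℝ) ^ (-(2 - p)) = (n : ℝ) ^ p / (n : ℝ) ^ 2 := by
      rw [neg_sub, Real.rpow_sub hn0]; norm_num
    rw [h4]
    calc 64 * (C * (1 + 3 * (n : ℝ)) ^ p + c) / (n : ℝ) ^ 2 * ‖s‖
        ≤ 64 * (C * (4 ^ p * (n : ℝ) ^ p) + c * (n : ℝ) ^ p) / (n : ℝ) ^ 2 * ‖s‖ := by gcongr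
      _ = _ := by ring
  refine squeeze_zero' (Eventually.of_forall fun _ => norm_nonneg _) ?_ hlim3
  filter_upwards [eventually_gt_atTop 0, eventually_gt_atTop ⌈4 * ‖s‖⌉₊] with n hn0 hns
  have hnR : (0 : ℝ) < n := by exact_mod_cast hn0
  have hsn : ‖s‖ < n / 4 := by
    have := (Nat.le_ceil (4 * ‖s‖)).trans_lt (Nat.cast_lt.2 hns)
    linarith
  set T : Finset ℂ := (S n).map (Function.Embedding.subtype _) with hT
  have hTmem : ∀ ρ, ρ ∈ T ↔ f ρ = 0 ∧ ‖ρ‖ ≤ n := by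
    intro ρ; simp [hT, hS, and_comm]
  have hT0 : (0 : ℂ) ∉ T := fun h => h0 ((hTmem 0).1 h).1
  obtain ⟨g, hg, hfg, hgT⟩ := hf.exists_eq_prod_mul h0 T hT0
  have hg0 : g 0 = f 0 := by rw [hfg 0]; simp
  have hfp : 0 < ‖f 0‖ := norm_pos_iff.2 h0
  have hgb : ∀ z ∈ ball (0 : ℂ) n,
      ‖g z‖ ≤ ‖g 0‖ * Real.exp (C * (1 + 3 * (n : ℝ)) ^ p + c) := by
    intro z hz
    have hz : ‖z‖ < n := by simpa using hz
    have := two_pow_mul_norm_le_of_eq_prod_mul hg hnR hT0 (fun ρ hρ => ((hTmem ρ).1 hρ).2) hfg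
      (M := Real.exp (C * (1 + 3 * (n : ℝ)) ^ p)) (fun w hw => by rw [← hw]; exact hb w)
      (z := z) (by linarith)
    have h1 : ‖g z‖ ≤ Real.exp (C * (1 + 3 * (n : ℝ)) ^ p) :=
      (le_mul_of_one_le_left (norm_nonneg _) (one_le_pow₀ one_le_two)).trans this
    have h2 : 1 ≤ ‖f 0‖ * Real.exp c := by
      rw [← Real.exp_log hfp, ← Real.exp_add]
      refine Real.one_le_exp ?_
      linarith [neg_abs_le (Real.log ‖f 0‖)]
    rw [hg0, Real.exp_add]
    calc _ ≤ Real.exp (C * (1 + 3 * (n : ℝ)) ^ p) * 1 := by linarith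
      _ ≤ Real.exp (C * (1 + 3 * (n : ℝ)) ^ p) * (‖f 0‖ * Real.exp c) := by gcongr
      _ = _ := by ring
  have hgne : ∀ z ∈ ball (0 : ℂ) n, g z ≠ 0 := by
    intro z hz h
    have hz : ‖z‖ < n := by simpa using hz
    have hfz : f z = 0 := by rw [hfg, h, mul_zero]
    exact hgT z ((hTmem z).2 ⟨hfz, hz.le⟩) h
  have hMpos : 0 < C * (1 + 3 * (n : ℝ)) ^ p + c := by positivity
  have hmain := norm_logDeriv_sub_le hg hnR hMpos hgne hgb hsn
  -- The logarithmic derivative of f is the finite sum over T plus that of g. Subtracting its value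
  -- at 0 leaves the partial sum plus the variation of the logarithmic derivative of g, which
  -- `hmain` controls.
  have hld : ∀ w, f w ≠ 0 → logDeriv f w =
      ∑ ρ ∈ T, (analyticOrderNatAt f ρ : ℂ) * (1 / (w - ρ)) + logDeriv g w := by
    intro w hw
    have hfeq : f = fun z => (∏ ρ ∈ T, (1 - z / ρ) ^ analyticOrderNatAt f ρ) * g z := funext hfg
    have hPw : (∏ ρ ∈ T, (1 - w / ρ) ^ analyticOrderNatAt f ρ) ≠ 0 := by
      intro h; exact hw (by rw [hfg, h, zero_mul])
    have hgw : g w ≠ 0 := by intro h; exact hw (by rw [hfg, h, mul_zero])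
    have hPd : DifferentiableAt ℂ (fun z => ∏ ρ ∈ T, (1 - z / ρ) ^ analyticOrderNatAt f ρ) w :=
      DifferentiableAt.fun_finsetProd (fun i _ => by fun_prop)
    conv_lhs => rw [hfeq]
    rw [logDeriv_mul w hPw hgw hPd (hg w), logDeriv_prod (Finset.prod_ne_zero_iff.1 hPw)
      (fun i _ => by fun_prop)]
    congr 1
    refine Finset.sum_congr rfl fun ρ hρ => ?_
    have hρ0 : ρ ≠ 0 := fun h => hT0 (h ▸ hρ)
    have hwρ : w - ρ ≠ 0 := fun h => hw (sub_eq_zero.1 h ▸ ((hTmem ρ).1 hρ).1)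
    have hρw : ρ - w ≠ 0 := by rw [← neg_sub]; exact neg_ne_zero.2 hwρ
    rw [logDeriv_fun_pow (by fun_prop)]
    congr 1
    have hd : HasDerivAt (fun z : ℂ => 1 - z / ρ) (-(1 / ρ)) w :=
      ((hasDerivAt_id w).div_const ρ).const_sub 1
    have h1w : 1 - w / ρ ≠ 0 := by
      intro h; apply hρw; field_simp at h; simpa using h
    rw [logDeriv_apply, hd.deriv, div_eq_div_iff h1w hwρ]
    field_simp; ring
  have hsumT : ∑ z ∈ S n, (analyticOrderNatAt f z : ℂ) * (1 / (s - z) + 1 / z)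
      = ∑ ρ ∈ T, (analyticOrderNatAt f ρ : ℂ) * (1 / (s - ρ) + 1 / ρ) := by
    rw [hT, Finset.sum_map]; rfl
  rw [hsumT, norm_sub_rev]
  refine le_trans (le_of_eq ?_) hmain
  congr 1
  rw [hld s hs, hld 0 h0]
  have : ∑ ρ ∈ T, (analyticOrderNatAt f ρ : ℂ) * (1 / (s - ρ) + 1 / ρ)
      = ∑ ρ ∈ T, (analyticOrderNatAt f ρ : ℂ) * (1 / (s - ρ))
        - ∑ ρ ∈ T, (analyticOrderNatAt f ρ : ℂ) * (1 / (0 - ρ)) := by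
    rw [← Finset.sum_sub_distrib]
    refine Finset.sum_congr rfl fun ρ _ => ?_
    rw [zero_sub, one_div_neg_eq_neg_one_div]; ring
  rw [this]; ring

/-! ### The growth of (s - 1) ζ(s) -/

/-- The `n`-th term of a series for `(s - 1) ζ(s) - 1` that converges for `0 < re s`. -/
noncomputable def zetaTerm (n : ℕ) (s : ℂ) : ℂ :=
  (s - 1) * ((n : ℂ) + 1) ^ (-s) + (((n : ℂ) + 2) ^ (1 - s) - ((n : ℂ) + 1) ^ (1 - s))

/-- With F(x) = x^(1-s), the term is the Taylor remainder F(n+2) - F(n+1) - F'(n+1). Two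
applications of the mean value inequality bound it by the supremum of |F''| on [n+1, n+2], which
gains a power of n over each separate piece. -/
theorem norm_zetaTerm_le (n : ℕ) {s : ℂ} (hs : 0 < s.re) :
    ‖zetaTerm n s‖ ≤ ‖s‖ * ‖s - 1‖ * ((n : ℝ) + 1) ^ (-s.re - 1) := by
  have hn : (0 : ℝ) < (n : ℝ) + 1 := by positivity
  set K := ‖s‖ * ‖s - 1‖ * ((n : ℝ) + 1) ^ (-s.re - 1) with hK
  have hpos : ∀ x ∈ Set.Icc ((n : ℝ) + 1) (n + 2), 0 < x := fun x hx => hn.trans_le hx.1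
  have hd1 : ∀ x ∈ Set.Icc ((n : ℝ) + 1) (n + 2), HasDerivAt (fun x : ℝ => (x : ℂ) ^ (1 - s))
      ((1 - s) * (x : ℂ) ^ (-s)) x := by
    intro x hx
    rcases eq_or_ne (1 - s) 0 with h | h
    · simp only [h, cpow_zero, zero_mul]; exact hasDerivAt_const x (1 : ℂ)
    · have := hasDerivAt_ofReal_cpow_const (hpos x hx).ne' h
      rwa [show 1 - s - 1 = -s by ring] at this
  have hd2 : ∀ x ∈ Set.Icc ((n : ℝ) + 1) (n + 2), HasDerivAt (fun x : ℝ => (1 - s) * (x : ℂ) ^ (-s))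
      ((1 - s) * (-s * (x : ℂ) ^ (-s - 1))) x := by
    intro x hx
    have hs0 : s ≠ 0 := by rintro rfl; simp at hs
    exact (hasDerivAt_ofReal_cpow_const (hpos x hx).ne' (neg_ne_zero.2 hs0)).const_mul (1 - s)
  have hb2 : ∀ x ∈ Set.Icc ((n : ℝ) + 1) (n + 2), ‖(1 - s) * (-s * (x : ℂ) ^ (-s - 1))‖ ≤ K := by
    intro x hx
    rw [norm_mul, norm_mul, norm_neg, Complex.norm_cpow_eq_rpow_re_of_pos (hpos x hx),
      norm_sub_rev, hK, mul_left_comm, ← mul_assoc]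
    refine mul_le_mul_of_nonneg_left ?_ (by positivity)
    simp only [sub_re, neg_re, one_re]
    exact Real.rpow_le_rpow_of_nonpos hn hx.1 (by linarith)
  have hmem : ((n : ℝ) + 1) ∈ Set.Icc ((n : ℝ) + 1) (n + 2) := ⟨le_rfl, by linarith⟩
  have hmem2 : ((n : ℝ) + 2) ∈ Set.Icc ((n : ℝ) + 1) (n + 2) := ⟨by linarith, le_rfl⟩
  have hb1 : ∀ x ∈ Set.Icc ((n : ℝ) + 1) (n + 2),
      ‖(1 - s) * (x : ℂ) ^ (-s) - (1 - s) * (((n : ℝ) + 1 : ℝ) : ℂ) ^ (-s)‖ ≤ K := by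
    intro x hx
    have := (convex_Icc ((n : ℝ) + 1) (n + 2)).norm_image_sub_le_of_norm_hasDerivWithin_le
      (fun x hx => (hd2 x hx).hasDerivWithinAt) hb2 hmem hx
    refine this.trans (mul_le_of_le_one_right (by positivity) ?_)
    rw [Real.norm_eq_abs, abs_of_nonneg (by linarith [hx.1])]
    linarith [hx.2]
  have := (convex_Icc ((n : ℝ) + 1) (n + 2)).norm_image_sub_le_of_norm_hasDerivWithin_le
    (fun x hx => ((hd1 x hx).sub ((hasDerivAt_id x).ofReal_comp.const_mul
      ((1 - s) * (((n : ℝ) + 1 : ℝ) : ℂ) ^ (-s)))).hasDerivWithinAt)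
      (fun x hx => by simpa using hb1 x hx) hmem hmem2
  have e : (n : ℝ) + 2 - (n + 1) = 1 := by ring
  rw [e, norm_one, mul_one] at this
  refine le_trans (le_of_eq ?_) this
  congr 1
  rw [zetaTerm]
  simp only [Pi.sub_apply, id]
  push_cast
  ring

theorem differentiable_zetaTerm (n : ℕ) : Differentiable ℂ (zetaTerm n) := by
  intro s
  have h1 : (n : ℂ) + 1 ≠ 0 := by exact_mod_cast Nat.succ_ne_zero n
  have h2 : (n : ℂ) + 2 ≠ 0 := by exact_mod_cast Nat.succ_ne_zero (n + 1)
  unfold zetaTerm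
  refine ((differentiableAt_id.sub_const _).mul ?_).add (DifferentiableAt.sub ?_ ?_)
  · exact differentiableAt_id.neg.const_cpow (Or.inl h1)
  · exact (differentiableAt_id.const_sub _).const_cpow (Or.inl h2)
  · exact (differentiableAt_id.const_sub _).const_cpow (Or.inl h1)

/-- The first part sums to (s-1)ζ(s); the differences telescope to -1 because N^(1-s) → 0. -/
theorem hasSum_zetaTerm_of_one_lt_re {s : ℂ} (hs : 1 < s.re) :
    HasSum (fun n => zetaTerm n s) (riemannZeta₁ s - 1) := by
  have hs1 : s ≠ 1 := by rintro rfl; simp at hs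
  have h1 : HasSum (fun n : ℕ => (s - 1) * ((n : ℂ) + 1) ^ (-s)) ((s - 1) * riemannZeta s) := by
    refine HasSum.mul_left _ ?_
    rw [zeta_eq_tsum_one_div_nat_add_one_cpow hs]
    have := (Complex.summable_one_div_nat_cpow.2 hs)
    have := ((summable_nat_add_iff 1).2 this).hasSum
    simpa [cpow_neg] using this
  have h2 : HasSum (fun n : ℕ => ((n : ℂ) + 2) ^ (1 - s) - ((n : ℂ) + 1) ^ (1 - s)) (0 - 1) := by
    have hT : Summable fun n => zetaTerm n s := by
      have hu : Summable fun n : ℕ => ‖s‖ * ‖s - 1‖ * ((n : ℝ) + 1) ^ (-s.re - 1) := by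
        have h := (summable_nat_add_iff 1).2 (Real.summable_nat_rpow.2
          (by linarith : (-s.re - 1 : ℝ) < -1))
        simpa using h.mul_left (‖s‖ * ‖s - 1‖)
      exact Summable.of_norm_bounded hu fun n => norm_zetaTerm_le n (by linarith)
    have hsm : Summable fun n : ℕ => ((n : ℂ) + 2) ^ (1 - s) - ((n : ℂ) + 1) ^ (1 - s) := by
      refine (hT.sub h1.summable).congr fun n => ?_
      rw [zetaTerm]; ring
    have hlim : Tendsto (fun N : ℕ => ((N : ℂ) + 1) ^ (1 - s) - 1) atTop (𝓝 (0 - 1)) := by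
      refine Tendsto.sub_const ?_ 1
      rw [tendsto_zero_iff_norm_tendsto_zero]
      have h3 := (tendsto_rpow_neg_atTop (by linarith : 0 < s.re - 1)).comp
        (tendsto_natCast_atTop_atTop.comp (tendsto_add_atTop_nat 1))
      refine h3.congr fun N => ?_
      have : ((N : ℂ) + 1) = (((N + 1 : ℕ) : ℝ) : ℂ) := by push_cast; rfl
      rw [this, Complex.norm_cpow_eq_rpow_re_of_pos (by positivity)]
      simp
    have h4 := hsm.hasSum.tendsto_sum_nat
    have h5 : ∀ N : ℕ, ∑ n ∈ Finset.range N, (((n : ℂ) + 2) ^ (1 - s) - ((n : ℂ) + 1) ^ (1 - s))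
        = ((N : ℂ) + 1) ^ (1 - s) - 1 := by
      intro N
      have := Finset.sum_range_sub (fun n : ℕ => ((n : ℂ) + 1) ^ (1 - s)) N
      simp only [Nat.cast_zero, zero_add, one_cpow] at this
      rw [← this]
      refine Finset.sum_congr rfl fun n _ => ?_
      push_cast; ring_nf
    simp_rw [h5] at h4
    rw [← tendsto_nhds_unique h4 hlim]
    exact hsm.hasSum
  have := h1.add h2
  have e : (s - 1) * riemannZeta s + (0 - 1) = riemannZeta₁ s - 1 := by
    rw [riemannZeta_eq_inv_sub_mul hs1, mul_inv_cancel_left₀ (sub_ne_zero.2 hs1)]; ring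
  rw [e] at this
  exact this

/-- Analytic continuation: the series converges locally uniformly on Re s > 1/4, so the identity
theorem extends the formula from Re s > 1. -/
theorem hasSum_zetaTerm {s : ℂ} (hs : 1 / 2 ≤ s.re) :
    HasSum (fun n => zetaTerm n s) (riemannZeta₁ s - 1) := by
  set R := ‖s‖ + 3 with hR
  have hRp : 0 < R := by positivity
  set U : Set ℂ := {z | 1 / 4 < z.re} ∩ ball 0 R with hU
  have hUo : IsOpen U := (isOpen_lt continuous_const continuous_re).inter isOpen_ball
  have hUc : IsPreconnected U :=
    ((convex_halfSpace_re_gt _).inter (convex_ball _ _)).isPreconnected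
  have hu : Summable fun n : ℕ => R * (R + 1) * ((n : ℝ) + 1) ^ (-(5 / 4) : ℝ) := by
    have h := (summable_nat_add_iff 1).2 (Real.summable_nat_rpow.2
      (by norm_num : (-(5 / 4) : ℝ) < -1))
    simpa using h.mul_left (R * (R + 1))
  have hle : ∀ (n : ℕ) (w : ℂ), w ∈ U →
      ‖zetaTerm n w‖ ≤ R * (R + 1) * ((n : ℝ) + 1) ^ (-(5 / 4) : ℝ) := by
    intro n w hw
    have hw1 : 1 / 4 < w.re := hw.1
    have hw2 : ‖w‖ < R := by simpa using hw.2
    refine (norm_zetaTerm_le n (by linarith)).trans ?_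
    gcongr
    · refine (norm_sub_le _ _).trans ?_
      rw [norm_one]; linarith
    · linarith [Nat.cast_nonneg (α := ℝ) n]
    · linarith
  have hd := differentiableOn_tsum_of_summable_norm hu
    (fun n => (differentiable_zetaTerm n).differentiableOn) hUo hle
  have hA1 := hd.analyticOnNhd hUo
  have hA2 : AnalyticOnNhd ℂ (fun z => riemannZeta₁ z - 1) U := fun z _ =>
    (differentiable_riemannZeta₁.sub_const 1).analyticAt z
  have h2U : (2 : ℂ) ∈ U := by
    refine ⟨by simp; norm_num, ?_⟩
    simp [hR]; linarith [norm_nonneg s]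
  have hsU : s ∈ U := ⟨by simp; linarith, by simp [hR]⟩
  have heq := hA1.eqOn_of_preconnected_of_eventuallyEq hA2 hUc h2U (by
    have : {z : ℂ | 1 < z.re} ∈ 𝓝 (2 : ℂ) :=
      (isOpen_lt continuous_const continuous_re).mem_nhds (by simp)
    filter_upwards [this] with z hz using (hasSum_zetaTerm_of_one_lt_re hz).tsum_eq)
  have hsm : Summable fun n => zetaTerm n s := Summable.of_norm_bounded hu fun n => hle n s hsU
  have he : ∑' n, zetaTerm n s = riemannZeta₁ s - 1 := heq hsU
  rw [← he]
  exact hsm.hasSum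

theorem exists_norm_riemannZeta₁_le : ∃ A : ℝ, 0 ≤ A ∧ ∀ s : ℂ, 1 / 2 ≤ s.re →
    ‖riemannZeta₁ s‖ ≤ 1 + A * (‖s‖ * ‖s - 1‖) := by
  have hsm : Summable fun n : ℕ => ((n : ℝ) + 1) ^ (-(3 / 2) : ℝ) := by
    have h := (summable_nat_add_iff 1).2 (Real.summable_nat_rpow.2
      (by norm_num : (-(3 / 2) : ℝ) < -1))
    simpa using h
  refine ⟨∑' n : ℕ, ((n : ℝ) + 1) ^ (-(3 / 2) : ℝ), tsum_nonneg fun n => by positivity,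
    fun s hs => ?_⟩
  have h1 := hasSum_zetaTerm hs
  have h2 := tsum_of_norm_bounded (f := fun n => zetaTerm n s)
    ((hsm.mul_left (‖s‖ * ‖s - 1‖)).hasSum) (fun n => by
      refine (norm_zetaTerm_le n (by linarith)).trans ?_
      gcongr
      · linarith [Nat.cast_nonneg (α := ℝ) n]
      · linarith)
  rw [h1.tsum_eq, tsum_mul_left] at h2
  calc ‖riemannZeta₁ s‖ = ‖1 + (riemannZeta₁ s - 1)‖ := by congr 1; ring
    _ ≤ 1 + ‖riemannZeta₁ s - 1‖ := by
      refine (norm_add_le _ _).trans ?_; rw [norm_one]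
    _ ≤ _ := by linarith

theorem Complex.norm_Gamma_le_of_re_pos {s : ℂ} (hs : 0 < s.re) :
    ‖Gamma s‖ ≤ Real.Gamma s.re := by
  rw [Gamma_eq_integral hs, Real.Gamma_eq_integral hs, GammaIntegral]
  refine (MeasureTheory.norm_integral_le_integral_norm _).trans (le_of_eq ?_)
  refine MeasureTheory.setIntegral_congr_fun measurableSet_Ioi fun x hx => ?_
  simp only [norm_mul]
  rw [Complex.norm_cpow_eq_rpow_re_of_pos hx, Complex.norm_real,
    Real.norm_of_nonneg (Real.exp_pos _).le]
  simp

theorem Real.Gamma_le_exp_of_half_le {x : ℝ} (hx : 1 / 2 ≤ x) :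
    Real.Gamma x ≤ 4 / 3 * Real.exp ((x + 2) * Real.log (x + 2)) := by
  have hx0 : 0 < x := by linarith
  have h1 : Real.Gamma (x + 2) = (x + 1) * (x * Real.Gamma x) := by
    rw [← Real.Gamma_add_one hx0.ne', show x + 2 = (x + 1) + 1 by ring,
      Real.Gamma_add_one (by linarith)]
  have h2 : Real.Gamma (x + 2) ≤ Real.Gamma ((⌈x⌉₊ + 1 : ℕ) + 1) := by
    refine Real.Gamma_strictMonoOn_Ici.monotoneOn ?_ ?_ ?_
    · simp; linarith
    · simp only [Set.mem_Ici]; push_cast; linarith [Nat.cast_nonneg (α := ℝ) ⌈x⌉₊]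
    · push_cast; linarith [Nat.le_ceil x]
  rw [Real.Gamma_nat_eq_factorial] at h2
  have h3 : ((⌈x⌉₊ + 1).factorial : ℝ) ≤ Real.exp ((x + 2) * Real.log (x + 2)) := by
    have h4 : ((⌈x⌉₊ + 1).factorial : ℝ) ≤ ((⌈x⌉₊ + 1 : ℕ) : ℝ) ^ (⌈x⌉₊ + 1) := by
      exact_mod_cast Nat.factorial_le_pow _
    refine h4.trans ?_
    have h5 : ((⌈x⌉₊ + 1 : ℕ) : ℝ) ≤ x + 2 := by
      push_cast; linarith [Nat.ceil_lt_add_one hx0.le]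
    calc ((⌈x⌉₊ + 1 : ℕ) : ℝ) ^ (⌈x⌉₊ + 1) ≤ (x + 2) ^ (⌈x⌉₊ + 1) := by gcongr
      _ = (x + 2) ^ ((⌈x⌉₊ + 1 : ℕ) : ℝ) := (Real.rpow_natCast _ _).symm
      _ ≤ (x + 2) ^ (x + 2) := Real.rpow_le_rpow_of_exponent_le (by linarith) h5
      _ = _ := by rw [Real.rpow_def_of_pos (by linarith), mul_comm]
  have hG : 0 ≤ Real.Gamma x := (Real.Gamma_pos_of_pos hx0).le
  have h6 : 3 / 4 * Real.Gamma x ≤ (x + 1) * (x * Real.Gamma x) := by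
    nlinarith [mul_nonneg hG (by linarith : 0 ≤ x - 1 / 2),
      mul_nonneg (mul_nonneg hG (by linarith : 0 ≤ x - 1 / 2)) hx0.le]
  linarith

theorem Complex.norm_cos_le_exp (z : ℂ) : ‖cos z‖ ≤ Real.exp ‖z‖ := by
  rw [cos]
  have h1 : ‖exp (z * I)‖ ≤ Real.exp ‖z‖ := by
    simpa using norm_exp_le_exp_norm (z * I)
  have h2 : ‖exp (-z * I)‖ ≤ Real.exp ‖z‖ := by
    simpa using norm_exp_le_exp_norm (-z * I)
  rw [norm_div]
  have := norm_add_le (exp (z * I)) (exp (-z * I))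
  simp only [Complex.norm_ofNat]
  linarith

/-- The entire function `(s - 1) ζ(s)` has order at most one. -/
theorem exists_norm_riemannZeta₁_le_exp {p : ℝ} (hp : 1 < p) :
    ∃ C : ℝ, 0 < C ∧ ∀ s, ‖riemannZeta₁ s‖ ≤ Real.exp (C * (1 + ‖s‖) ^ p) := by
  obtain ⟨A, hA0, hA⟩ := exists_norm_riemannZeta₁_le
  obtain ⟨B, hB⟩ := (isCompact_closedBall (0 : ℂ) 1).exists_bound_of_continuousOn
    differentiable_riemannZeta₁.continuous.continuousOn
  -- D absorbs the Gamma factor: x log x with x ≤ 3r is at most (3r)^p/(p-1), by log x ≤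
  -- x^(p-1)/(p-1).
  set D := 3 ^ p / (p - 1) with hD
  have hDp : 0 < D := div_pos (by positivity) (by linarith)
  refine ⟨|B| + (A + 1) + D + 20, by positivity, fun s => ?_⟩
  set r := 1 + ‖s‖ with hr
  have hr1 : 1 ≤ r := by linarith [norm_nonneg s]
  have hrp : r ≤ r ^ p := by
    simpa using Real.rpow_le_rpow_of_exponent_le hr1 hp.le
  have hexpr : r ≤ Real.exp r := by linarith [Real.add_one_le_exp r]
  have hexpA : (1 + A * r ^ 2) ≤ Real.exp ((A + 1) * r + 2 * r) := by
    have h1 : 1 + A * r ^ 2 ≤ (A + 1) * (r * r) := by nlinarith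
    have h2 : A + 1 ≤ Real.exp ((A + 1) * r) := by
      have : A + 1 ≤ (A + 1) * r := le_mul_of_one_le_right (by linarith) hr1
      linarith [Real.add_one_le_exp ((A + 1) * r)]
    refine h1.trans ?_
    rw [Real.exp_add, two_mul r, Real.exp_add]
    gcongr
  by_cases h1 : 1 / 2 ≤ s.re
  · refine (hA s h1).trans ?_
    have h2 : ‖s - 1‖ ≤ r := by
      refine (norm_sub_le _ _).trans ?_
      rw [norm_one, hr]; linarith
    have h3 : ‖s‖ ≤ r := by linarith
    have h4 : ‖s‖ * ‖s - 1‖ ≤ r ^ 2 := by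
      rw [sq]; gcongr
    calc 1 + A * (‖s‖ * ‖s - 1‖) ≤ 1 + A * r ^ 2 := by gcongr
      _ ≤ Real.exp ((A + 1) * r + 2 * r) := hexpA
      _ ≤ _ := by
        refine Real.exp_le_exp.2 ?_
        rw [← add_mul]
        have h0 := abs_nonneg B
        exact mul_le_mul (by linarith) hrp (by linarith) (by positivity)
  · push Not at h1
    -- Near s = 0 the reflected point 1 - s meets the pole of ζ, so the unit disc is left to
    -- compactness. Outside it |w - 1| = |s| > 1 and the functional equation can be used safely.
    by_cases h2 : ‖s‖ ≤ 1
    · refine (hB s (by simpa using h2)).trans ?_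
      have h3 : B ≤ (|B| + (A + 1) + D + 20) * r ^ p := by
        have h0 := abs_nonneg B
        calc B ≤ |B| * 1 := by rw [mul_one]; exact le_abs_self B
          _ ≤ _ := mul_le_mul (by linarith) (hr1.trans hrp) (by norm_num) (by positivity)
      linarith [Real.add_one_le_exp ((|B| + (A + 1) + D + 20) * r ^ p)]
    · push Not at h2
      set w := 1 - s with hw
      have hsw : s = 1 - w := by rw [hw]; ring
      have hwre : 1 / 2 < w.re := by simp [hw]; linarith
      have hwr : ‖w‖ ≤ r := by
        refine (norm_sub_le _ _).trans ?_
        rw [norm_one]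
      have hwrer : w.re ≤ r := (Complex.re_le_norm w).trans hwr
      have hw1 : w ≠ 1 := by
        intro h; rw [hsw, h] at h2; simp at h2; linarith
      have hs1 : s ≠ 1 := by rintro rfl; simp at h1; linarith
      have hw1n : ‖w - 1‖ = ‖s‖ := by rw [hw]; simp
      have hwne : ∀ n : ℕ, w ≠ -n := by
        intro n h
        rw [h] at hwre
        simp at hwre
        linarith [Nat.cast_nonneg (α := ℝ) n]
      have hz1 : riemannZeta₁ s = (s - 1) * riemannZeta s := by
        rw [riemannZeta_eq_inv_sub_mul hs1, mul_inv_cancel_left₀ (sub_ne_zero.2 hs1)]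
      have hFE := riemannZeta_one_sub hwne hw1
      rw [← hsw, riemannZeta_eq_inv_sub_mul hw1] at hFE
      have b1 : ‖riemannZeta₁ w‖ ≤ Real.exp ((A + 1) * r + 2 * r) := by
        refine (hA w hwre.le).trans (le_trans ?_ hexpA)
        have : ‖w‖ * ‖w - 1‖ ≤ r ^ 2 := by
          rw [sq, hw1n]; gcongr; linarith
        gcongr
      have b2 : ‖(w - 1)⁻¹‖ ≤ 1 := by
        rw [norm_inv, hw1n]; exact inv_le_one_of_one_le₀ h2.le
      have b3 : ‖cos (Real.pi * w / 2)‖ ≤ Real.exp (2 * r) := by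
        refine (norm_cos_le_exp _).trans (Real.exp_le_exp.2 ?_)
        rw [norm_div, norm_mul, Complex.norm_real, Real.norm_of_nonneg Real.pi_pos.le]
        simp only [Complex.norm_ofNat]
        nlinarith [Real.pi_le_four, norm_nonneg w, Real.pi_pos]
      have b4 : ‖Gamma w‖ ≤ 4 / 3 * Real.exp (D * r ^ p) := by
        refine (norm_Gamma_le_of_re_pos (by linarith)).trans
          ((Real.Gamma_le_exp_of_half_le hwre.le).trans ?_)
        refine mul_le_mul_of_nonneg_left (Real.exp_le_exp.2 ?_) (by norm_num)
        have h3 : w.re + 2 ≤ 3 * r := by linarith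
        have h5 : Real.log (w.re + 2) ≤ (3 * r) ^ (p - 1) / (p - 1) := by
          refine (Real.log_le_log (by linarith) h3).trans ?_
          exact Real.log_le_rpow_div (by linarith) (by linarith)
        calc (w.re + 2) * Real.log (w.re + 2)
            ≤ (3 * r) * ((3 * r) ^ (p - 1) / (p - 1)) :=
              mul_le_mul h3 h5 (Real.log_nonneg (by linarith)) (by linarith)
          _ = (3 * r) ^ p / (p - 1) := by
              rw [Real.rpow_sub_one (by positivity)]; field_simp
          _ = D * r ^ p := by rw [Real.mul_rpow (by norm_num) (by linarith), hD]; ring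
      have b5 : ‖(2 * Real.pi : ℂ) ^ (-w)‖ ≤ 1 := by
        have : (2 * Real.pi : ℂ) = ((2 * Real.pi : ℝ) : ℂ) := by push_cast; rfl
        rw [this, Complex.norm_cpow_eq_rpow_re_of_pos (by positivity)]
        refine Real.rpow_le_one_of_one_le_of_nonpos ?_ (by simp; linarith)
        linarith [Real.two_le_pi]
      have b6 : ‖s - 1‖ ≤ Real.exp r := by
        have : ‖s - 1‖ = ‖w‖ := by rw [hw, norm_sub_rev]
        rw [this]; linarith
      rw [hz1, hFE]
      simp only [norm_mul, Complex.norm_ofNat]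
      calc ‖s - 1‖ * (2 * ‖(2 * Real.pi : ℂ) ^ (-w)‖ * ‖Gamma w‖ * ‖cos (Real.pi * w / 2)‖ *
            (‖(w - 1)⁻¹‖ * ‖riemannZeta₁ w‖))
          ≤ Real.exp r * (2 * 1 * (4 / 3 * Real.exp (D * r ^ p)) * Real.exp (2 * r) *
            (1 * Real.exp ((A + 1) * r + 2 * r))) := by gcongr
        _ = 8 / 3 * Real.exp (r + D * r ^ p + 2 * r + ((A + 1) * r + 2 * r)) := by
            simp only [Real.exp_add]; ring
        _ ≤ Real.exp (3 * r) * Real.exp (r + D * r ^ p + 2 * r + ((A + 1) * r + 2 * r)) := by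
            gcongr
            linarith [Real.add_one_le_exp (3 * r)]
        _ ≤ _ := by
            rw [← Real.exp_add]
            refine Real.exp_le_exp.2 ?_
            have h0 := abs_nonneg B
            nlinarith [mul_nonneg h0 (by linarith : 0 ≤ r ^ p),
              mul_nonneg hA0 (by linarith : 0 ≤ r ^ p - r)]

/-! ### The zeros of (s - 1) ζ(s) and the partial fractions of ζ'/ζ -/

theorem riemannZeta₁_zero_ne_zero : riemannZeta₁ 0 ≠ 0 := by
  have := riemannZeta_eq_inv_sub_mul (s := 0) (by norm_num)
  rw [riemannZeta_zero] at this
  intro h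
  rw [h] at this
  norm_num at this

theorem riemannZeta₁_eq_mul {s : ℂ} (hs : s ≠ 1) : riemannZeta₁ s = (s - 1) * riemannZeta s := by
  rw [riemannZeta_eq_inv_sub_mul hs, mul_inv_cancel_left₀ (sub_ne_zero.2 hs)]

theorem analyticOrderNatAt_riemannZeta₁ {ρ : ℂ} (hρ : ρ ≠ 1) :
    analyticOrderNatAt riemannZeta₁ ρ = zetaMult ρ := by
  have h1 : riemannZeta₁ =ᶠ[𝓝 ρ] (fun s => s - 1) * riemannZeta := by
    filter_upwards [isOpen_ne.mem_nhds hρ] with s hs using riemannZeta₁_eq_mul hs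
  have h2 : AnalyticAt ℂ (fun s : ℂ => s - 1) ρ := by fun_prop
  rw [zetaMult, analyticOrderNatAt, analyticOrderNatAt, analyticOrderAt_congr h1,
    analyticOrderAt_mul h2 (analyticOn_riemannZeta ρ hρ),
    h2.analyticOrderAt_eq_zero.2 (sub_ne_zero.2 hρ), zero_add]

/-- The zeros of `(s - 1) ζ(s)`. -/
theorem mem_zetaZeros_or_of_riemannZeta₁_eq_zero {z : ℂ} (hz : riemannZeta₁ z = 0) :
    z ∈ zetaZeros ∨ (z.im = 0 ∧ z.re ≤ -2) := by
  have hz1 : z ≠ 1 := by rintro rfl; simp at hz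
  have hz0 : z ≠ 0 := by rintro rfl; exact riemannZeta₁_zero_ne_zero hz
  have hζ : riemannZeta z = 0 := by rw [riemannZeta_eq_inv_sub_mul hz1, hz, mul_zero]
  have hre : z.re < 1 := by
    by_contra h
    exact riemannZeta_ne_zero_of_one_le_re (not_lt.1 h) hζ
  by_cases hpos : 0 < z.re
  · exact Or.inl ⟨hζ, hpos, hre⟩
  right
  set w := 1 - z with hw
  have hzw : z = 1 - w := by rw [hw]; ring
  have hwre : 1 ≤ w.re := by simp [hw]; linarith
  have hw1 : w ≠ 1 := by intro h; apply hz0; rw [hzw, h]; ring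
  have hwne : ∀ n : ℕ, w ≠ -n := by
    intro n h
    rw [h] at hwre
    simp at hwre
    linarith [Nat.cast_nonneg (α := ℝ) n]
  have hFE := riemannZeta_one_sub hwne hw1
  rw [← hzw, hζ] at hFE
  have h2pi : (2 * Real.pi : ℂ) ^ (-w) ≠ 0 := by
    rw [ne_eq, cpow_eq_zero_iff]
    simp [Real.pi_ne_zero]
  -- Since Re w ≥ 1, the cosine is the only factor of the functional equation that can vanish; this
  -- forces w to be an odd integer.
  have hcos : cos (Real.pi * w / 2) = 0 := by
    by_contra hc
    exact (mul_ne_zero (mul_ne_zero (mul_ne_zero (mul_ne_zero two_ne_zero h2pi)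
      (Gamma_ne_zero hwne)) hc) (riemannZeta_ne_zero_of_one_le_re hwre)) hFE.symm
  obtain ⟨k, hk⟩ := Complex.cos_eq_zero_iff.1 hcos
  have hpi : (Real.pi : ℂ) ≠ 0 := by exact_mod_cast Real.pi_ne_zero
  have hwk : w = 2 * k + 1 := by
    field_simp at hk
    linear_combination hk
  have hzk : z = ((-2 * k : ℤ) : ℂ) := by rw [hzw, hwk]; push_cast; ring
  have hk0 : 1 ≤ k := by
    have h1 : (w.re : ℝ) = 2 * k + 1 := by rw [hwk]; simp
    rw [h1] at hwre
    have h2 : (0 : ℤ) ≤ k := by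
      have : (0 : ℝ) ≤ k := by linarith
      exact_mod_cast this
    rcases h2.eq_or_lt with h | h
    · exfalso; apply hw1; rw [hwk, ← h]; simp
    · exact h
  rw [hzk]
  refine ⟨Complex.intCast_im _, ?_⟩
  rw [Complex.intCast_re]
  push_cast
  have : (1 : ℝ) ≤ k := by exact_mod_cast hk0
  linarith

theorem summable_riemannZeta₁_zeros {q : ℝ} (hq : 1 < q) :
    Summable fun z : ℂ => (analyticOrderNatAt riemannZeta₁ z : ℝ) * (1 + ‖z‖) ^ (-q) := by
  obtain ⟨C, hC, hb⟩ := exists_norm_riemannZeta₁_le_exp (p := (1 + q) / 2) (by linarith)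
  exact summable_analyticOrderNatAt_mul_rpow differentiable_riemannZeta₁ riemannZeta₁_zero_ne_zero
    (by linarith) (by linarith) hC.le hb

theorem countable_riemannZeta₁_zeros : Countable {z // riemannZeta₁ z = 0} := by
  have h := (summable_riemannZeta₁_zeros one_lt_two).countable_support
  refine (h.mono (s₁ := {z | riemannZeta₁ z = 0}) fun z hz => ?_).to_subtype
  refine mul_ne_zero ?_ (by positivity)
  exact_mod_cast analyticOrderNatAt_ne_zero_of_eq_zero differentiable_riemannZeta₁
    riemannZeta₁_zero_ne_zero hz

/-- The partial fraction expansion of the logarithmic derivative of the zeta function. -/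
theorem hasSum_LSeries_vonMangoldt {s : ℂ} (hs : 1 < s.re) :
    HasSum (fun z : {z // riemannZeta₁ z = 0} =>
        (analyticOrderNatAt riemannZeta₁ z : ℂ) / z * (s / (s - z)))
      (1 / (s - 1) - logDeriv riemannZeta₁ 0
        - LSeries (fun n => (ArithmeticFunction.vonMangoldt n : ℂ)) s) := by
  obtain ⟨C, hC, hb⟩ := exists_norm_riemannZeta₁_le_exp (p := 3 / 2) (by norm_num)
  have hs1 : s ≠ 1 := by rintro rfl; simp at hs
  have hζ : riemannZeta s ≠ 0 := riemannZeta_ne_zero_of_one_le_re hs.le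
  have hs0 : riemannZeta₁ s ≠ 0 := by
    rw [riemannZeta₁_eq_mul hs1]
    exact mul_ne_zero (sub_ne_zero.2 hs1) hζ
  have h := hasSum_logDeriv_sub differentiable_riemannZeta₁ riemannZeta₁_zero_ne_zero
    (by norm_num) (by norm_num) hC hb hs0
  have hL : LSeries (fun n => (ArithmeticFunction.vonMangoldt n : ℂ)) s
      = 1 / (s - 1) - logDeriv riemannZeta₁ s := by
    have h1 := ArithmeticFunction.LSeries_vonMangoldt_eq_deriv_riemannZeta_div hs
    rw [h1, deriv_riemannZeta_eq_neg_inv_sub_sq_mul_add hs1, riemannZeta_eq_inv_sub_mul hs1,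
      logDeriv_apply]
    have := sub_ne_zero.2 hs1
    field_simp
    ring
  rw [hL]
  -- 1/(s-z) + 1/z = (1/z) · s/(s-z). The factor 1/z supplies decay in z, and s will be absorbed by
  -- a Beta recurrence.
  convert! h using 1
  · ext z
    have hz0 : (z : ℂ) ≠ 0 := by
      intro h; have := z.2; rw [h] at this; exact riemannZeta₁_zero_ne_zero this
    have hzs : s - (z : ℂ) ≠ 0 := by
      intro h; have := z.2; rw [← sub_eq_zero.1 h] at this; exact hs0 this
    field_simp
    ring
  · ring

/-! ### Incomplete Beta integrals -/

theorem IntervalIntegrable.complex_ofReal {f : ℝ → ℝ} {p q : ℝ}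
    (hf : IntervalIntegrable f volume p q) :
    IntervalIntegrable (fun u => (f u : ℂ)) volume p q :=
  ⟨hf.1.ofReal, hf.2.ofReal⟩

/-- One integration by parts against u^(z+1)/(z+1). As w' has constant sign, w is monotone and ∫|w'|
≤ 2W; with the two boundary terms this makes 4W. -/
theorem norm_integral_mul_cpow_le {w w' : ℝ → ℝ} {p q W V : ℝ} {z : ℂ} (hp : 0 ≤ p) (hpq : p ≤ q)
    (hz : 0 < p ∨ -1 < z.re) (hz1 : z + 1 ≠ 0) (hw : ∀ u ∈ Set.Icc p q, HasDerivAt w (w' u) u)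
    (hw' : ContinuousOn w' (Set.Icc p q))
    (hsign : (∀ u ∈ Set.Icc p q, 0 ≤ w' u) ∨ ∀ u ∈ Set.Icc p q, w' u ≤ 0)
    (hW : ∀ u ∈ Set.Icc p q, |w u| ≤ W) (hV : ∀ u ∈ Set.Icc p q, ‖(u : ℂ) ^ (z + 1)‖ ≤ V) :
    ‖∫ u in p..q, (w u : ℂ) * (u : ℂ) ^ z‖ ≤ 4 * W * V / ‖z + 1‖ := by
  have hI : Set.uIcc p q = Set.Icc p q := Set.uIcc_of_le hpq
  have hpm : p ∈ Set.Icc p q := ⟨le_rfl, hpq⟩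
  have hqm : q ∈ Set.Icc p q := ⟨hpq, le_rfl⟩
  have hW0 : 0 ≤ W := (abs_nonneg _).trans (hW p hpm)
  have hV0 : 0 ≤ V := (norm_nonneg _).trans (hV p hpm)
  have hn : 0 < ‖z + 1‖ := norm_pos_iff.2 hz1
  have hw'i : IntervalIntegrable w' volume p q := (hI ▸ hw').intervalIntegrable
  have hcont : ContinuousOn (fun u : ℝ => (u : ℂ) ^ (z + 1) / (z + 1)) (Set.uIcc p q) := by
    rw [hI]
    intro u hu
    refine (ContinuousAt.div_const ?_ _).continuousWithinAt
    rcases hz with hz | hz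
    · exact Complex.continuousAt_ofReal_cpow_const _ _ (Or.inr (hz.trans_le hu.1).ne')
    · exact Complex.continuousAt_ofReal_cpow_const _ _ (Or.inl (by simp; linarith))
  have hpow : IntervalIntegrable (fun u : ℝ => (u : ℂ) ^ z) volume p q := by
    rcases hz with hz | hz
    · refine intervalIntegrable_cpow (Or.inr ?_)
      rw [hI]; exact fun h => absurd h.1 (not_le.2 hz)
    · exact intervalIntegrable_cpow' hz
  have hparts := integral_mul_deriv_eq_deriv_mul_of_hasDeriv_right
    (u := fun u => (w u : ℂ)) (u' := fun u => (w' u : ℂ))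
    (v := fun u : ℝ => (u : ℂ) ^ (z + 1) / (z + 1)) (v' := fun u : ℝ => (u : ℂ) ^ z)
    (a := p) (b := q)
    (by rw [hI]; exact fun u hu => ((hw u hu).ofReal_comp).continuousAt.continuousWithinAt)
    hcont
    (fun u hu => by
      rw [min_eq_left hpq, max_eq_right hpq] at hu
      exact ((hw u ⟨hu.1.le, hu.2.le⟩).ofReal_comp).hasDerivWithinAt)
    (fun u hu => by
      rw [min_eq_left hpq, max_eq_right hpq] at hu
      have h := (hasDerivAt_ofReal_cpow_const (hp.trans_lt hu.1).ne' hz1).div_const (z + 1)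
      rw [add_sub_cancel_right, mul_div_cancel_left₀ _ hz1] at h
      exact h.hasDerivWithinAt)
    hw'i.complex_ofReal hpow
  rw [hparts]
  have hInt : ∫ u in p..q, |w' u| ≤ 2 * W := by
    have hftc : ∫ u in p..q, w' u = w q - w p :=
      integral_eq_sub_of_hasDerivAt (by rw [hI]; exact hw) hw'i
    have h1 := abs_le.1 (hW p hpm)
    have h2 := abs_le.1 (hW q hqm)
    rcases hsign with h | h
    · have : ∫ u in p..q, |w' u| = ∫ u in p..q, w' u :=
        integral_congr fun u hu => abs_of_nonneg (h u (hI ▸ hu))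
      rw [this, hftc]; linarith
    · have : ∫ u in p..q, |w' u| = ∫ u in p..q, -w' u :=
        integral_congr fun u hu => abs_of_nonpos (h u (hI ▸ hu))
      rw [this, intervalIntegral.integral_neg, hftc]; linarith
  have hb : ∀ u ∈ Set.Icc p q, ‖(w u : ℂ) * ((u : ℂ) ^ (z + 1) / (z + 1))‖ ≤ W * V / ‖z + 1‖ := by
    intro u hu
    rw [norm_mul, norm_div, Complex.norm_real, mul_div_assoc]
    have := hW u hu
    have := hV u hu
    rw [Real.norm_eq_abs]
    gcongr
  have hb2 : ‖∫ u in p..q, (w' u : ℂ) * ((u : ℂ) ^ (z + 1) / (z + 1))‖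
      ≤ 2 * W * V / ‖z + 1‖ := by
    calc _ ≤ ∫ u in p..q, |w' u| * (V / ‖z + 1‖) := by
          refine intervalIntegral.norm_integral_le_of_norm_le hpq ?_
            (hw'i.abs.mul_const _)
          refine ae_of_all _ fun u hu => ?_
          rw [norm_mul, norm_div, Complex.norm_real, Real.norm_eq_abs]
          have := hV u ⟨hu.1.le, hu.2⟩
          gcongr
      _ = (∫ u in p..q, |w' u|) * (V / ‖z + 1‖) := by rw [intervalIntegral.integral_mul_const]
      _ ≤ 2 * W * (V / ‖z + 1‖) := by gcongr
      _ = _ := by ring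
  calc _ ≤ W * V / ‖z + 1‖ + W * V / ‖z + 1‖ + 2 * W * V / ‖z + 1‖ :=
        (norm_sub_le _ _).trans (add_le_add ((norm_sub_le _ _).trans
          (add_le_add (hb q hqm) (hb p hpm))) hb2)
    _ = _ := by ring

/-- The upper incomplete Beta integral `∫_t^1 (1 - u)^(c - 1) u^z du`. -/
noncomputable def incBeta (c : ℝ) (z : ℂ) (t : ℝ) : ℂ :=
  ∫ u in t..1, (((1 - u) ^ (c - 1) : ℝ) : ℂ) * (u : ℂ) ^ z

theorem intervalIntegrable_one_sub_rpow {c : ℝ} (hc : 0 < c) (p q : ℝ) :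
    IntervalIntegrable (fun u : ℝ => (1 - u) ^ (c - 1)) volume p q := by
  have h := (intervalIntegral.intervalIntegrable_rpow' (a := 1 - p) (b := 1 - q)
    (by linarith : -1 < c - 1)).comp_sub_left 1
  simpa using h

theorem intervalIntegrable_incBeta {c : ℝ} (hc : 0 < c) {z : ℂ} {p q : ℝ} (hp : 0 ≤ p)
    (hpq : p ≤ q) (hq : q ≤ 1) (hz : 0 < p ∨ -1 < z.re) :
    IntervalIntegrable (fun u : ℝ => (((1 - u) ^ (c - 1) : ℝ) : ℂ) * (u : ℂ) ^ z) volume p q := by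
  by_cases hz' : -1 < z.re
  · have h := Complex.betaIntegral_convergent (u := z + 1) (v := c) (by simp; linarith)
      (by simpa using hc)
    have h2 : IntervalIntegrable (fun u : ℝ => (((1 - u) ^ (c - 1) : ℝ) : ℂ) * (u : ℂ) ^ z)
        volume 0 1 := by
      refine h.congr fun u hu => ?_
      rw [Set.uIoc_of_le zero_le_one] at hu
      rw [Complex.ofReal_cpow (by linarith [hu.2])]
      push_cast
      ring_nf
    exact h2.mono_set (by
      rw [Set.uIcc_of_le hpq, Set.uIcc_of_le zero_le_one]; exact Set.Icc_subset_Icc hp hq)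
  · have hp0 : 0 < p := hz.resolve_right hz'
    refine (intervalIntegrable_one_sub_rpow hc p q).complex_ofReal.mul_continuousOn ?_
    rw [Set.uIcc_of_le hpq]
    exact fun u hu => (Complex.continuousAt_ofReal_cpow_const _ _
      (Or.inr (hp0.trans_le hu.1).ne')).continuousWithinAt

theorem incBeta_zero {c : ℝ} {z : ℂ} : incBeta c z 0 = betaIntegral (z + 1) c := by
  rw [incBeta, betaIntegral]
  refine integral_congr fun u hu => ?_
  rw [Set.uIcc_of_le zero_le_one] at hu
  rw [Complex.ofReal_cpow (by linarith [hu.2])]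
  push_cast
  ring_nf

theorem integral_one_sub_rpow {c : ℝ} (hc : 0 < c) (x : ℝ) :
    ∫ u in x..1, (1 - u) ^ (c - 1) = (1 - x) ^ c / c := by
  rw [intervalIntegral.integral_comp_sub_left (fun u => u ^ (c - 1)) 1,
    integral_rpow (Or.inl (by linarith))]
  simp [Real.zero_rpow hc.ne']

/-- Integration by parts against the weight `(1 - u)^(c - 1)` away from its singularity. -/
theorem norm_integral_one_sub_rpow_mul_cpow_le {c η p q V : ℝ} (hη : 0 < η) {z : ℂ} (hp : 0 ≤ p)
    (hpq : p ≤ q) (hq : q ≤ 1 - η) (hz : 0 < p ∨ -1 < z.re) (hz1 : z + 1 ≠ 0)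
    (hV : ∀ u ∈ Set.Icc p q, ‖(u : ℂ) ^ (z + 1)‖ ≤ V) :
    ‖∫ u in p..q, (((1 - u) ^ (c - 1) : ℝ) : ℂ) * (u : ℂ) ^ z‖
      ≤ 4 * max 1 (η ^ (c - 1)) * V / ‖z + 1‖ := by
  have hpos : ∀ u ∈ Set.Icc p q, 0 < 1 - u := fun u hu => by linarith [hu.2]
  refine norm_integral_mul_cpow_le (w' := fun u => -((c - 1) * (1 - u) ^ (c - 1 - 1))) hp hpq hz hz1
    (fun u hu => ?_) (fun u hu => ?_) ?_ (fun u hu => ?_) hV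
  · have := ((hasDerivAt_id u).const_sub 1).rpow_const (p := c - 1) (Or.inl (hpos u hu).ne')
    refine this.congr_deriv ?_
    simp only [id]; ring
  · refine ContinuousAt.continuousWithinAt ?_
    exact ((((continuous_const.sub continuous_id).continuousAt).rpow_const
      (Or.inl (hpos u hu).ne')).const_mul _).neg
  · rcases le_total c 1 with h | h
    · left
      intro u hu
      have := Real.rpow_nonneg (hpos u hu).le (c - 1 - 1)
      nlinarith
    · right
      intro u hu
      have := Real.rpow_nonneg (hpos u hu).le (c - 1 - 1)
      nlinarith
  · rw [abs_of_nonneg (Real.rpow_nonneg (hpos u hu).le _)]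
    rcases le_total c 1 with h | h
    · exact le_max_of_le_right
        (Real.rpow_le_rpow_of_nonpos hη (by linarith [hu.2]) (by linarith))
    · exact le_max_of_le_left
        (Real.rpow_le_one (hpos u hu).le (by linarith [hu.1]) (by linarith))

/-- The weight may be singular or non-smooth at u = 1, so the integral is cut at 1 - 1/n with n =
|z+1|. Below the cut integration by parts gains 1/n against a weight of size max(1, n^(1-c)); above
it the weight has mass at most n^(-c)/c. Both are O(n^(-min(1,c))). -/
theorem norm_incBeta_le {c : ℝ} (hc : 0 < c) {z : ℂ} {t V : ℝ} (ht : 0 ≤ t) (ht1 : t < 1)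
    (hz : 0 < t ∨ -1 < z.re) (hz1 : 1 ≤ ‖z + 1‖)
    (hV : ∀ u ∈ Set.Icc t 1, ‖(u : ℂ) ^ z‖ ≤ V) :
    ‖incBeta c z t‖ ≤ (4 + 1 / c) * V * ‖z + 1‖ ^ (-min 1 c) := by
  set n := ‖z + 1‖ with hn
  have hn0 : 0 < n := by linarith
  have hzne : z + 1 ≠ 0 := norm_pos_iff.1 hn0
  have hV0 : 0 ≤ V := (norm_nonneg _).trans (hV 1 ⟨ht1.le, le_rfl⟩)
  have hV' : ∀ u ∈ Set.Icc t 1, ‖(u : ℂ) ^ (z + 1)‖ ≤ V := by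
    intro u hu
    rcases eq_or_ne u 0 with rfl | h0
    · simpa [zero_cpow hzne] using hV0
    · have hu0 : 0 < u := lt_of_le_of_ne (ht.trans hu.1) h0.symm
      rw [cpow_add _ _ (by exact_mod_cast h0), cpow_one, norm_mul, Complex.norm_real,
        Real.norm_of_nonneg hu0.le]
      exact (mul_le_of_le_one_right (norm_nonneg _) hu.2).trans (hV u hu)
  have hnc : n⁻¹ ^ c ≤ n ^ (-min 1 c) := by
    rw [Real.inv_rpow hn0.le, ← Real.rpow_neg hn0.le]
    exact Real.rpow_le_rpow_of_exponent_le hz1 (neg_le_neg (min_le_right _ _))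
  have hW : max 1 (n⁻¹ ^ (c - 1)) / n ≤ n ^ (-min 1 c) := by
    rw [div_le_iff₀ hn0]
    refine max_le ?_ ?_
    · have : n ^ (-min 1 c) * n = n ^ (1 - min 1 c) := by
        nth_rewrite 2 [← Real.rpow_one n]
        rw [← Real.rpow_add hn0]; ring_nf
      rw [this]
      exact Real.one_le_rpow hz1 (sub_nonneg.2 (min_le_left _ _))
    · rw [← div_le_iff₀ hn0]
      refine le_trans (le_of_eq ?_) hnc
      rw [Real.rpow_sub_one (inv_ne_zero hn0.ne')]
      field_simp
  have tail : ∀ x, t ≤ x → x ≤ 1 → 1 - x ≤ n⁻¹ →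
      ‖incBeta c z x‖ ≤ 1 / c * V * n ^ (-min 1 c) := by
    intro x htx hx1 hxn
    calc ‖incBeta c z x‖ ≤ ∫ u in x..1, (1 - u) ^ (c - 1) * V := by
          refine intervalIntegral.norm_integral_le_of_norm_le hx1 ?_
            ((intervalIntegrable_one_sub_rpow hc x 1).mul_const V)
          refine ae_of_all _ fun u hu => ?_
          have h1 : 0 ≤ 1 - u := by linarith [hu.2]
          rw [norm_mul, Complex.norm_real, Real.norm_of_nonneg (Real.rpow_nonneg h1 _)]
          exact mul_le_mul_of_nonneg_left (hV u ⟨htx.trans hu.1.le, hu.2⟩) (Real.rpow_nonneg h1 _)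
      _ = (1 - x) ^ c / c * V := by
          rw [intervalIntegral.integral_mul_const, integral_one_sub_rpow hc]
      _ ≤ n ^ (-min 1 c) / c * V := by
          gcongr
          exact (Real.rpow_le_rpow (by linarith) hxn hc.le).trans hnc
      _ = _ := by ring
  rcases le_total (1 - n⁻¹) t with h | h
  · refine (tail t le_rfl ht1.le (by linarith)).trans ?_
    have : 0 ≤ V * n ^ (-min 1 c) := by positivity
    nlinarith
  · have hninv : 0 < n⁻¹ := inv_pos.2 hn0
    have hsplit : incBeta c z t = (∫ u in t..(1 - n⁻¹),
        (((1 - u) ^ (c - 1) : ℝ) : ℂ) * (u : ℂ) ^ z) + incBeta c z (1 - n⁻¹) := by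
      rw [incBeta, incBeta, integral_add_adjacent_intervals]
      · exact intervalIntegrable_incBeta hc ht h (by linarith) hz
      · refine intervalIntegrable_incBeta hc (ht.trans h) (by linarith) le_rfl ?_
        exact hz.imp (fun h0 => h0.trans_le h) id
    rw [hsplit]
    have h1 := norm_integral_one_sub_rpow_mul_cpow_le (c := c) hninv ht h le_rfl hz hzne
      (fun u hu => hV' u ⟨hu.1, by linarith [hu.2]⟩)
    have h2 := tail (1 - n⁻¹) h (by linarith) (by linarith)
    have h3 : 4 * max 1 (n⁻¹ ^ (c - 1)) * V / ‖z + 1‖ ≤ 4 * V * n ^ (-min 1 c) := by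
      calc _ = 4 * V * (max 1 (n⁻¹ ^ (c - 1)) / n) := by rw [← hn]; ring
        _ ≤ _ := by gcongr
    refine (norm_add_le _ _).trans ((add_le_add (h1.trans h3) h2).trans (le_of_eq ?_))
    ring

/-- `incBeta` is close to the complete Beta integral for small `t`. -/
theorem norm_cpow_mul_incBeta_sub_le {c : ℝ} (hc : 0 < c) {z : ℂ} (hz : 0 ≤ z.re) {t : ℝ}
    (ht : 0 < t) (ht2 : t ≤ 1 / 2) :
    ‖(t : ℂ) ^ (-z) * (incBeta c z 0 - incBeta c z t)‖
      ≤ 4 * max 1 ((1 / 2) ^ (c - 1)) / ‖z + 1‖ := by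
  have hzne : z + 1 ≠ 0 := by
    intro h
    have := congrArg Complex.re h
    simp at this; linarith
  -- Only [0, t] with t ≤ 1/2 remains, away from the singularity, so integration by parts gives the
  -- full decay |z+1|⁻¹, and the boundary size t^(Re z + 1) cancels t^(-Re z).
  have hsplit : incBeta c z 0 - incBeta c z t
      = ∫ u in (0 : ℝ)..t, (((1 - u) ^ (c - 1) : ℝ) : ℂ) * (u : ℂ) ^ z := by
    rw [incBeta, incBeta, sub_eq_iff_eq_add, integral_add_adjacent_intervals]
    · exact intervalIntegrable_incBeta hc le_rfl ht.le (by linarith) (Or.inr (by linarith))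
    · exact intervalIntegrable_incBeta hc ht.le (by linarith) le_rfl (Or.inr (by linarith))
  have h1 := norm_integral_one_sub_rpow_mul_cpow_le (c := c) (η := 1 / 2) (z := z) (p := 0) (q := t)
    (V := t ^ (z.re + 1)) (by norm_num) le_rfl ht.le (by linarith) (Or.inr (by linarith)) hzne
    (fun u hu => by
      rcases eq_or_ne u 0 with rfl | h0
      · simp only [ofReal_zero, zero_cpow hzne, norm_zero]; positivity
      · have hu0 : 0 < u := lt_of_le_of_ne hu.1 h0.symm
        rw [Complex.norm_cpow_eq_rpow_re_of_pos hu0]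
        exact Real.rpow_le_rpow hu0.le hu.2 (by simp; linarith))
  rw [hsplit, norm_mul, Complex.norm_cpow_eq_rpow_re_of_pos ht, neg_re]
  calc _ ≤ t ^ (-z.re) * (4 * max 1 ((1 / 2) ^ (c - 1)) * t ^ (z.re + 1) / ‖z + 1‖) := by gcongr
    _ = t * (4 * max 1 ((1 / 2) ^ (c - 1)) / ‖z + 1‖) := by
        have : t ^ (-z.re) * t ^ (z.re + 1) = t := by
          rw [← Real.rpow_add ht]; simp
        rw [show t ^ (-z.re) * (4 * max 1 ((1 / 2) ^ (c - 1)) * t ^ (z.re + 1) / ‖z + 1‖)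
          = (t ^ (-z.re) * t ^ (z.re + 1)) * (4 * max 1 ((1 / 2) ^ (c - 1)) / ‖z + 1‖) by ring,
          this]
    _ ≤ _ := mul_le_of_le_one_left (by positivity) (by linarith)

/-! ### Mellin transforms of the kernels -/

/-- Mellin transforms may be computed termwise for series dominated near the origin. -/
theorem hasSum_mellin_tsum {ι : Type*} [Countable ι] {F : ι → ℝ → ℂ} {u : ι → ℝ} {r : ℝ}
    (hu : Summable u) (hm : ∀ i, AEStronglyMeasurable (F i) (volume.restrict (Set.Ioi 0)))
    (hb : ∀ i, ∀ t ∈ Set.Ioc (0 : ℝ) 1, ‖F i t‖ ≤ u i * t ^ (-r))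
    (h0 : ∀ i t, 1 < t → F i t = 0) {s : ℂ} (hs : r < s.re) :
    MellinConvergent (fun t => ∑' i, F i t) s ∧
      HasSum (fun i => mellin (F i) s) (mellin (fun t => ∑' i, F i t) s) := by
  set k : ℝ → ℝ := Set.indicator (Set.Ioc 0 1) fun t => t ^ (s.re - 1 - r) with hk
  have hki : Integrable k (volume.restrict (Set.Ioi 0)) := by
    rw [hk, integrable_indicator_iff measurableSet_Ioc, IntegrableOn,
      Measure.restrict_restrict measurableSet_Ioc,
      Set.inter_eq_left.2 fun _ ht => ht.1]
    have := intervalIntegral.intervalIntegrable_rpow' (a := 0) (b := 1)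
      (by linarith : -1 < s.re - 1 - r)
    rwa [intervalIntegrable_iff_integrableOn_Ioc_of_le zero_le_one] at this
  have hu0 : ∀ i, 0 ≤ u i := fun i => by
    simpa using (norm_nonneg _).trans (hb i 1 ⟨zero_lt_one, le_rfl⟩)
  have hbound : ∀ i, ∀ t ∈ Set.Ioi (0 : ℝ), ‖(t : ℂ) ^ (s - 1) • F i t‖ ≤ u i * k t := by
    intro i t ht
    have ht : 0 < t := ht
    by_cases h1 : t ≤ 1
    · have hmem : t ∈ Set.Ioc (0 : ℝ) 1 := ⟨ht, h1⟩
      rw [norm_smul, Complex.norm_cpow_eq_rpow_re_of_pos ht, hk, Set.indicator_of_mem hmem]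
      calc _ ≤ t ^ (s - 1).re * (u i * t ^ (-r)) := by gcongr; exact hb i t hmem
        _ = u i * (t ^ (s.re - 1) * t ^ (-r)) := by simp only [sub_re, one_re]; ring
        _ = _ := by rw [← Real.rpow_add ht]; ring_nf
    · rw [h0 i t (not_le.1 h1), smul_zero, norm_zero, hk,
        Set.indicator_of_notMem fun h => h1 h.2, mul_zero]
  have hpow : AEStronglyMeasurable (fun t : ℝ => (t : ℂ) ^ (s - 1))
      (volume.restrict (Set.Ioi 0)) := by
    refine ContinuousOn.aestronglyMeasurable (fun t ht => ?_) measurableSet_Ioi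
    exact (Complex.continuousAt_ofReal_cpow_const _ _ (Or.inr (ne_of_gt ht))).continuousWithinAt
  have hmeas : ∀ i, AEStronglyMeasurable (fun t : ℝ => (t : ℂ) ^ (s - 1) • F i t)
      (volume.restrict (Set.Ioi 0)) := fun i => hpow.smul (hm i)
  have hsm : ∀ t, Summable fun i => u i * k t := fun t => hu.mul_right _
  have hlim : ∀ᵐ t : ℝ ∂(volume.restrict (Set.Ioi 0)), HasSum (fun i => (t : ℂ) ^ (s - 1) • F i t)
      ((t : ℂ) ^ (s - 1) • ∑' i, F i t) := by
    filter_upwards [ae_restrict_mem measurableSet_Ioi] with t ht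
    have h1 : Summable fun i => (t : ℂ) ^ (s - 1) • F i t :=
      Summable.of_norm_bounded (hsm t) fun i => hbound i t ht
    have ht' : (t : ℂ) ^ (s - 1) ≠ 0 := by
      rw [ne_eq, cpow_eq_zero_iff]
      intro h
      exact (ne_of_gt ht) (by exact_mod_cast h.1)
    rw [← tsum_const_smul'' ]
    exact h1.hasSum
  have hbi : Integrable (fun t => ∑' i, u i * k t) (volume.restrict (Set.Ioi 0)) := by
    simp_rw [tsum_mul_right]
    exact hki.const_mul _
  refine ⟨?_, ?_⟩
  · refine Integrable.mono' hbi ?_ ?_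
    · refine aestronglyMeasurable_of_tendsto_ae atTop
        (f := fun (S : Finset ι) (t : ℝ) => ∑ i ∈ S, (t : ℂ) ^ (s - 1) • F i t) (fun S => ?_) hlim
      exact Finset.aestronglyMeasurable_fun_sum _ fun i _ => hmeas i
    · filter_upwards [ae_restrict_mem measurableSet_Ioi, hlim] with t ht hl
      rw [← hl.tsum_eq]
      exact tsum_of_norm_bounded (hsm t).hasSum fun i => hbound i t ht
  · exact hasSum_integral_of_dominated_convergence (fun i t => u i * k t) hmeas
      (fun i => by
        filter_upwards [ae_restrict_mem measurableSet_Ioi] with t ht using hbound i t ht)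
      (ae_of_all _ hsm) hbi hlim

/-- A Mellin transform of a function supported in `(0, 1]`. -/
theorem hasMellin_of_eq_zero {f : ℝ → ℂ} (h0 : ∀ t, 1 < t → f t = 0) {s : ℂ}
    (hi : IntervalIntegrable (fun t : ℝ => (t : ℂ) ^ (s - 1) * f t) volume 0 1) :
    HasMellin f s (∫ t in (0 : ℝ)..1, (t : ℂ) ^ (s - 1) * f t) := by
  have hz : ∀ t ∈ Set.Ioi (0 : ℝ) \ Set.Ioc 0 1, (t : ℂ) ^ (s - 1) • f t = 0 := by
    intro t ht
    rw [h0 t, smul_zero]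
    by_contra h
    exact ht.2 ⟨ht.1, not_lt.1 h⟩
  rw [intervalIntegrable_iff_integrableOn_Ioc_of_le zero_le_one] at hi
  refine ⟨?_, ?_⟩
  · exact hi.of_forall_sdiff_eq_zero measurableSet_Ioi hz
  · rw [mellin, intervalIntegral.integral_of_le zero_le_one]
    exact setIntegral_eq_of_subset_of_forall_sdiff_eq_zero measurableSet_Ioi (fun t ht => ht.1) hz

/-- The Cesàro weight `(1 - t)_+^(a - 1)`. -/
noncomputable def cesaroKernel (a t : ℝ) : ℝ := (max (1 - t) 0) ^ (a - 1)

theorem continuous_cesaroKernel {a : ℝ} (ha : 1 < a) : Continuous (cesaroKernel a) := by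
  unfold cesaroKernel
  exact ((continuous_const.sub continuous_id).max continuous_const).rpow_const
    fun _ => Or.inr (by linarith)

theorem cesaroKernel_of_one_le {a : ℝ} (ha : 1 < a) {t : ℝ} (ht : 1 ≤ t) :
    cesaroKernel a t = 0 := by
  rw [cesaroKernel, max_eq_right (by linarith), Real.zero_rpow (by linarith)]

theorem cesaroKernel_of_le_one {a t : ℝ} (ht : t ≤ 1) :
    cesaroKernel a t = (1 - t) ^ (a - 1) := by
  rw [cesaroKernel, max_eq_left (by linarith)]

theorem cesaroKernel_nonneg (a t : ℝ) : 0 ≤ cesaroKernel a t :=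
  Real.rpow_nonneg (le_max_right _ _) _

theorem cesaroKernel_le_one {a : ℝ} (ha : 1 < a) {t : ℝ} (ht : 0 ≤ t) : cesaroKernel a t ≤ 1 :=
  Real.rpow_le_one (le_max_right _ _) (max_le (by linarith) zero_le_one) (by linarith)

theorem hasMellin_cesaroKernel {a : ℝ} (ha : 1 < a) {s : ℂ} (hs : 0 < s.re) :
    HasMellin (fun t => (cesaroKernel a t : ℂ)) s (betaIntegral s a) := by
  have hcongr : ∀ t ∈ Set.Icc (0 : ℝ) 1, (t : ℂ) ^ (s - 1) * (1 - (t : ℂ)) ^ ((a : ℂ) - 1)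
      = (t : ℂ) ^ (s - 1) * (cesaroKernel a t : ℂ) := by
    intro t ht
    rw [cesaroKernel_of_le_one ht.2, Complex.ofReal_cpow (by linarith [ht.2])]
    push_cast; rfl
  have hi : IntervalIntegrable (fun t : ℝ => (t : ℂ) ^ (s - 1) * (cesaroKernel a t : ℂ))
      volume 0 1 := by
    refine (betaIntegral_convergent (u := s) (v := a) hs (by simp; linarith)).congr fun t ht => ?_
    rw [Set.uIoc_of_le zero_le_one] at ht
    exact hcongr t ⟨ht.1.le, ht.2⟩
  have h := hasMellin_of_eq_zero (f := fun t => (cesaroKernel a t : ℂ))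
    (fun t ht => by rw [cesaroKernel_of_one_le ha ht.le, ofReal_zero]) hi
  convert! h using 1
  rw [betaIntegral]
  refine integral_congr fun t ht => ?_
  rw [Set.uIcc_of_le zero_le_one] at ht
  exact hcongr t ht

/-- The kernel attached to a zero `z`. -/
noncomputable def zeroKernel (c : ℝ) (z : ℂ) : ℝ → ℂ :=
  Set.indicator (Set.Ioc 0 1) fun t => (t : ℂ) ^ (-z) * incBeta c z t

theorem continuousOn_incBeta {c : ℝ} (hc : 0 < c) (z : ℂ) :
    ContinuousOn (incBeta c z) (Set.Ioc 0 1) := by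
  intro t ht
  have ht2 : 0 < t / 2 := by linarith [ht.1]
  have hle : t / 2 ≤ 1 := by linarith [ht.1, ht.2]
  have h := intervalIntegrable_incBeta hc (z := z) ht2.le hle le_rfl (Or.inl ht2)
  have h2 := (intervalIntegrable_iff_integrableOn_Icc_of_le hle).1 h
  rw [← Set.uIcc_of_le hle] at h2
  have h3 := intervalIntegral.continuousOn_primitive_interval_left h2
  rw [Set.uIcc_of_le hle] at h3
  have h4 := h3 t ⟨by linarith [ht.1], ht.2⟩
  refine h4.mono_of_mem_nhdsWithin ?_
  rw [mem_nhdsWithin]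
  exact ⟨Set.Ioi (t / 2), isOpen_Ioi, by simp; exact ht.1, fun x hx => ⟨le_of_lt hx.1, hx.2.2⟩⟩

theorem continuousOn_cpow_mul_incBeta {c : ℝ} (hc : 0 < c) (z w : ℂ) :
    ContinuousOn (fun t : ℝ => (t : ℂ) ^ w * incBeta c z t) (Set.Ioc 0 1) :=
  ContinuousOn.mul (fun _ ht => (Complex.continuousAt_ofReal_cpow_const _ _
    (Or.inr (ne_of_gt ht.1))).continuousWithinAt) (continuousOn_incBeta hc z)

theorem aestronglyMeasurable_zeroKernel {c : ℝ} (hc : 0 < c) (z : ℂ) (μ : Measure ℝ) :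
    AEStronglyMeasurable (zeroKernel c z) μ := by
  rw [zeroKernel, aestronglyMeasurable_indicator_iff measurableSet_Ioc]
  exact (continuousOn_cpow_mul_incBeta hc z (-z)).aestronglyMeasurable measurableSet_Ioc

/-- On [t, 1] one has |u^z| ≤ t^(Re z - 1) whenever Re z ≤ 1. The resulting majorant t⁻¹ does not
depend on the zero, trivial or not, which allows termwise Mellin transforms for Re s > 1. -/
theorem norm_cpow_mul_incBeta_le {c : ℝ} (hc : 0 < c) {z : ℂ} (hz : z.re ≤ 1)
    (hz1 : 1 ≤ ‖z + 1‖) {t : ℝ} (ht : t ∈ Set.Ioc (0 : ℝ) 1) :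
    ‖(t : ℂ) ^ (-z) * incBeta c z t‖ ≤ (4 + 1 / c) * ‖z + 1‖ ^ (-min 1 c) * t ^ (-1 : ℝ) := by
  have ht0 := ht.1
  rcases ht.2.eq_or_lt with h | h
  · rw [h, incBeta]; simp; positivity
  have h1 := norm_incBeta_le hc (z := z) (V := t ^ (z.re - 1)) ht0.le h (Or.inl ht0) hz1
    (fun u hu => by
      have hu0 : 0 < u := ht0.trans_le hu.1
      rw [Complex.norm_cpow_eq_rpow_re_of_pos hu0]
      rcases le_total 0 z.re with h0 | h0
      · exact (Real.rpow_le_one hu0.le hu.2 h0).trans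
          (Real.one_le_rpow_of_pos_of_le_one_of_nonpos ht0 ht.2 (by linarith))
      · exact (Real.rpow_le_rpow_of_nonpos ht0 hu.1 h0).trans
          (Real.rpow_le_rpow_of_exponent_ge ht0 ht.2 (by linarith)))
  rw [norm_mul, Complex.norm_cpow_eq_rpow_re_of_pos ht0, neg_re]
  calc _ ≤ t ^ (-z.re) * ((4 + 1 / c) * t ^ (z.re - 1) * ‖z + 1‖ ^ (-min 1 c)) := by gcongr
    _ = (4 + 1 / c) * ‖z + 1‖ ^ (-min 1 c) * (t ^ (-z.re) * t ^ (z.re - 1)) := by ring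
    _ = _ := by rw [← Real.rpow_add ht0]; ring_nf

/-- Integration by parts in t: differentiating the incomplete integral removes it, and t^z · t^(s-z)
= t^s leaves a complete Beta integral divided by s - z. -/
theorem hasMellin_zeroKernel {c : ℝ} (hc : 0 < c) {z : ℂ} (hz : z.re ≤ 1)
    (hz1 : 1 ≤ ‖z + 1‖) {s : ℂ} (hs : 1 < s.re) :
    HasMellin (zeroKernel c z) s (betaIntegral (s + 1) c / (s - z)) := by
  have hsz : s - z ≠ 0 := by
    intro h
    have := congrArg Complex.re h
    simp at this; linarith
  set A := (4 + 1 / c) * ‖z + 1‖ ^ (-min 1 c) with hA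
  have hconv : MellinConvergent (zeroKernel c z) s := by
    have := (hasSum_mellin_tsum (ι := Unit) (F := fun _ => zeroKernel c z) (u := fun _ => A)
      (r := 1) (hasSum_unique _).summable (fun _ => aestronglyMeasurable_zeroKernel hc z _)
      (fun _ t ht => by
        rw [zeroKernel, Set.indicator_of_mem ht]
        exact norm_cpow_mul_incBeta_le hc hz hz1 ht)
      (fun _ t ht => Set.indicator_of_notMem (fun h => absurd h.2 (not_le.2 ht)) _) hs).1
    simpa using this
  have hint1 : IntervalIntegrable (fun t : ℝ => (t : ℂ) ^ (s - 1) * zeroKernel c z t)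
      volume 0 1 := by
    rw [intervalIntegrable_iff_integrableOn_Ioc_of_le zero_le_one]
    exact hconv.mono_set fun t ht => ht.1
  have h := hasMellin_of_eq_zero (f := zeroKernel c z)
    (fun t ht => Set.indicator_of_notMem (fun h => absurd h.2 (not_le.2 ht)) _) hint1
  convert! h using 1
  have hint2 := (intervalIntegrable_incBeta hc (z := s) le_rfl zero_le_one le_rfl
    (Or.inr (by linarith))).div_const (s - z)
  -- G is the boundary term. It vanishes at t = 1 since the integral is empty, and at t = 0 because
  -- |G| ≪ t^(Re s - 1) with Re s > 1.
  set G : ℝ → ℂ := fun t => (t : ℂ) ^ (s - z) * incBeta c z t / (s - z) with hG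
  have hGc : ContinuousOn G (Set.Icc 0 1) := by
    intro t ht
    rcases ht.1.eq_or_lt with h0 | h0
    · subst h0
      rw [ContinuousWithinAt]
      have hG0 : G 0 = 0 := by simp [hG, zero_cpow hsz]
      rw [hG0, tendsto_zero_iff_norm_tendsto_zero]
      have hlim : Tendsto (fun t : ℝ => A * t ^ (s.re - 1) / ‖s - z‖) (𝓝[Set.Icc 0 1] 0) (𝓝 0) := by
        have : ContinuousAt (fun t : ℝ => A * t ^ (s.re - 1) / ‖s - z‖) 0 :=
          ((Real.continuousAt_rpow_const _ _ (Or.inr (by linarith))).const_mul _).div_const _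
        have := this.tendsto
        rw [Real.zero_rpow (by linarith), mul_zero, zero_div] at this
        exact this.mono_left nhdsWithin_le_nhds
      refine squeeze_zero' (Eventually.of_forall fun _ => norm_nonneg _) ?_ hlim
      filter_upwards [self_mem_nhdsWithin] with t ht
      rcases ht.1.eq_or_lt with h1 | h1
      · rw [← h1, hG0, norm_zero, Real.zero_rpow (by linarith)]; simp
      · have hb := norm_cpow_mul_incBeta_le hc hz hz1 (t := t) ⟨h1, ht.2⟩
        rw [hG]
        simp only [norm_div]
        gcongr
        rw [show s - z = s + -z by ring, cpow_add _ _ (by exact_mod_cast h1.ne'), mul_assoc,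
          norm_mul, Complex.norm_cpow_eq_rpow_re_of_pos h1]
        calc _ ≤ t ^ s.re * (A * t ^ (-1 : ℝ)) := by gcongr
          _ = A * (t ^ s.re * t ^ (-1 : ℝ)) := by ring
          _ = _ := by rw [← Real.rpow_add h1]; ring_nf
    · have h2 := ((continuousOn_cpow_mul_incBeta hc z (s - z)).div_const (s - z)) t ⟨h0, ht.2⟩
      refine h2.mono_of_mem_nhdsWithin ?_
      rw [mem_nhdsWithin]
      exact ⟨Set.Ioi 0, isOpen_Ioi, h0, fun x hx => ⟨hx.1, hx.2.2⟩⟩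
  have hGd : ∀ t ∈ Set.Ioo (0 : ℝ) 1, HasDerivAt G ((t : ℂ) ^ (s - 1) * zeroKernel c z t
      - (((1 - t) ^ (c - 1) : ℝ) : ℂ) * (t : ℂ) ^ s / (s - z)) t := by
    intro t ht
    have ht0 : (t : ℂ) ≠ 0 := by exact_mod_cast ht.1.ne'
    have hcontIoo : ContinuousOn (fun u : ℝ => (((1 - u) ^ (c - 1) : ℝ) : ℂ) * (u : ℂ) ^ z)
        (Set.Ioo 0 1) := by
      intro u hu
      refine ContinuousAt.continuousWithinAt (ContinuousAt.mul ?_ ?_)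
      · refine Complex.continuous_ofReal.continuousAt.comp ?_
        exact ((continuous_const.sub continuous_id).continuousAt).rpow_const
          (Or.inl (sub_pos.2 hu.2).ne')
      · exact Complex.continuousAt_ofReal_cpow_const _ _ (Or.inr hu.1.ne')
    have hB : HasDerivAt (incBeta c z) (-((((1 - t) ^ (c - 1) : ℝ) : ℂ) * (t : ℂ) ^ z)) t :=
      integral_hasDerivAt_left
        (intervalIntegrable_incBeta hc ht.1.le ht.2.le le_rfl (Or.inl ht.1))
        (hcontIoo.stronglyMeasurableAtFilter isOpen_Ioo t ht)
        (hcontIoo.continuousAt (isOpen_Ioo.mem_nhds ht))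
    have hP := hasDerivAt_ofReal_cpow_const ht.1.ne' hsz
    refine ((hP.mul hB).div_const (s - z)).congr_deriv ?_
    rw [zeroKernel, Set.indicator_of_mem (Set.Ioo_subset_Ioc_self ht)]
    have e1 : (t : ℂ) ^ (s - z - 1) = (t : ℂ) ^ (s - 1) * (t : ℂ) ^ (-z) := by
      rw [← cpow_add _ _ ht0]; ring_nf
    have e2 : (t : ℂ) ^ (s - z) * (t : ℂ) ^ z = (t : ℂ) ^ s := by
      rw [← cpow_add _ _ ht0]; ring_nf
    rw [e1, ← e2]
    field_simp
    ring
  have hftc := integral_eq_sub_of_hasDerivAt_of_le zero_le_one hGc hGd (hint1.sub hint2)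
  have hG1 : G 1 = 0 := by simp [hG, incBeta]
  have hG0 : G 0 = 0 := by simp [hG, zero_cpow hsz]
  rw [intervalIntegral.integral_sub hint1 hint2, hG1, hG0, sub_zero, sub_eq_zero,
    intervalIntegral.integral_div] at hftc
  rw [hftc, ← incBeta_zero, incBeta]

/-! ### An exact formula for Cesàro means of Λ -/

theorem summable_vonMangoldt_mul_rpow :
    Summable fun n : ℕ => ArithmeticFunction.vonMangoldt n * (n : ℝ) ^ (-(3 / 2) : ℝ) := by
  have h := ArithmeticFunction.LSeriesSummable_vonMangoldt (s := 3 / 2) (by norm_num)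
  refine h.norm.congr fun n => ?_
  rcases eq_or_ne n 0 with rfl | hn
  · simp
  · have hn0 : (0 : ℝ) < n := by positivity
    rw [LSeries.term_of_ne_zero hn, norm_div, Complex.norm_real, Complex.norm_natCast_cpow_of_pos
      (Nat.pos_of_ne_zero hn), Real.norm_of_nonneg ArithmeticFunction.vonMangoldt_nonneg,
      Real.rpow_neg hn0.le, div_eq_mul_inv]
    norm_num

/-- The kernel is at most 1 and lives on nt ≤ 1, so it is below (nt)^(-3/2). Any exponent less than
-1 would make the series over n converge. -/
theorem vonMangoldt_mul_cesaroKernel_le {a : ℝ} (ha : 1 < a) (n : ℕ) {t : ℝ} (ht : 0 < t) :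
    ArithmeticFunction.vonMangoldt n * cesaroKernel a (n * t)
      ≤ ArithmeticFunction.vonMangoldt n * (n : ℝ) ^ (-(3 / 2) : ℝ) * t ^ (-(3 / 2) : ℝ) := by
  rcases eq_or_ne n 0 with rfl | hn
  · simp
  have hn0 : (0 : ℝ) < n := by positivity
  rw [mul_assoc, ← Real.mul_rpow hn0.le ht.le]
  refine mul_le_mul_of_nonneg_left ?_ ArithmeticFunction.vonMangoldt_nonneg
  rcases le_total 1 ((n : ℝ) * t) with h | h
  · rw [cesaroKernel_of_one_le ha h]; positivity
  · exact (cesaroKernel_le_one ha (by positivity)).trans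
      (Real.one_le_rpow_of_pos_of_le_one_of_nonpos (by positivity) h (by norm_num))

theorem vonMangoldt_mul_cesaroKernel_eq_zero {a : ℝ} (ha : 1 < a) (n : ℕ) {t : ℝ} (ht : 1 ≤ t) :
    ArithmeticFunction.vonMangoldt n * cesaroKernel a (n * t) = 0 := by
  rcases eq_or_ne n 0 with rfl | hn
  · simp
  have hn1 : (1 : ℝ) ≤ n := by exact_mod_cast Nat.one_le_iff_ne_zero.2 hn
  rw [cesaroKernel_of_one_le ha (by nlinarith), mul_zero]

/-- Zeros lie in the critical strip or on the real axis to the left of -2, hence away from the point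
-1 where the estimates in |z+1| would degenerate. -/
theorem re_le_one_of_riemannZeta₁_eq_zero {z : ℂ} (hz : riemannZeta₁ z = 0) :
    z.re ≤ 1 ∧ 1 ≤ ‖z + 1‖ ∧ 1 + ‖z‖ ≤ 3 * ‖z + 1‖ := by
  rcases mem_zetaZeros_or_of_riemannZeta₁_eq_zero hz with h | ⟨h1, h2⟩
  · have h0 := h.2.1
    have hn : ‖z‖ ≤ ‖z + 1‖ := by
      rw [← sq_le_sq₀ (norm_nonneg _) (norm_nonneg _), Complex.sq_norm, Complex.sq_norm,
        normSq_apply, normSq_apply]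
      simp only [add_re, one_re, add_im, one_im, add_zero]
      nlinarith
    have h1 : 1 ≤ ‖z + 1‖ := by
      have := Complex.re_le_norm (z + 1)
      simp only [add_re, one_re] at this
      linarith
    exact ⟨h.2.2.le, h1, by linarith⟩
  · have hzr : z = (z.re : ℂ) := by
      apply Complex.ext <;> simp [h1]
    have e1 : ‖z‖ = -z.re := by
      conv_lhs => rw [hzr]
      rw [Complex.norm_real, Real.norm_of_nonpos (by linarith)]
    have e2 : ‖z + 1‖ = -z.re - 1 := by
      conv_lhs => rw [hzr]
      rw [← ofReal_one, ← ofReal_add, Complex.norm_real, Real.norm_of_nonpos (by linarith)]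
      ring
    rw [e1, e2]
    refine ⟨by linarith, by linarith, by linarith⟩

/-- The summable weight attached to a zero `z`. -/
noncomputable def zeroWeight (c : ℝ) (z : ℂ) : ℝ :=
  (analyticOrderNatAt riemannZeta₁ z : ℝ) * (1 + ‖z‖) ^ (-(1 + min 1 c))

theorem summable_zeroWeight {c : ℝ} (hc : 0 < c) : Summable (zeroWeight c) :=
  summable_riemannZeta₁_zeros (by
    have : 0 < min 1 c := lt_min one_pos hc
    linarith)

theorem zeroWeight_nonneg (c : ℝ) (z : ℂ) : 0 ≤ zeroWeight c z := by
  unfold zeroWeight; positivity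

/-- The factor 1/z costs only a constant over 1/(1+|z|), as no zero lies near 0. The total exponent
1 + min(1,c) exceeds 1, the order of (s-1)ζ(s), so the weights are summable. -/
theorem exists_norm_div_mul_rpow_le {c : ℝ} (hc : 0 < c) : ∃ K : ℝ, 0 ≤ K ∧
    ∀ z, riemannZeta₁ z = 0 → ‖(analyticOrderNatAt riemannZeta₁ z : ℂ) / z‖
      * ‖z + 1‖ ^ (-min 1 c) ≤ K * zeroWeight c z := by
  obtain ⟨ε, hε, hball⟩ := Metric.eventually_nhds_iff.1
    (differentiable_riemannZeta₁.continuous.continuousAt.eventually_ne riemannZeta₁_zero_ne_zero)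
  refine ⟨(1 + ε⁻¹) * 3, by positivity, fun z hz => ?_⟩
  obtain ⟨-, h1, h3⟩ := re_le_one_of_riemannZeta₁_eq_zero hz
  have hzε : ε ≤ ‖z‖ := by
    by_contra h
    exact hball (by simpa using not_le.1 h) hz
  have hz0 : 0 < ‖z‖ := hε.trans_le hzε
  have hδ : 0 < min 1 c := lt_min one_pos hc
  have hp1 : (0 : ℝ) < 1 + ‖z‖ := by linarith
  have hb1 : ‖z‖⁻¹ ≤ (1 + ε⁻¹) * (1 + ‖z‖)⁻¹ := by
    rw [inv_eq_one_div, ← div_eq_mul_inv, div_le_div_iff₀ hz0 hp1]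
    have : 1 ≤ ε⁻¹ * ‖z‖ := by
      rw [inv_mul_eq_div, le_div_iff₀ hε]; linarith
    linarith
  have hb2 : ‖z + 1‖ ^ (-min 1 c) ≤ 3 * (1 + ‖z‖) ^ (-min 1 c) := by
    have e : ((1 + ‖z‖) / 3) ^ (-min 1 c) = 3 ^ (min 1 c) * (1 + ‖z‖) ^ (-min 1 c) := by
      rw [Real.div_rpow hp1.le (by norm_num), Real.rpow_neg (by norm_num : (0 : ℝ) ≤ 3),
        div_inv_eq_mul, mul_comm]
    calc _ ≤ ((1 + ‖z‖) / 3) ^ (-min 1 c) :=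
          Real.rpow_le_rpow_of_nonpos (by positivity) (by linarith) (by linarith)
      _ = 3 ^ (min 1 c) * (1 + ‖z‖) ^ (-min 1 c) := e
      _ ≤ 3 * (1 + ‖z‖) ^ (-min 1 c) := by
          gcongr
          calc (3 : ℝ) ^ (min 1 c) ≤ 3 ^ (1 : ℝ) :=
                Real.rpow_le_rpow_of_exponent_le (by norm_num) (min_le_left _ _)
            _ = 3 := Real.rpow_one _
  rw [norm_div, Complex.norm_natCast, div_eq_mul_inv]
  calc _ ≤ (analyticOrderNatAt riemannZeta₁ z : ℝ) * ((1 + ε⁻¹) * (1 + ‖z‖)⁻¹)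
        * (3 * (1 + ‖z‖) ^ (-min 1 c)) := by gcongr
    _ = (1 + ε⁻¹) * 3 * ((analyticOrderNatAt riemannZeta₁ z : ℝ)
        * ((1 + ‖z‖)⁻¹ * (1 + ‖z‖) ^ (-min 1 c))) := by ring
    _ = _ := by
        rw [zeroWeight, neg_add, Real.rpow_add hp1, Real.rpow_neg_one]

/-- Each term is recognised by its Mellin transform: B(s,a) times, respectively, -ζ'/ζ(s), 1/(s-1),
a constant, and the sum of partial fractions. The expansion of ζ'/ζ says that the difference D of
the two sides has transform 0, and D is continuous at t, so inversion gives D(t) = 0. -/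
theorem cesaro_vonMangoldt_eq {a : ℝ} (ha : 1 < a) {t : ℝ} (ht : t ∈ Set.Ioo (0 : ℝ) 1) :
    ∑' n : ℕ, ((ArithmeticFunction.vonMangoldt n * cesaroKernel a (n * t) : ℝ) : ℂ)
      = (t : ℂ) ^ (-1 : ℂ) * (cesaroKernel (a + 1) t : ℂ) / a
        - logDeriv riemannZeta₁ 0 * (cesaroKernel a t : ℂ)
        - ((a : ℂ) - 1) * ∑' z : {z // riemannZeta₁ z = 0},
          (analyticOrderNatAt riemannZeta₁ z : ℂ) / z * zeroKernel (a - 1) z t := by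
  have hc : 0 < a - 1 := by linarith
  have ha0 : (a : ℂ) ≠ 0 := by exact_mod_cast (by linarith : a ≠ 0)
  have := countable_riemannZeta₁_zeros
  obtain ⟨K, hK0, hK⟩ := exists_norm_div_mul_rpow_le hc
  set b := logDeriv riemannZeta₁ 0 with hb
  set FΛ : ℕ → ℝ → ℂ := fun n t =>
    ((ArithmeticFunction.vonMangoldt n * cesaroKernel a (n * t) : ℝ) : ℂ) with hFΛ
  set FZ : {z // riemannZeta₁ z = 0} → ℝ → ℂ := fun z t =>
    (analyticOrderNatAt riemannZeta₁ z : ℂ) / z * zeroKernel (a - 1) z t with hFZ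
  set uZ : {z // riemannZeta₁ z = 0} → ℝ := fun z =>
    (4 + 1 / (a - 1)) * (K * zeroWeight (a - 1) z) with huZ
  have huZs : Summable uZ :=
    (((summable_zeroWeight hc).comp_injective Subtype.val_injective).mul_left K).mul_left _
  have hFΛc : ∀ n, Continuous (FΛ n) := fun n =>
    Complex.continuous_ofReal.comp (((continuous_cesaroKernel ha).comp
      (continuous_const.mul continuous_id)).const_mul _)
  have hFΛb : ∀ n, ∀ t ∈ Set.Ioc (0 : ℝ) 1, ‖FΛ n t‖ ≤
      ArithmeticFunction.vonMangoldt n * (n : ℝ) ^ (-(3 / 2) : ℝ) * t ^ (-(3 / 2) : ℝ) := by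
    intro n t ht
    rw [hFΛ]
    simp only
    rw [Complex.norm_real, Real.norm_of_nonneg (mul_nonneg ArithmeticFunction.vonMangoldt_nonneg
      (cesaroKernel_nonneg _ _))]
    exact vonMangoldt_mul_cesaroKernel_le ha n ht.1
  have hFZb : ∀ z, ∀ t ∈ Set.Ioc (0 : ℝ) 1, ‖FZ z t‖ ≤ uZ z * t ^ (-1 : ℝ) := by
    intro z t ht
    obtain ⟨h1, h2, -⟩ := re_le_one_of_riemannZeta₁_eq_zero z.2
    have h3 := norm_cpow_mul_incBeta_le hc h1 h2 ht
    have ht0 := ht.1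
    rw [hFZ]
    simp only
    rw [norm_mul, zeroKernel, Set.indicator_of_mem ht]
    calc _ ≤ ‖(analyticOrderNatAt riemannZeta₁ z : ℂ) / z‖ * ((4 + 1 / (a - 1)) *
          ‖(z : ℂ) + 1‖ ^ (-min 1 (a - 1)) * t ^ (-1 : ℝ)) := by gcongr
      _ = (4 + 1 / (a - 1)) * (‖(analyticOrderNatAt riemannZeta₁ z : ℂ) / z‖ *
          ‖(z : ℂ) + 1‖ ^ (-min 1 (a - 1))) * t ^ (-1 : ℝ) := by ring
      _ ≤ _ := by
          have := hK z z.2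
          have h4 : 0 ≤ 4 + 1 / (a - 1) := by positivity
          exact mul_le_mul_of_nonneg_right (mul_le_mul_of_nonneg_left this h4) (by positivity)
  set D : ℝ → ℂ := fun t => ∑' n, FΛ n t - (t : ℂ) ^ (-1 : ℂ) • ((cesaroKernel (a + 1) t : ℂ) / a)
      + b • (cesaroKernel a t : ℂ) + ((a : ℂ) - 1) • ∑' z, FZ z t with hD
  have hmain : ∀ s : ℂ, 3 / 2 < s.re → HasMellin D s 0 := by
    intro s hs
    have hs0 : 0 < s.re := by linarith
    obtain ⟨c1, v1⟩ := hasSum_mellin_tsum (r := 3 / 2) summable_vonMangoldt_mul_rpow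
      (fun n => (hFΛc n).aestronglyMeasurable) hFΛb
      (fun n t ht => by rw [hFΛ]; simp only; rw [vonMangoldt_mul_cesaroKernel_eq_zero ha n ht.le,
        ofReal_zero]) hs
    obtain ⟨c2, v2⟩ := hasSum_mellin_tsum (F := FZ) (r := 1) huZs
      (fun z => (aestronglyMeasurable_zeroKernel hc z _).const_mul _) hFZb
      (fun z t ht => by
        have h1 : zeroKernel (a - 1) z t = 0 :=
          Set.indicator_of_notMem (fun h => absurd h.2 (not_le.2 ht)) _
        simp only [hFZ, h1, mul_zero])
      (s := s) (by linarith)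
    obtain ⟨c3, v3⟩ := hasMellin_cesaroKernel ha hs0
    obtain ⟨c4, v4⟩ := hasMellin_cesaroKernel (a := a + 1) (by linarith)
      (s := s + (-1)) (by simp; linarith)
    have c5 : MellinConvergent (fun t : ℝ => (t : ℂ) ^ (-1 : ℂ) •
        ((cesaroKernel (a + 1) t : ℂ) / a)) s :=
      MellinConvergent.cpow_smul.2 (c4.div_const _)
    have v5 : mellin (fun t : ℝ => (t : ℂ) ^ (-1 : ℂ) • ((cesaroKernel (a + 1) t : ℂ) / a)) s
        = betaIntegral (s - 1) (a + 1) / a := by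
      rw [mellin_cpow_smul, mellin_div_const, v4]
      push_cast; ring_nf
    have m1 := hasMellin_sub c1 c5
    have m2 := hasMellin_add m1.1 (c3.const_smul b)
    have m3 := hasMellin_add m2.1 (c2.const_smul ((a : ℂ) - 1))
    refine ⟨m3.1, ?_⟩
    rw [hD, m3.2, m2.2, m1.2, v5, mellin_const_smul, v3, mellin_const_smul, ← v1.tsum_eq,
      ← v2.tsum_eq]
    have e1 : ∑' n, mellin (FΛ n) s
        = LSeries (fun n => (ArithmeticFunction.vonMangoldt n : ℂ)) s * betaIntegral s a := by
      rw [LSeries, ← tsum_mul_right]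
      refine tsum_congr fun n => ?_
      rcases eq_or_ne n 0 with rfl | hn
      · simp [hFΛ, mellin]
      · have hn0 : (0 : ℝ) < n := by positivity
        have : FΛ n = fun t => (ArithmeticFunction.vonMangoldt n : ℂ) •
            (fun t => (cesaroKernel a t : ℂ)) ((n : ℝ) * t) := by
          ext t; simp [hFΛ]
        rw [this, mellin_const_smul, mellin_comp_mul_left (fun t => (cesaroKernel a t : ℂ)) s hn0,
          v3, LSeries.term_of_ne_zero hn, cpow_neg]
        simp only [smul_eq_mul, ofReal_natCast]
        rw [div_eq_mul_inv]; ring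
    have e2 : ((a : ℂ) - 1) • ∑' z, mellin (FZ z) s = betaIntegral s a *
        (1 / (s - 1) - b - LSeries (fun n => (ArithmeticFunction.vonMangoldt n : ℂ)) s) := by
      -- s B(s,a) = (a-1) B(s+1,a-1): the factor s of the partial fraction is traded for a shift of
      -- the Beta integral.
      have hrec := betaIntegral_recurrence (u := s) (v := (a : ℂ) - 1) hs0 (by simpa using hc)
      rw [sub_add_cancel] at hrec
      rw [← (hasSum_LSeries_vonMangoldt (s := s) (by linarith)).tsum_eq, smul_eq_mul,
        ← tsum_mul_left, ← tsum_mul_left]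
      refine tsum_congr fun z => ?_
      obtain ⟨h1, h2, -⟩ := re_le_one_of_riemannZeta₁_eq_zero z.2
      have hm := (hasMellin_zeroKernel hc h1 h2 (s := s) (by linarith)).2
      have : mellin (FZ z) s = (analyticOrderNatAt riemannZeta₁ z : ℂ) / z *
          (betaIntegral (s + 1) (a - 1 : ℝ) / (s - z)) := by
        rw [← hm]
        exact mellin_const_smul (zeroKernel (a - 1) z) s
          ((analyticOrderNatAt riemannZeta₁ z : ℂ) / z)
      rw [this]
      push_cast
      linear_combination -((analyticOrderNatAt riemannZeta₁ z : ℂ) / z / (s - z)) * hrec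
    have hrec2 := betaIntegral_recurrence (u := s - 1) (v := a) (by simp; linarith)
      (by simp; linarith)
    rw [sub_add_cancel] at hrec2
    have hs1 : s - 1 ≠ 0 := by
      intro h
      have := congrArg Complex.re h
      simp at this; linarith
    rw [e1, e2]
    -- The pole of ζ: (s-1) B(s-1,a+1) = a B(s,a).
    have e3 : betaIntegral (s - 1) (a + 1) / a = betaIntegral s a / (s - 1) := by
      rw [div_eq_div_iff ha0 hs1]; linear_combination hrec2
    rw [e3, smul_eq_mul]
    ring
  have hcont : ContinuousAt D t := by
    have ht0 := ht.1
    have hmem : Set.Ioo (t / 2) 1 ∈ 𝓝 t := isOpen_Ioo.mem_nhds ⟨by linarith, ht.2⟩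
    have hsub : Set.Ioo (t / 2) 1 ⊆ Set.Ioc 0 1 := fun x hx => ⟨by linarith [hx.1], hx.2.le⟩
    have k1 : ContinuousAt (fun t => ∑' n, FΛ n t) t := by
      refine (continuousOn_tsum (s := Set.Ioo (t / 2) 1) (fun n => (hFΛc n).continuousOn)
        (summable_vonMangoldt_mul_rpow.mul_right ((t / 2) ^ (-(3 / 2) : ℝ)))
        fun n x hx => (hFΛb n x (hsub hx)).trans ?_).continuousAt hmem
      refine mul_le_mul_of_nonneg_left ?_
        (mul_nonneg ArithmeticFunction.vonMangoldt_nonneg (by positivity))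
      exact Real.rpow_le_rpow_of_nonpos (by linarith) hx.1.le (by norm_num)
    have k2 : ContinuousAt (fun t => ∑' z, FZ z t) t := by
      refine (continuousOn_tsum (s := Set.Ioo (t / 2) 1) (fun z => ?_)
        (huZs.mul_right ((t / 2) ^ (-1 : ℝ)))
        fun z x hx => (hFZb z x (hsub hx)).trans ?_).continuousAt hmem
      · refine ContinuousOn.mul continuousOn_const ?_
        refine ((continuousOn_cpow_mul_incBeta hc z (-z)).mono hsub).congr fun x hx => ?_
        rw [zeroKernel, Set.indicator_of_mem (hsub hx)]
      · refine mul_le_mul_of_nonneg_left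
          (Real.rpow_le_rpow_of_nonpos (by linarith) hx.1.le (by norm_num)) ?_
        rw [huZ]
        have := zeroWeight_nonneg (a - 1) z
        positivity
    have k3 : ContinuousAt (fun t : ℝ => (cesaroKernel a t : ℂ)) t :=
      (Complex.continuous_ofReal.comp (continuous_cesaroKernel ha)).continuousAt
    have k4 : ContinuousAt (fun t : ℝ => (cesaroKernel (a + 1) t : ℂ) / a) t :=
      ((Complex.continuous_ofReal.comp
        (continuous_cesaroKernel (by linarith))).div_const _).continuousAt
    have k5 : ContinuousAt (fun t : ℝ => (t : ℂ) ^ (-1 : ℂ)) t :=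
      Complex.continuousAt_ofReal_cpow_const _ _ (Or.inr ht0.ne')
    exact ((k1.sub (k5.smul k4)).add (k3.const_smul b)).add (k2.const_smul ((a : ℂ) - 1))
  -- Inversion on Re s = 2, inside the half-plane Re s > 3/2; integrability on the line is trivial
  -- for the zero function.
  have hvert : ∀ y : ℝ, mellin D (((2 : ℝ) : ℂ) + y * I) = 0 := fun y =>
    (hmain _ (by simp; norm_num)).2
  have hinv := mellinInv_mellin_eq 2 D ht.1 (hmain _ (by simp; norm_num)).1
    (by simp only [VerticalIntegrable, hvert]; exact integrable_zero _ _ _) hcont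
  rw [mellinInv] at hinv
  simp only [hvert, smul_zero, MeasureTheory.integral_zero] at hinv
  have h0 : D t = 0 := hinv.symm
  rw [hD] at h0
  simp only [smul_eq_mul] at h0
  linear_combination h0

/-! ### The explicit formula with bounded error -/

theorem ne_one_of_mem_zetaZeros {ρ : ℂ} (hρ : ρ ∈ zetaZeros) : ρ ≠ 1 := by
  rintro rfl
  have := hρ.2.2
  simp at this

theorem riemannZeta₁_eq_zero_of_mem {ρ : ℂ} (hρ : ρ ∈ zetaZeros) : riemannZeta₁ ρ = 0 := by
  rw [riemannZeta₁_eq_mul (ne_one_of_mem_zetaZeros hρ), hρ.1, mul_zero]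

theorem countable_zetaZeros : Countable zetaZeros := by
  have : Countable {z | riemannZeta₁ z = 0} := countable_riemannZeta₁_zeros
  exact (Set.inclusion_injective (s := zetaZeros) (t := {z | riemannZeta₁ z = 0})
    fun ρ hρ => riemannZeta₁_eq_zero_of_mem hρ).countable

/-- The coefficient of `x ^ ρ` in the explicit formula for Cesàro means. -/
noncomputable def zeroCoeff (a : ℝ) (ρ : ℂ) : ℂ :=
  (analyticOrderNatAt riemannZeta₁ ρ : ℂ) * betaIntegral ρ a

theorem zeroCoeff_eq {a : ℝ} (ha : 1 < a) {ρ : ℂ} (hρ : ρ ∈ zetaZeros) :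
    zeroCoeff a ρ = ((a : ℂ) - 1) * ((analyticOrderNatAt riemannZeta₁ ρ : ℂ) / ρ
      * incBeta (a - 1) ρ 0) := by
  have h := betaIntegral_recurrence (u := ρ) (v := (a : ℂ) - 1) hρ.2.1 (by simp; linarith)
  have hρ0 : ρ ≠ 0 := by rintro rfl; have := hρ.2.1; simp at this
  rw [sub_add_cancel] at h
  rw [incBeta_zero, zeroCoeff]
  push_cast
  field_simp
  linear_combination (analyticOrderNatAt riemannZeta₁ ρ : ℂ) * h

/-- The recurrence writes B(ρ,a) as (a-1)/ρ times a Beta integral with decay |ρ+1|^(-min(1,a-1)).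
The condition a > 1 pushes the combined exponent past 1; this absolute convergence underlies both
series of the theorem. -/
theorem summable_norm_zeroCoeff {a : ℝ} (ha : 1 < a) :
    Summable fun ρ : zetaZeros => ‖zeroCoeff a ρ‖ := by
  have hc : 0 < a - 1 := by linarith
  obtain ⟨K, hK0, hK⟩ := exists_norm_div_mul_rpow_le hc
  have hs := (summable_zeroWeight hc).comp_injective
    (Subtype.val_injective (p := fun z => z ∈ zetaZeros))
  refine Summable.of_nonneg_of_le (fun _ => norm_nonneg _) (fun ρ => ?_)
    (hs.mul_left ((a - 1) * (4 + 1 / (a - 1)) * K))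
  have hz := riemannZeta₁_eq_zero_of_mem ρ.2
  obtain ⟨-, h1, -⟩ := re_le_one_of_riemannZeta₁_eq_zero hz
  have hre := ρ.2.2.1
  have hb := norm_incBeta_le hc (z := (ρ : ℂ)) (t := 0) (V := 1) le_rfl zero_lt_one
    (Or.inr (by linarith)) h1 (fun u hu => by
      rcases hu.1.eq_or_lt with h | h
      · rw [← h, ofReal_zero, zero_cpow (by intro h; rw [h] at hre; simp at hre)]; simp
      · rw [Complex.norm_cpow_eq_rpow_re_of_pos h]
        exact Real.rpow_le_one h.le hu.2 hre.le)
  rw [mul_one] at hb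
  have ha1 : ‖(a : ℂ) - 1‖ = a - 1 := by
    rw [← ofReal_one, ← ofReal_sub, Complex.norm_real, Real.norm_of_nonneg hc.le]
  rw [zeroCoeff_eq ha ρ.2, norm_mul, norm_mul, ha1]
  calc _ ≤ (a - 1) * (‖(analyticOrderNatAt riemannZeta₁ ρ : ℂ) / ρ‖ *
        ((4 + 1 / (a - 1)) * ‖(ρ : ℂ) + 1‖ ^ (-min 1 (a - 1)))) := by gcongr
    _ = (a - 1) * (4 + 1 / (a - 1)) * (‖(analyticOrderNatAt riemannZeta₁ ρ : ℂ) / ρ‖ *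
        ‖(ρ : ℂ) + 1‖ ^ (-min 1 (a - 1))) := by ring
    _ ≤ (a - 1) * (4 + 1 / (a - 1)) * (K * zeroWeight (a - 1) ρ) := by
        exact mul_le_mul_of_nonneg_left (hK ρ hz) (by positivity)
    _ = _ := by simp only [Function.comp]; ring

/-- The explicit formula for Cesàro means of the von Mangoldt function, with a bounded error. -/
theorem exists_norm_cesaro_vonMangoldt_sub_le {a : ℝ} (ha : 1 < a) :
    ∃ C : ℝ, 0 ≤ C ∧ ∀ t : ℝ, 0 < t →
      ‖∑' n : ℕ, ((ArithmeticFunction.vonMangoldt n * cesaroKernel a (n * t) : ℝ) : ℂ)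
        - ((t⁻¹ / a : ℝ) : ℂ) + ∑' ρ : zetaZeros, zeroCoeff a ρ * (t : ℂ) ^ (-(ρ : ℂ))‖ ≤ C := by
  have hc : 0 < a - 1 := by linarith
  have hδ : 0 < min 1 (a - 1) := lt_min one_pos hc
  have ha0 : 0 < a := by linarith
  obtain ⟨K, hK0, hK⟩ := exists_norm_div_mul_rpow_le hc
  set B := ∑' n : ℕ, ArithmeticFunction.vonMangoldt n * (n : ℝ) ^ (-(3 / 2) : ℝ) with hB
  set Q := ∑' ρ : zetaZeros, ‖zeroCoeff a ρ‖ with hQ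
  set W := 4 * max 1 ((1 / 2 : ℝ) ^ (a - 1 - 1)) with hW
  set A := max W (4 + 1 / (a - 1)) with hA
  have hW0 : 0 ≤ W := by positivity
  have hA0 : 0 ≤ A := hW0.trans (le_max_left _ _)
  have hB0 : 0 ≤ B := tsum_nonneg fun n =>
    mul_nonneg ArithmeticFunction.vonMangoldt_nonneg (by positivity)
  have hQ0 : 0 ≤ Q := tsum_nonneg fun _ => norm_nonneg _
  set Y := ∑' z : {z // riemannZeta₁ z = 0}, zeroWeight (a - 1) z with hY
  have hYs : Summable fun z : {z // riemannZeta₁ z = 0} => zeroWeight (a - 1) z :=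
    (summable_zeroWeight hc).comp_injective Subtype.val_injective
  have hY0 : 0 ≤ Y := tsum_nonneg fun z => zeroWeight_nonneg _ _
  have hae : ‖(a : ℂ) - 1‖ = a - 1 := by
    rw [← ofReal_one, ← ofReal_sub, Complex.norm_real, Real.norm_of_nonneg hc.le]
  refine ⟨(B * (1 / 2) ^ (-(3 / 2) : ℝ) + 2 / a + Q * 2) +
    (1 + ‖logDeriv riemannZeta₁ 0‖ + (a - 1) * (A * K * Y)), by positivity, fun t ht => ?_⟩
  rcases le_or_gt (1 / 2) t with h2 | h2
  -- For t ≥ 1/2 each of the three quantities is bounded separately.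
  · refine le_trans ?_ (le_add_of_nonneg_right (by positivity))
    have b1 : ‖∑' n : ℕ, ((ArithmeticFunction.vonMangoldt n * cesaroKernel a (n * t) : ℝ) : ℂ)‖
        ≤ B * (1 / 2) ^ (-(3 / 2) : ℝ) := by
      refine tsum_of_norm_bounded (summable_vonMangoldt_mul_rpow.hasSum.mul_right _) fun n => ?_
      rw [Complex.norm_real, Real.norm_of_nonneg (mul_nonneg
        ArithmeticFunction.vonMangoldt_nonneg (cesaroKernel_nonneg _ _))]
      refine (vonMangoldt_mul_cesaroKernel_le ha n ht).trans ?_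
      refine mul_le_mul_of_nonneg_left ?_
        (mul_nonneg ArithmeticFunction.vonMangoldt_nonneg (by positivity))
      exact Real.rpow_le_rpow_of_nonpos (by norm_num) h2 (by norm_num)
    have ht2 : t⁻¹ ≤ 2 := by
      rw [inv_le_comm₀ ht (by norm_num)]; linarith
    have b2 : ‖((t⁻¹ / a : ℝ) : ℂ)‖ ≤ 2 / a := by
      rw [Complex.norm_real, Real.norm_of_nonneg (by positivity)]
      gcongr
    have b3 : ‖∑' ρ : zetaZeros, zeroCoeff a ρ * (t : ℂ) ^ (-(ρ : ℂ))‖ ≤ Q * 2 := by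
      refine tsum_of_norm_bounded ((summable_norm_zeroCoeff ha).hasSum.mul_right 2) fun ρ => ?_
      rw [norm_mul, Complex.norm_cpow_eq_rpow_re_of_pos ht]
      refine mul_le_mul_of_nonneg_left ?_ (norm_nonneg _)
      have h0 := ρ.2.2.1
      have h1 := ρ.2.2.2
      calc t ^ (-(ρ : ℂ)).re ≤ (1 / 2 : ℝ) ^ (-(ρ : ℂ)).re :=
            Real.rpow_le_rpow_of_nonpos (by norm_num) h2 (by simp; linarith)
        _ ≤ (1 / 2 : ℝ) ^ (-1 : ℝ) :=
            Real.rpow_le_rpow_of_exponent_ge (by norm_num) (by norm_num) (by simp; linarith)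
        _ = 2 := by rw [Real.rpow_neg_one]; norm_num
    exact (norm_add_le _ _).trans (add_le_add ((norm_sub_le _ _).trans (add_le_add b1 b2)) b3)
  · refine le_trans ?_ (le_add_of_nonneg_left (by positivity))
    have ht1 : t < 1 := by linarith
    have htm : t ∈ Set.Ioc (0 : ℝ) 1 := ⟨ht, ht1.le⟩
    classical
    -- T extends the terms by 0 to the trivial zeros, so that it can be compared with the kernel sum
    -- H zero by zero.
    set T : ℂ → ℂ := fun z => if z ∈ zetaZeros then zeroCoeff a z * (t : ℂ) ^ (-z) else 0 with hT
    set H : ℂ → ℂ := fun z => (analyticOrderNatAt riemannZeta₁ z : ℂ) / z * zeroKernel (a - 1) z t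
      with hH
    have hTsum : ∑' ρ : zetaZeros, zeroCoeff a ρ * (t : ℂ) ^ (-(ρ : ℂ))
        = ∑' z : {z // riemannZeta₁ z = 0}, T z := by
      have e1 : ∑' ρ : zetaZeros, zeroCoeff a ρ * (t : ℂ) ^ (-(ρ : ℂ)) = ∑' ρ : zetaZeros, T ρ :=
        tsum_congr fun ρ => by rw [hT]; simp [ρ.2]
      have hsupp : Function.support T ⊆ zetaZeros := by
        intro z hz
        by_contra h
        exact hz (by simp [hT, h])
      rw [e1, tsum_subtype_eq_of_support_subset hsupp]
      exact (tsum_subtype_eq_of_support_subset (s := {z | riemannZeta₁ z = 0})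
        (hsupp.trans fun z hz => riemannZeta₁_eq_zero_of_mem hz)).symm
    have hterm : ∀ z : {z // riemannZeta₁ z = 0},
        ‖T z - ((a : ℂ) - 1) * H z‖ ≤ (a - 1) * (A * K) * zeroWeight (a - 1) z := by
      rintro ⟨z, hz⟩
      obtain ⟨-, h1, -⟩ := re_le_one_of_riemannZeta₁_eq_zero hz
      have hHz : H z = (analyticOrderNatAt riemannZeta₁ z : ℂ) / z *
          ((t : ℂ) ^ (-z) * incBeta (a - 1) z t) := by
        rw [hH]; simp only; rw [zeroKernel, Set.indicator_of_mem htm]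
      have key : ∃ w : ℂ, ‖w‖ ≤ A * ‖z + 1‖ ^ (-min 1 (a - 1)) ∧ T z - ((a : ℂ) - 1) * H z
          = ((a : ℂ) - 1) * ((analyticOrderNatAt riemannZeta₁ z : ℂ) / z * w) := by
        by_cases hmem : z ∈ zetaZeros
        -- At a non-trivial zero the error is the missing piece over [0, t].
        · refine ⟨(t : ℂ) ^ (-z) * (incBeta (a - 1) z 0 - incBeta (a - 1) z t), ?_, ?_⟩
          · refine (norm_cpow_mul_incBeta_sub_le hc hmem.2.1.le ht h2.le).trans ?_
            rw [← hW, div_eq_mul_inv]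
            have hn0 : 0 < ‖z + 1‖ := by linarith
            refine mul_le_mul (le_max_left _ _) ?_ (by positivity) hA0
            rw [← Real.rpow_neg_one]
            exact Real.rpow_le_rpow_of_exponent_le h1 (neg_le_neg (min_le_left _ _))
          · rw [hHz, hT]
            simp only [if_pos hmem]
            rw [zeroCoeff_eq ha hmem]
            ring
        -- At a trivial zero the whole kernel is error. As Re z ≤ 0, |u^z| ≤ t^(Re z) on [t, 1],
        -- which cancels t^(-Re z) and leaves no growth as t → 0.
        · refine ⟨-((t : ℂ) ^ (-z) * incBeta (a - 1) z t), ?_, ?_⟩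
          · have hre : z.re ≤ 0 := by
              rcases mem_zetaZeros_or_of_riemannZeta₁_eq_zero hz with h | h
              · exact absurd h hmem
              · linarith [h.2]
            have hb := norm_incBeta_le hc (z := z) (t := t) (V := t ^ z.re) ht.le ht1
              (Or.inl ht) h1 (fun u hu => by
                rw [Complex.norm_cpow_eq_rpow_re_of_pos (ht.trans_le hu.1)]
                exact Real.rpow_le_rpow_of_nonpos ht hu.1 hre)
            rw [norm_neg, norm_mul, Complex.norm_cpow_eq_rpow_re_of_pos ht, neg_re]
            calc _ ≤ t ^ (-z.re) * ((4 + 1 / (a - 1)) * t ^ z.re *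
                  ‖z + 1‖ ^ (-min 1 (a - 1))) := by gcongr
              _ = (t ^ (-z.re) * t ^ z.re) * ((4 + 1 / (a - 1)) *
                  ‖z + 1‖ ^ (-min 1 (a - 1))) := by ring
              _ = (4 + 1 / (a - 1)) * ‖z + 1‖ ^ (-min 1 (a - 1)) := by
                  rw [← Real.rpow_add ht]; simp
              _ ≤ _ := by gcongr; exact le_max_right _ _
          · rw [hHz, hT]
            simp only [if_neg hmem]
            ring
      obtain ⟨w, hw, he⟩ := key
      rw [he, norm_mul, norm_mul, hae]
      calc _ ≤ (a - 1) * (‖(analyticOrderNatAt riemannZeta₁ z : ℂ) / z‖ *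
            (A * ‖z + 1‖ ^ (-min 1 (a - 1)))) := by gcongr
        _ = (a - 1) * A * (‖(analyticOrderNatAt riemannZeta₁ z : ℂ) / z‖ *
            ‖z + 1‖ ^ (-min 1 (a - 1))) := by ring
        _ ≤ (a - 1) * A * (K * zeroWeight (a - 1) z) := by
            exact mul_le_mul_of_nonneg_left (hK z hz) (mul_nonneg hc.le hA0)
        _ = _ := by ring
    have hTs : Summable fun z : {z // riemannZeta₁ z = 0} => T z := by
      have hinj : Function.Injective (Set.inclusion (s := zetaZeros) (t := {z | riemannZeta₁ z = 0})
        fun ρ hρ => riemannZeta₁_eq_zero_of_mem hρ) := Set.inclusion_injective _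
      refine (hinj.summable_iff ?_).1 ?_
      · rintro ⟨z, hz⟩ hnot
        have : z ∉ zetaZeros := fun h => hnot ⟨⟨z, h⟩, rfl⟩
        simp [hT, this]
      · refine Summable.of_norm_bounded ((summable_norm_zeroCoeff ha).mul_right t⁻¹) fun ρ => ?_
        have h1 := ρ.2.2.2
        simp only [Function.comp, hT, if_pos ρ.2]
        rw [norm_mul, Complex.norm_cpow_eq_rpow_re_of_pos ht, ← Real.rpow_neg_one]
        refine mul_le_mul_of_nonneg_left ?_ (norm_nonneg _)
        exact Real.rpow_le_rpow_of_exponent_ge ht ht1.le (by simp; linarith)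
    have hdiff : Summable fun z : {z // riemannZeta₁ z = 0} => T z - ((a : ℂ) - 1) * H z :=
      Summable.of_norm_bounded (hYs.mul_left _) hterm
    have hHs : Summable fun z : {z // riemannZeta₁ z = 0} => ((a : ℂ) - 1) * H z :=
      (hTs.sub hdiff).congr fun z => by ring
    rw [cesaro_vonMangoldt_eq ha ⟨ht, ht1⟩, hTsum]
    have e : (t : ℂ) ^ (-1 : ℂ) * (cesaroKernel (a + 1) t : ℂ) / a
        - logDeriv riemannZeta₁ 0 * (cesaroKernel a t : ℂ)
        - ((a : ℂ) - 1) * ∑' z : {z // riemannZeta₁ z = 0}, H z - ((t⁻¹ / a : ℝ) : ℂ)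
        + ∑' z : {z // riemannZeta₁ z = 0}, T z
        = ((t⁻¹ / a * (cesaroKernel (a + 1) t - 1) : ℝ) : ℂ)
          - logDeriv riemannZeta₁ 0 * (cesaroKernel a t : ℂ)
          + ∑' z : {z // riemannZeta₁ z = 0}, (T z - ((a : ℂ) - 1) * H z) := by
      rw [hTs.tsum_sub hHs, tsum_mul_left, cpow_neg_one]
      push_cast
      ring
    rw [e]
    have b1 : ‖((t⁻¹ / a * (cesaroKernel (a + 1) t - 1) : ℝ) : ℂ)‖ ≤ 1 := by
      rw [cesaroKernel_of_le_one ht1.le, add_sub_cancel_right, Complex.norm_real,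
        Real.norm_eq_abs, abs_le]
      -- Bernoulli: 1 - at ≤ (1-t)^a ≤ 1, so replacing t⁻¹(1-t)^a/a by t⁻¹/a costs at most 1.
      have h1 := one_add_mul_self_le_rpow_one_add (s := -t) (by linarith) ha.le
      have h3 : (1 - t) ^ a ≤ 1 := Real.rpow_le_one (by linarith) (by linarith) (by linarith)
      have h4 : 0 < t⁻¹ / a := by positivity
      rw [← sub_eq_add_neg] at h1
      have h5 : t⁻¹ / a * (a * t) = 1 := by field_simp
      constructor <;> nlinarith
    have b2 : ‖logDeriv riemannZeta₁ 0 * (cesaroKernel a t : ℂ)‖ ≤ ‖logDeriv riemannZeta₁ 0‖ := by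
      rw [norm_mul, Complex.norm_real, Real.norm_of_nonneg (cesaroKernel_nonneg _ _)]
      exact mul_le_of_le_one_right (norm_nonneg _) (cesaroKernel_le_one ha ht.le)
    have b3 : ‖∑' z : {z // riemannZeta₁ z = 0}, (T z - ((a : ℂ) - 1) * H z)‖
        ≤ (a - 1) * (A * K) * Y := tsum_of_norm_bounded (hYs.hasSum.mul_left _) hterm
    refine (norm_add_le _ _).trans ((add_le_add ((norm_sub_le _ _).trans
      (add_le_add b1 b2)) b3).trans (le_of_eq (by ring)))

/-! ### Convolutions of sums of powers -/

/-- The generalized Dirichlet-type sum `∑ i, g i * x ^ w i` of powers of `x`. -/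
noncomputable def powSum {ι : Type*} (g w : ι → ℂ) (x : ℝ) : ℂ := ∑' i, g i * (x : ℂ) ^ w i

theorem norm_ofReal_cpow_le {x X A : ℝ} {w : ℂ} (hx : 0 ≤ x) (hxX : x ≤ X) (hX : 1 ≤ X)
    (hw : 0 < w.re) (hwA : w.re ≤ A) : ‖(x : ℂ) ^ w‖ ≤ X ^ A := by
  rw [Complex.norm_cpow_eq_rpow_re_of_nonneg hx hw.ne']
  exact (Real.rpow_le_rpow hx hxX hw.le).trans (Real.rpow_le_rpow_of_exponent_le hX hwA)

section PowSum

variable {ι κ : Type*} {g w : ι → ℂ} {h v : κ → ℂ} {X A : ℝ}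

theorem norm_mul_ofReal_cpow_le (hw : ∀ i, 0 < (w i).re) (hwA : ∀ i, (w i).re ≤ A)
    (hX : 1 ≤ X) {x : ℝ} (hx : x ∈ Set.Icc 0 X) (i : ι) :
    ‖g i * (x : ℂ) ^ w i‖ ≤ ‖g i‖ * X ^ A := by
  rw [norm_mul]
  exact mul_le_mul_of_nonneg_left (norm_ofReal_cpow_le hx.1 hx.2 hX (hw i) (hwA i)) (norm_nonneg _)

theorem summable_norm_mul_ofReal_cpow (hg : Summable fun i => ‖g i‖) (hw : ∀ i, 0 < (w i).re)
    (hwA : ∀ i, (w i).re ≤ A) (hX : 1 ≤ X) {x : ℝ} (hx : x ∈ Set.Icc 0 X) :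
    Summable fun i => ‖g i * (x : ℂ) ^ w i‖ :=
  Summable.of_nonneg_of_le (fun _ => norm_nonneg _)
    (norm_mul_ofReal_cpow_le hw hwA hX hx) (hg.mul_right _)

theorem continuousOn_powSum (hg : Summable fun i => ‖g i‖) (hw : ∀ i, 0 < (w i).re)
    (hwA : ∀ i, (w i).re ≤ A) (hX : 1 ≤ X) : ContinuousOn (powSum g w) (Set.Icc 0 X) :=
  continuousOn_tsum
    (fun i => (continuous_const.mul (Complex.continuous_ofReal_cpow_const (hw i))).continuousOn)
    (hg.mul_right (X ^ A)) fun i _ hx => norm_mul_ofReal_cpow_le hw hwA hX hx i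

theorem powSum_zero (hw : ∀ i, 0 < (w i).re) : powSum g w 0 = 0 := by
  have h0 : ∀ i, w i ≠ 0 := fun i h => by have := hw i; rw [h] at this; simp at this
  simp [powSum, zero_cpow (h0 _)]

/-- Convolutions of sums of powers can be computed termwise. -/
theorem hasSum_convolution_powSum [Countable ι] [Countable κ] (hg : Summable fun i => ‖g i‖)
    (hw : ∀ i, 0 < (w i).re) (hwA : ∀ i, (w i).re ≤ A) (hh : Summable fun j => ‖h j‖)
    (hv : ∀ j, 0 < (v j).re) (hvA : ∀ j, (v j).re ≤ A) (hX : 1 ≤ X) :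
    HasSum (fun p : ι × κ => g p.1 * h p.2 *
        ((X : ℂ) ^ (w p.1 + v p.2 + 1) * betaIntegral (w p.1 + 1) (v p.2 + 1)))
      (∫ x in (0 : ℝ)..X, powSum g w x * powSum h v (X - x)) := by
  have hX0 : 0 < X := by linarith
  have hsub : ∀ x ∈ Set.uIoc 0 X, x ∈ Set.Icc 0 X ∧ X - x ∈ Set.Icc 0 X := fun x hx => by
    rw [Set.uIoc_of_le hX0.le] at hx
    exact ⟨⟨hx.1.le, hx.2⟩, ⟨by linarith [hx.2], by linarith [hx.1]⟩⟩
  have key := intervalIntegral.hasSum_integral_of_dominated_convergence (μ := volume)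
    (a := 0) (b := X)
    (F := fun (p : ι × κ) (x : ℝ) =>
      (g p.1 * (x : ℂ) ^ w p.1) * (h p.2 * ((X - x : ℝ) : ℂ) ^ v p.2))
    (f := fun x => powSum g w x * powSum h v (X - x))
    (fun p _ => (‖g p.1‖ * X ^ A) * (‖h p.2‖ * X ^ A)) ?_ ?_ ?_ ?_ ?_
  · refine key.congr_fun ?_
    intro p
    have hb := betaIntegral_scaled (w p.1 + 1) (v p.2 + 1) hX0
    simp only [add_sub_cancel_right] at hb
    rw [show w p.1 + v p.2 + 1 = w p.1 + 1 + (v p.2 + 1) - 1 by ring, ← hb,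
      ← intervalIntegral.integral_const_mul]
    refine intervalIntegral.integral_congr fun x _ => ?_
    simp only [ofReal_sub]
    ring
  · intro p
    refine Continuous.aestronglyMeasurable ?_
    exact (continuous_const.mul (Complex.continuous_ofReal_cpow_const (hw _))).mul
      (continuous_const.mul ((Complex.continuous_ofReal_cpow_const (hv _)).comp
        (continuous_const.sub continuous_id)))
  · refine fun p => ae_of_all _ fun x hx => ?_
    rw [norm_mul]
    exact mul_le_mul (norm_mul_ofReal_cpow_le hw hwA hX (hsub x hx).1 _)
      (norm_mul_ofReal_cpow_le hv hvA hX (hsub x hx).2 _) (norm_nonneg _) (by positivity)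
  -- The majorants are constant in x and factor over the pair, so their double series converges as a
  -- product of two absolutely convergent ones.
  · refine ae_of_all _ fun x _ => ?_
    exact (hg.mul_right _).mul_of_nonneg (hh.mul_right _) (fun _ => by positivity)
      (fun _ => by positivity)
  · exact intervalIntegrable_const
  · refine ae_of_all _ fun x hx => ?_
    have h1 := summable_norm_mul_ofReal_cpow (g := g) hg hw hwA hX (hsub x hx).1
    have h2 := summable_norm_mul_ofReal_cpow (g := h) hh hv hvA hX (hsub x hx).2
    have h3 := summable_mul_of_summable_norm (f := fun i => g i * (x : ℂ) ^ w i)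
      (g := fun j => h j * ((X - x : ℝ) : ℂ) ^ v j) h1 h2
    exact HasSum.mul (f := fun i => g i * (x : ℂ) ^ w i)
      (g := fun j => h j * ((X - x : ℝ) : ℂ) ^ v j) h1.of_norm.hasSum h2.of_norm.hasSum h3

end PowSum

/-- Convolution of two shifted truncated powers. -/
theorem integral_max_rpow_mul_max_rpow {a : ℝ} (ha : 1 < a) {p q X : ℝ} (hp : 0 ≤ p) (hq : 0 ≤ q) :
    ∫ x in (0 : ℝ)..X, (((max (x - p) 0) ^ (a - 1) * (max (X - x - q) 0) ^ (a - 1) : ℝ) : ℂ)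
      = (((max (X - p - q) 0) ^ (2 * a - 1) : ℝ) : ℂ) * betaIntegral a a := by
  have ha0 : a - 1 ≠ 0 := by linarith
  set f : ℝ → ℂ := fun x => (((max (x - p) 0) ^ (a - 1) * (max (X - x - q) 0) ^ (a - 1) : ℝ) : ℂ)
    with hf
  have hz : ∀ x, x ≤ p ∨ X - q ≤ x → f x = 0 := by
    rintro x (h | h)
    · simp [hf, max_eq_right (show x - p ≤ 0 by linarith), Real.zero_rpow ha0]
    · simp [hf, max_eq_right (show X - x - q ≤ 0 by linarith), Real.zero_rpow ha0]
  have hcont : Continuous f := by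
    refine continuous_ofReal.comp (Continuous.mul ?_ ?_)
    · exact ((continuous_id.sub continuous_const).max continuous_const).rpow_const
        fun _ => Or.inr (by linarith)
    · exact (((continuous_const.sub continuous_id).sub continuous_const).max
        continuous_const).rpow_const fun _ => Or.inr (by linarith)
  rcases le_or_gt (X - p - q) 0 with hL | hL
  · rw [max_eq_right hL, Real.zero_rpow (by linarith), ofReal_zero, zero_mul]
    refine (intervalIntegral.integral_congr (g := fun _ => (0 : ℂ)) fun x _ => hz x ?_).trans
      (by simp)
    rcases le_total x p with h | h
    · exact Or.inl h
    · exact Or.inr (by linarith)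
  -- The integrand lives on [p, X - q]; translating by p leaves a Beta integral scaled to length X -
  -- p - q.
  · rw [← intervalIntegral.integral_add_adjacent_intervals (hcont.intervalIntegrable 0 p)
        (hcont.intervalIntegrable p X),
      ← intervalIntegral.integral_add_adjacent_intervals (hcont.intervalIntegrable p (X - q))
        (hcont.intervalIntegrable (X - q) X)]
    have h1 : ∫ x in (0 : ℝ)..p, f x = 0 :=
      (intervalIntegral.integral_congr (g := fun _ => (0 : ℂ)) fun x hx => hz x (Or.inl (by
        rw [Set.uIcc_of_le hp] at hx; exact hx.2))).trans (by simp)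
    have h2 : ∫ x in (X - q)..X, f x = 0 :=
      (intervalIntegral.integral_congr (g := fun _ => (0 : ℂ)) fun x hx => hz x (Or.inr (by
        rw [Set.uIcc_of_le (by linarith)] at hx; exact hx.1))).trans (by simp)
    have h3 := intervalIntegral.integral_comp_add_right (a := 0) (b := X - p - q) f p
    rw [zero_add, show X - p - q + p = X - q by ring] at h3
    rw [h1, h2, ← h3, zero_add, add_zero, max_eq_left hL.le,
      show (((X - p - q) ^ (2 * a - 1) : ℝ) : ℂ) = ((X - p - q : ℝ) : ℂ) ^ ((a : ℂ) + a - 1) by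
        rw [Complex.ofReal_cpow hL.le]; push_cast; ring_nf,
      ← betaIntegral_scaled a a hL]
    refine intervalIntegral.integral_congr fun x hx => ?_
    rw [Set.uIcc_of_le hL.le] at hx
    have e1 : x + p - p = x := by ring
    have e2 : X - (x + p) - q = X - p - q - x := by ring
    simp only [hf, e1, e2]
    rw [max_eq_left hx.1, max_eq_left (by linarith [hx.2]), ofReal_mul,
      Complex.ofReal_cpow hx.1, Complex.ofReal_cpow (by linarith [hx.2])]
    push_cast
    ring

/-! ### Riesz means of Λ and their self-convolution -/

/-- The Riesz mean `∑ n ≤ N, Λ n * (x - n)₊ ^ (a - 1)` of the von Mangoldt function. -/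
noncomputable def rieszSum (a : ℝ) (N : ℕ) (x : ℝ) : ℝ :=
  ∑ n ∈ Finset.range (N + 1), ArithmeticFunction.vonMangoldt n * (max (x - n) 0) ^ (a - 1)

theorem continuous_rieszSum {a : ℝ} (ha : 1 < a) (N : ℕ) : Continuous (rieszSum a N) := by
  refine continuous_finsetSum _ fun n _ => continuous_const.mul ?_
  exact ((continuous_id.sub continuous_const).max continuous_const).rpow_const
    fun _ => Or.inr (by linarith)

theorem rieszSum_zero {a : ℝ} (ha : 1 < a) (N : ℕ) : rieszSum a N 0 = 0 :=
  Finset.sum_eq_zero fun n _ => by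
    have hn : (0 : ℝ) ≤ n := n.cast_nonneg
    rw [max_eq_right (by linarith), Real.zero_rpow (by linarith), mul_zero]

theorem rieszSum_nonneg (a : ℝ) (N : ℕ) (x : ℝ) : 0 ≤ rieszSum a N x :=
  Finset.sum_nonneg fun _ _ => mul_nonneg ArithmeticFunction.vonMangoldt_nonneg
    (Real.rpow_nonneg (le_max_right _ _) _)

theorem rieszSum_le {a : ℝ} (ha : 1 < a) {N : ℕ} {x : ℝ} (hx : x ≤ N) :
    rieszSum a N x ≤ (Real.log 4 + 4) * N * (N : ℝ) ^ (a - 1) := by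
  have hN : (0 : ℝ) ≤ N := N.cast_nonneg
  calc rieszSum a N x
      ≤ ∑ n ∈ Finset.range (N + 1), ArithmeticFunction.vonMangoldt n * (N : ℝ) ^ (a - 1) := by
        refine Finset.sum_le_sum fun n _ => mul_le_mul_of_nonneg_left ?_
          ArithmeticFunction.vonMangoldt_nonneg
        have hn : (0 : ℝ) ≤ n := n.cast_nonneg
        exact Real.rpow_le_rpow (le_max_right _ _) (max_le (by linarith) hN) (by linarith)
    _ = Chebyshev.psi N * (N : ℝ) ^ (a - 1) := by
        rw [Chebyshev.psi_eq_sum_Icc, Nat.floor_natCast, ← Finset.sum_mul,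
          Nat.range_succ_eq_Icc_zero]
    _ ≤ _ := mul_le_mul_of_nonneg_right (Chebyshev.psi_le_const_mul_self hN) (by positivity)

/-- The substitution t = 1/x links Riesz and Cesàro means. Cutting the sum at N loses nothing, since
terms with n ≥ x vanish. -/
theorem rieszSum_eq_tsum {a : ℝ} (ha : 1 < a) {N : ℕ} {x : ℝ} (hx : 0 < x) (hxN : x ≤ N) :
    (rieszSum a N x : ℂ) = ((x ^ (a - 1) : ℝ) : ℂ) *
      ∑' n : ℕ, ((ArithmeticFunction.vonMangoldt n * cesaroKernel a (n * x⁻¹) : ℝ) : ℂ) := by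
  rw [← ofReal_tsum, ← ofReal_mul, tsum_eq_sum (s := Finset.range (N + 1)), rieszSum,
    Finset.mul_sum]
  · congr 1
    refine Finset.sum_congr rfl fun n _ => ?_
    rw [cesaroKernel, mul_left_comm, ← Real.mul_rpow hx.le (le_max_right _ _),
      mul_max_of_nonneg _ _ hx.le]
    congr 4
    · field_simp
    · simp
  · intro n hn
    have hnN : (N : ℝ) ≤ n := by
      have : N + 1 ≤ n := by simpa using hn
      exact_mod_cast (Nat.le_succ N).trans this
    rw [cesaroKernel_of_one_le ha, mul_zero]
    rw [← div_eq_mul_inv, le_div_iff₀ hx]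
    linarith

/-- Expanding the product, a pair (m₁, m₂) contributes B(a,a) (N - m₁ - m₂)₊^(2a-1); grouping the
pairs by their sum produces the Goldbach weights. -/
theorem integral_rieszSum_mul_rieszSum {a : ℝ} (ha : 1 < a) (N : ℕ) :
    ∫ x in (0 : ℝ)..N, (rieszSum a N x : ℂ) * (rieszSum a N (N - x) : ℂ)
      = ((∑ n ∈ Finset.Icc 1 N, goldbachR n * ((N : ℝ) - n) ^ (2 * a - 1) : ℝ) : ℂ)
        * betaIntegral a a := by
  have hcont : ∀ p q : ℝ, Continuous fun x : ℝ =>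
      (((max (x - p) 0) ^ (a - 1) * (max (N - x - q) 0) ^ (a - 1) : ℝ) : ℂ) := fun p q => by
    refine continuous_ofReal.comp (Continuous.mul ?_ ?_)
    · exact ((continuous_id.sub continuous_const).max continuous_const).rpow_const
        fun _ => Or.inr (by linarith)
    · exact (((continuous_const.sub continuous_id).sub continuous_const).max
        continuous_const).rpow_const fun _ => Or.inr (by linarith)
  set f : ℕ × ℕ → ℝ := fun p => ArithmeticFunction.vonMangoldt p.1 *
    ArithmeticFunction.vonMangoldt p.2 * (max ((N : ℝ) - p.1 - p.2) 0) ^ (2 * a - 1) with hf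
  have h1 : ∀ x : ℝ, (rieszSum a N x : ℂ) * (rieszSum a N (N - x) : ℂ)
      = ∑ p ∈ Finset.range (N + 1) ×ˢ Finset.range (N + 1),
        ((ArithmeticFunction.vonMangoldt p.1 * ArithmeticFunction.vonMangoldt p.2 : ℝ) : ℂ) *
        (((max (x - p.1) 0) ^ (a - 1) * (max (N - x - p.2) 0) ^ (a - 1) : ℝ) : ℂ) := by
    intro x
    rw [← ofReal_mul, rieszSum, rieszSum, Finset.sum_mul_sum, ← Finset.sum_product', ofReal_sum]
    refine Finset.sum_congr rfl fun p _ => ?_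
    push_cast
    ring
  have h2 : ∑ p ∈ Finset.range (N + 1) ×ˢ Finset.range (N + 1), f p
      = ∑ n ∈ Finset.Icc 1 N, goldbachR n * ((N : ℝ) - n) ^ (2 * a - 1) := by
    have e1 : ∑ p ∈ (Finset.range (N + 1) ×ˢ Finset.range (N + 1)).filter
        (fun p => p.1 + p.2 ≤ N), f p
        = ∑ p ∈ Finset.range (N + 1) ×ˢ Finset.range (N + 1), f p := by
      refine Finset.sum_subset (Finset.filter_subset _ _) fun p hp hnp => ?_
      have hlt : N < p.1 + p.2 := by
        by_contra h
        exact hnp (Finset.mem_filter.2 ⟨hp, not_lt.1 h⟩)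
      have hlt' : (N : ℝ) ≤ p.1 + p.2 := by exact_mod_cast hlt.le
      simp only [hf]
      rw [max_eq_right (by linarith), Real.zero_rpow (by linarith), mul_zero]
    rw [← e1, ← Finset.sum_fiberwise_of_maps_to (g := fun p => p.1 + p.2)
      (t := Finset.range (N + 1)) (fun p hp => by
        have := (Finset.mem_filter.1 hp).2
        simp only [Finset.mem_range]
        omega)]
    have e2 : ∀ n ∈ Finset.range (N + 1),
        ∑ p ∈ ((Finset.range (N + 1) ×ˢ Finset.range (N + 1)).filter
          (fun p => p.1 + p.2 ≤ N)).filter (fun p => p.1 + p.2 = n), f p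
        = goldbachR n * ((N : ℝ) - n) ^ (2 * a - 1) := by
      intro n hn
      rw [Finset.mem_range] at hn
      have hs : ((Finset.range (N + 1) ×ˢ Finset.range (N + 1)).filter
          (fun p => p.1 + p.2 ≤ N)).filter (fun p => p.1 + p.2 = n)
          = Finset.HasAntidiagonal.antidiagonal n := by
        ext p
        simp only [Finset.mem_filter, Finset.mem_product, Finset.mem_range,
          Finset.HasAntidiagonal.mem_antidiagonal]
        omega
      rw [hs, goldbachR, Finset.sum_mul]
      refine Finset.sum_congr rfl fun p hp => ?_
      have hpn : (p.1 : ℝ) + p.2 = n := by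
        exact_mod_cast Finset.HasAntidiagonal.mem_antidiagonal.1 hp
      have hnN : (n : ℝ) ≤ N := by exact_mod_cast Nat.lt_succ_iff.1 hn
      simp only [hf]
      rw [max_eq_left (by linarith), ← hpn, sub_sub]
    rw [Finset.sum_congr rfl e2]
    refine (Finset.sum_subset (fun n hn => ?_) fun n hn hnn => ?_).symm
    · simp only [Finset.mem_Icc, Finset.mem_range] at hn ⊢
      omega
    · have : n = 0 := by
        simp only [Finset.mem_Icc, Finset.mem_range] at hn hnn
        omega
      -- The range includes n = 0, which contributes nothing because Λ(0) = 0.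
      subst this
      simp [goldbachR]
  have hInt : ∀ p ∈ Finset.range (N + 1) ×ˢ Finset.range (N + 1), IntervalIntegrable (fun x : ℝ =>
      ((ArithmeticFunction.vonMangoldt p.1 * ArithmeticFunction.vonMangoldt p.2 : ℝ) : ℂ) *
        (((max (x - p.1) 0) ^ (a - 1) * (max (N - x - p.2) 0) ^ (a - 1) : ℝ) : ℂ)) volume 0 N :=
    fun p _ => (continuous_const.mul (hcont _ _)).intervalIntegrable _ _
  simp only [h1]
  rw [intervalIntegral.integral_finsetSum hInt, ← h2, ofReal_sum, Finset.sum_mul]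
  refine Finset.sum_congr rfl fun p _ => ?_
  rw [intervalIntegral.integral_const_mul,
    integral_max_rpow_mul_max_rpow ha (Nat.cast_nonneg _) (Nat.cast_nonneg _)]
  simp only [hf]
  push_cast
  ring

theorem betaIntegral_eq_Gamma_div {s t : ℂ} (hs : 0 < s.re) (ht : 0 < t.re) :
    betaIntegral s t = Gamma s * Gamma t / Gamma (s + t) := by
  rw [Gamma_mul_Gamma_eq_betaIntegral hs ht,
    mul_div_cancel_left₀ _ (Gamma_ne_zero_of_re_pos (by rw [add_re]; positivity))]

theorem zeroCoeff_eq_Gamma {a : ℝ} (ha : 1 < a) {ρ : ℂ} (hρ : ρ ∈ zetaZeros) :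
    zeroCoeff a ρ = (zetaMult ρ : ℂ) * (Gamma ρ * Gamma a / Gamma (ρ + a)) := by
  rw [zeroCoeff, analyticOrderNatAt_riemannZeta₁ (ne_one_of_mem_zetaZeros hρ),
    betaIntegral_eq_Gamma_div hρ.2.1 (by rw [ofReal_re]; linarith)]

/-- The main term `x ^ a / a` of the Riesz mean of the von Mangoldt function. -/
noncomputable def mainPart (a : ℝ) : ℝ → ℂ :=
  powSum (fun _ : Unit => 1 / (a : ℂ)) (fun _ => (a : ℂ))

/-- The contribution of the zeros to the Riesz mean of the von Mangoldt function. -/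
noncomputable def zeroPart (a : ℝ) : ℝ → ℂ :=
  powSum (fun ρ : zetaZeros => zeroCoeff a ρ) (fun ρ => (ρ : ℂ) + a - 1)

theorem re_zero_exponent_pos {a : ℝ} (ha : 1 < a) (ρ : zetaZeros) : 0 < ((ρ : ℂ) + a - 1).re := by
  have := ρ.2.2.1
  simp only [sub_re, add_re, ofReal_re, one_re]
  linarith

/-- The bounded-error formula at t = 1/x, multiplied by x^(a-1) ≤ N^(a-1). At x = 0 all three
functions vanish. -/
theorem exists_norm_rieszSum_sub_le {a : ℝ} (ha : 1 < a) :
    ∃ C : ℝ, 0 ≤ C ∧ ∀ N : ℕ, ∀ x ∈ Set.Icc (0 : ℝ) N,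
      ‖(rieszSum a N x : ℂ) - (mainPart a x - zeroPart a x)‖ ≤ C * (N : ℝ) ^ (a - 1) := by
  obtain ⟨C, hC0, hC⟩ := exists_norm_cesaro_vonMangoldt_sub_le ha
  refine ⟨C, hC0, fun N x hx => ?_⟩
  have ha0 : (a : ℂ) ≠ 0 := ofReal_ne_zero.2 (by linarith)
  rcases hx.1.eq_or_lt with rfl | hx0
  · rw [rieszSum_zero ha, mainPart, zeroPart, powSum_zero (fun _ => by simp; linarith),
      powSum_zero (re_zero_exponent_pos ha)]
    simpa using by positivity
  have hxc : (x : ℂ) ≠ 0 := ofReal_ne_zero.2 hx0.ne'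
  have hz : ∀ ρ : zetaZeros,
      ((x ^ (a - 1) : ℝ) : ℂ) * (zeroCoeff a ρ * ((x⁻¹ : ℝ) : ℂ) ^ (-(ρ : ℂ)))
      = zeroCoeff a ρ * (x : ℂ) ^ ((ρ : ℂ) + a - 1) := by
    intro ρ
    rw [ofReal_inv, inv_cpow _ _ (by rw [arg_ofReal_of_nonneg hx0.le]; exact Real.pi_ne_zero.symm),
      cpow_neg, inv_inv, ofReal_cpow hx0.le, add_sub_assoc, cpow_add _ _ hxc]
    push_cast
    ring
  have hm : ((x ^ (a - 1) : ℝ) : ℂ) * (((x⁻¹)⁻¹ / a : ℝ) : ℂ) = mainPart a x := by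
    rw [mainPart, powSum, tsum_fintype, Finset.univ_unique, Finset.sum_singleton, inv_inv,
      ← ofReal_cpow hx0.le, Real.rpow_sub_one hx0.ne']
    push_cast
    field_simp
  have e : (rieszSum a N x : ℂ) - (mainPart a x - zeroPart a x) = ((x ^ (a - 1) : ℝ) : ℂ) *
      (∑' n : ℕ, ((ArithmeticFunction.vonMangoldt n * cesaroKernel a (n * x⁻¹) : ℝ) : ℂ)
        - (((x⁻¹)⁻¹ / a : ℝ) : ℂ)
        + ∑' ρ : zetaZeros, zeroCoeff a ρ * ((x⁻¹ : ℝ) : ℂ) ^ (-(ρ : ℂ))) := by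
    rw [mul_add, mul_sub, hm, ← rieszSum_eq_tsum ha hx0 hx.2, ← tsum_mul_left, tsum_congr hz,
      zeroPart, powSum]
    ring
  rw [e, norm_mul, norm_real, Real.norm_of_nonneg (by positivity), mul_comm C]
  exact mul_le_mul (Real.rpow_le_rpow hx0.le hx.2 (by linarith)) (hC _ (inv_pos.2 hx0))
    (norm_nonneg _) (by positivity)

section Convolutions

variable {a : ℝ}

theorem re_zero_exponent_le (ρ : zetaZeros) : ((ρ : ℂ) + a - 1).re ≤ a := by
  have := ρ.2.2.2
  simp only [sub_re, add_re, ofReal_re, one_re]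
  linarith

theorem continuousOn_mainPart (ha : 1 < a) {X : ℝ} (hX : 1 ≤ X) :
    ContinuousOn (mainPart a) (Set.Icc 0 X) :=
  continuousOn_powSum (A := a) (.of_finite) (fun _ => by rw [ofReal_re]; linarith)
    (fun _ => (ofReal_re a).le) hX

theorem continuousOn_zeroPart (ha : 1 < a) {X : ℝ} (hX : 1 ≤ X) :
    ContinuousOn (zeroPart a) (Set.Icc 0 X) :=
  continuousOn_powSum (summable_norm_zeroCoeff ha) (re_zero_exponent_pos ha) re_zero_exponent_le hX

theorem natCast_cpow_add_ofReal {N : ℕ} (hN : 1 ≤ N) (s : ℂ) (k : ℝ) :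
    (N : ℂ) ^ (s + k) = (((N : ℝ) ^ k : ℝ) : ℂ) * (N : ℂ) ^ s := by
  rw [cpow_add _ _ (by exact_mod_cast (show N ≠ 0 by omega)), ofReal_cpow N.cast_nonneg,
    ofReal_natCast, mul_comm]

/-- All the convolutions are written with the same factor Γ(a)² N^(2a-1), so that dividing by it at
the end recovers the terms of the theorem. Here Γ(a+1)/a = Γ(a) cancels the coefficient 1/a. -/
theorem integral_mainPart_mul_mainPart (ha : 1 < a) {N : ℕ} (hN : 1 ≤ N) :
    ∫ x in (0 : ℝ)..N, mainPart a x * mainPart a (N - x)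
      = Gamma a ^ 2 * (((N : ℝ) ^ (2 * a - 1) : ℝ) : ℂ) *
        ((N : ℂ) ^ 2 / Gamma (((2 * a - 1 : ℝ) : ℂ) + 3)) := by
  have ha0 : (a : ℂ) ≠ 0 := ofReal_ne_zero.2 (by linarith)
  have hre : 0 < (a : ℂ).re := by rw [ofReal_re]; linarith
  have hre1 : 0 < ((a : ℂ) + 1).re := by rw [add_re, one_re]; linarith
  have h := hasSum_convolution_powSum (ι := Unit) (κ := Unit) (g := fun _ => 1 / (a : ℂ))
    (w := fun _ => (a : ℂ)) (h := fun _ => 1 / (a : ℂ)) (v := fun _ => (a : ℂ)) (A := a) (X := N)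
    (.of_finite) (fun _ => hre) (fun _ => (ofReal_re a).le) (.of_finite) (fun _ => hre)
    (fun _ => (ofReal_re a).le) (by exact_mod_cast hN)
  have h' := h.unique (hasSum_fintype _)
  simp only [Fintype.sum_prod_type, Finset.univ_unique, Finset.sum_singleton] at h'
  change ∫ x in (0 : ℝ)..N, powSum _ _ x * powSum _ _ (N - x) = _
  rw [h', betaIntegral_eq_Gamma_div hre1 hre1, Gamma_add_one _ ha0,
    show (a : ℂ) + a + 1 = (2 : ℕ) + ((2 * a - 1 : ℝ) : ℂ) by push_cast; ring,
    show (a : ℂ) + 1 + (a + 1) = ((2 * a - 1 : ℝ) : ℂ) + 3 by push_cast; ring, ofReal_natCast,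
    natCast_cpow_add_ofReal hN, cpow_natCast]
  field_simp

theorem hasSum_integral_mainPart_mul_zeroPart (ha : 1 < a) {N : ℕ} (hN : 1 ≤ N) :
    HasSum (fun ρ : zetaZeros => Gamma a ^ 2 * (((N : ℝ) ^ (2 * a - 1) : ℝ) : ℂ) *
        singleTerm (2 * a - 1) N ρ)
      (∫ x in (0 : ℝ)..N, mainPart a x * zeroPart a (N - x)) := by
  have := countable_zetaZeros
  have ha0 : (a : ℂ) ≠ 0 := ofReal_ne_zero.2 (by linarith)
  have hre : 0 < (a : ℂ).re := by rw [ofReal_re]; linarith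
  have hre1 : 0 < ((a : ℂ) + 1).re := by rw [add_re, one_re]; linarith
  have h := hasSum_convolution_powSum (ι := Unit) (g := fun _ => 1 / (a : ℂ))
    (w := fun _ => (a : ℂ)) (h := fun ρ : zetaZeros => zeroCoeff a ρ)
    (v := fun ρ => (ρ : ℂ) + a - 1) (A := a) (X := N)
    (.of_finite) (fun _ => hre) (fun _ => (ofReal_re a).le) (summable_norm_zeroCoeff ha)
    (re_zero_exponent_pos ha) re_zero_exponent_le (by exact_mod_cast hN)
  refine ((Equiv.uniqueProd zetaZeros Unit).symm.hasSum_iff.2 h).congr_fun fun ρ => ?_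
  have hρa : 0 < ((ρ : ℂ) + a).re := by rw [add_re]; linarith [ρ.2.2.1]
  have hG := Gamma_ne_zero_of_re_pos hρa
  simp only [Function.comp, Equiv.uniqueProd_symm_apply, singleTerm]
  rw [zeroCoeff_eq_Gamma ha ρ.2, sub_add_cancel, betaIntegral_eq_Gamma_div hre1 hρa,
    Gamma_add_one _ ha0,
    show (a : ℂ) + ((ρ : ℂ) + a - 1) + 1 = ((ρ : ℂ) + 1) + ((2 * a - 1 : ℝ) : ℂ) by
      push_cast; ring,
    show (a : ℂ) + 1 + ((ρ : ℂ) + a) = (ρ : ℂ) + ((2 * a - 1 : ℝ) : ℂ) + 2 by push_cast; ring,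
    ofReal_natCast, natCast_cpow_add_ofReal hN]
  field_simp

theorem hasSum_integral_zeroPart_mul_zeroPart (ha : 1 < a) {N : ℕ} (hN : 1 ≤ N) :
    HasSum (fun p : zetaZeros × zetaZeros => Gamma a ^ 2 * (((N : ℝ) ^ (2 * a - 1) : ℝ) : ℂ) *
        doubleTerm (2 * a - 1) N p.1 p.2)
      (∫ x in (0 : ℝ)..N, zeroPart a x * zeroPart a (N - x)) := by
  have := countable_zetaZeros
  have h := hasSum_convolution_powSum (g := fun ρ : zetaZeros => zeroCoeff a ρ)
    (w := fun ρ => (ρ : ℂ) + a - 1) (h := fun ρ : zetaZeros => zeroCoeff a ρ)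
    (v := fun ρ => (ρ : ℂ) + a - 1) (A := a) (X := N) (summable_norm_zeroCoeff ha)
    (re_zero_exponent_pos ha) re_zero_exponent_le (summable_norm_zeroCoeff ha)
    (re_zero_exponent_pos ha) re_zero_exponent_le (by exact_mod_cast hN)
  refine h.congr_fun fun p => ?_
  have hρ : ∀ ρ : zetaZeros, 0 < ((ρ : ℂ) + a).re := fun ρ => by
    rw [add_re, ofReal_re]; linarith [ρ.2.2.1]
  have hG1 := Gamma_ne_zero_of_re_pos (hρ p.1)
  have hG2 := Gamma_ne_zero_of_re_pos (hρ p.2)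
  simp only [doubleTerm]
  rw [zeroCoeff_eq_Gamma ha p.1.2, zeroCoeff_eq_Gamma ha p.2.2, sub_add_cancel, sub_add_cancel,
    betaIntegral_eq_Gamma_div (hρ _) (hρ _),
    show (p.1 : ℂ) + a - 1 + ((p.2 : ℂ) + a - 1) + 1
      = ((p.1 : ℂ) + p.2) + ((2 * a - 1 : ℝ) : ℂ) by push_cast; ring,
    show (p.1 : ℂ) + a + ((p.2 : ℂ) + a) = (p.1 : ℂ) + p.2 + ((2 * a - 1 : ℝ) : ℂ) + 1 by
      push_cast; ring,
    ofReal_natCast, natCast_cpow_add_ofReal hN]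
  field_simp

theorem integral_rieszSum_eq_goldbachCesaro (ha : 1 < a) {N : ℕ} (hN : 1 ≤ N) :
    ∫ x in (0 : ℝ)..N, (rieszSum a N x : ℂ) * (rieszSum a N (N - x) : ℂ)
      = Gamma a ^ 2 * (((N : ℝ) ^ (2 * a - 1) : ℝ) : ℂ) * (goldbachCesaro (2 * a - 1) N : ℂ) := by
  have hre : 0 < (a : ℂ).re := by rw [ofReal_re]; linarith
  have hN0 : (0 : ℝ) < N := by exact_mod_cast hN
  rw [integral_rieszSum_mul_rieszSum ha, betaIntegral_eq_Gamma_div hre hre,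
    show (a : ℂ) + a = ((2 * a - 1 + 1 : ℝ) : ℂ) by push_cast; ring, Gamma_ofReal (2 * a - 1 + 1)]
  have e : ∑ n ∈ Finset.Icc 1 N, goldbachR n * ((N : ℝ) - n) ^ (2 * a - 1)
      = (N : ℝ) ^ (2 * a - 1) * goldbachCesaro (2 * a - 1) N * Real.Gamma (2 * a - 1 + 1) := by
    have hG := (Real.Gamma_pos_of_pos (show 0 < 2 * a - 1 + 1 by linarith)).ne'
    rw [goldbachCesaro, Finset.mul_sum, Finset.sum_mul]
    refine Finset.sum_congr rfl fun n hn => ?_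
    have hn : (n : ℝ) ≤ N := by exact_mod_cast (Finset.mem_Icc.1 hn).2
    rw [show (N : ℝ) - n = N * (1 - n / N) by field_simp,
      Real.mul_rpow hN0.le (sub_nonneg.2 ((div_le_one hN0).2 hn))]
    field_simp
  have hG : (Real.Gamma (2 * a - 1 + 1) : ℂ) ≠ 0 :=
    ofReal_ne_zero.2 (Real.Gamma_pos_of_pos (by linarith)).ne'
  rw [e]
  push_cast at hG ⊢
  field_simp

end Convolutions

/-! ### The Goldbach average -/

/-- Expanding around p and p' requires a size bound only for them. They will be Riesz means, bounded
by Chebyshev, so the sum over zeros need not be estimated again. -/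
theorem norm_mul_sub_mul_le {p p' q q' : ℂ} {B E : ℝ} (hp : ‖p‖ ≤ B) (hp' : ‖p'‖ ≤ B)
    (hq : ‖p - q‖ ≤ E) (hq' : ‖p' - q'‖ ≤ E) : ‖p * p' - q * q'‖ ≤ 2 * B * E + E ^ 2 := by
  have hB := (norm_nonneg _).trans hp
  have hE := (norm_nonneg _).trans hq
  calc ‖p * p' - q * q'‖ = ‖p * (p' - q') + (p - q) * p' - (p - q) * (p' - q')‖ := by ring_nf
    _ ≤ ‖p‖ * ‖p' - q'‖ + ‖p - q‖ * ‖p'‖ + ‖p - q‖ * ‖p' - q'‖ := by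
        refine (norm_sub_le _ _).trans ?_
        rw [← norm_mul, ← norm_mul, ← norm_mul]
        exact add_le_add_left (norm_add_le _ _) _
    _ ≤ B * E + E * B + E * E := by gcongr
    _ = _ := by ring

theorem theorem2 :
    ∃ N₀ : ℕ, ∀ k : ℝ, 1 < k → ∃ C : ℝ, ∀ N : ℕ, N₀ ≤ N →
      Summable (fun ρ : zetaZeros => singleTerm k N ρ) ∧
      Summable (fun p : zetaZeros × zetaZeros => doubleTerm k N p.1 p.2) ∧
      ‖(goldbachCesaro k N : ℂ) -
          ((N : ℂ) ^ 2 / Complex.Gamma ((k : ℂ) + 3)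
            - 2 * ∑' ρ : zetaZeros, singleTerm k N ρ
            + ∑' ρ₁ : zetaZeros, ∑' ρ₂ : zetaZeros, doubleTerm k N ρ₁ ρ₂)‖ ≤ C * (N : ℝ) := by
  refine ⟨1, fun k hk => ?_⟩
  -- Two kernels of exponent a - 1 convolve to exponent 2a - 1, which must be k.
  obtain ⟨a, rfl⟩ : ∃ a : ℝ, k = 2 * a - 1 := ⟨(k + 1) / 2, by ring⟩
  have ha : 1 < a := by linarith
  obtain ⟨C, hC0, hC⟩ := exists_norm_rieszSum_sub_le ha
  set D : ℝ := Real.log 4 + 4 with hD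
  have hD0 : 0 ≤ D := add_nonneg (Real.log_nonneg (by norm_num)) (by norm_num)
  have hGa : Gamma (a : ℂ) ≠ 0 := Gamma_ne_zero_of_re_pos (by rw [ofReal_re]; linarith)
  -- With B = D N^a and E = C N^(a-1), the integrand's error 2BE + E² is at most (2DC + C²)
  -- N^(2a-1). The interval has length N, and |Γ(a)²| N^(2a-1) is divided out.
  refine ⟨(2 * D * C + C ^ 2) / ‖Gamma (a : ℂ) ^ 2‖, fun N hN => ?_⟩
  have hN1 : (1 : ℝ) ≤ N := by exact_mod_cast hN
  have hN0 : (0 : ℝ) < N := by linarith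
  set J : ℂ := Gamma a ^ 2 * (((N : ℝ) ^ (2 * a - 1) : ℝ) : ℂ) with hJ
  have hJ0 : J ≠ 0 := mul_ne_zero (pow_ne_zero _ hGa) (ofReal_ne_zero.2 (by positivity))
  have h1 := hasSum_integral_mainPart_mul_zeroPart ha hN
  have h2 := hasSum_integral_zeroPart_mul_zeroPart ha hN
  have s1 : Summable (fun ρ : zetaZeros => singleTerm (2 * a - 1) N ρ) :=
    (summable_mul_left_iff hJ0).1 h1.summable
  have s2 : Summable (fun p : zetaZeros × zetaZeros => doubleTerm (2 * a - 1) N p.1 p.2) :=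
    (summable_mul_left_iff hJ0).1 h2.summable
  refine ⟨s1, s2, ?_⟩
  have i1 : J * ∑' ρ : zetaZeros, singleTerm (2 * a - 1) N ρ
      = ∫ x in (0 : ℝ)..N, mainPart a x * zeroPart a (N - x) := by
    rw [← tsum_mul_left]
    exact h1.tsum_eq
  have i2 : J * ∑' ρ₁ : zetaZeros, ∑' ρ₂ : zetaZeros, doubleTerm (2 * a - 1) N ρ₁ ρ₂
      = ∫ x in (0 : ℝ)..N, zeroPart a x * zeroPart a (N - x) := by
    rw [← s2.tsum_prod, ← tsum_mul_left]
    exact h2.tsum_eq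
  -- The reflection x ↦ N - x identifies the two cross terms, whence the factor 2 in the statement.
  have i3 : ∫ x in (0 : ℝ)..N, zeroPart a x * mainPart a (N - x)
      = ∫ x in (0 : ℝ)..N, mainPart a x * zeroPart a (N - x) := by
    have := intervalIntegral.integral_comp_sub_left (a := 0) (b := (N : ℝ))
      (fun x => mainPart a x * zeroPart a (N - x)) N
    simp only [sub_sub_cancel, sub_zero, sub_self] at this
    rw [← this]
    exact intervalIntegral.integral_congr fun x _ => mul_comm _ _
  have hu : Set.uIcc (0 : ℝ) N = Set.Icc (0 : ℝ) N := Set.uIcc_of_le hN0.le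
  have cM := continuousOn_mainPart ha hN1
  have cZ := continuousOn_zeroPart ha hN1
  have hmaps : Set.MapsTo (fun x : ℝ => (N : ℝ) - x) (Set.Icc 0 N) (Set.Icc 0 N) :=
    fun x hx => ⟨by linarith [hx.2], by linarith [hx.1]⟩
  have cS : ContinuousOn (fun x : ℝ => (N : ℝ) - x) (Set.Icc 0 N) :=
    (continuous_const.sub continuous_id).continuousOn
  have cM' : ContinuousOn (fun x : ℝ => mainPart a (N - x)) (Set.Icc 0 N) := cM.comp cS hmaps
  have cZ' : ContinuousOn (fun x : ℝ => zeroPart a (N - x)) (Set.Icc 0 N) := cZ.comp cS hmaps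
  have hI : ∀ {f : ℝ → ℂ}, ContinuousOn f (Set.Icc (0 : ℝ) N) →
      IntervalIntegrable f volume 0 N := fun hf => (hu.symm ▸ hf).intervalIntegrable
  have i4 : J * ((N : ℂ) ^ 2 / Gamma (((2 * a - 1 : ℝ) : ℂ) + 3)
        - 2 * ∑' ρ : zetaZeros, singleTerm (2 * a - 1) N ρ
        + ∑' ρ₁ : zetaZeros, ∑' ρ₂ : zetaZeros, doubleTerm (2 * a - 1) N ρ₁ ρ₂)
      = ∫ x in (0 : ℝ)..N, (mainPart a x - zeroPart a x)
          * (mainPart a (N - x) - zeroPart a (N - x)) := by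
    have e : ∀ x, (mainPart a x - zeroPart a x) * (mainPart a (N - x) - zeroPart a (N - x))
        = (mainPart a x * mainPart a (N - x) - mainPart a x * zeroPart a (N - x))
          - (zeroPart a x * mainPart a (N - x) - zeroPart a x * zeroPart a (N - x)) := fun x => by
      ring
    simp only [e]
    have jMM : IntervalIntegrable (fun x : ℝ => mainPart a x * mainPart a (N - x)) volume 0 N :=
      hI (cM.mul cM')
    have jMZ : IntervalIntegrable (fun x : ℝ => mainPart a x * zeroPart a (N - x)) volume 0 N :=
      hI (cM.mul cZ')
    have jZM : IntervalIntegrable (fun x : ℝ => zeroPart a x * mainPart a (N - x)) volume 0 N :=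
      hI (cZ.mul cM')
    have jZZ : IntervalIntegrable (fun x : ℝ => zeroPart a x * zeroPart a (N - x)) volume 0 N :=
      hI (cZ.mul cZ')
    rw [intervalIntegral.integral_sub (jMM.sub jMZ) (jZM.sub jZZ),
      intervalIntegral.integral_sub jMM jMZ, intervalIntegral.integral_sub jZM jZZ, i3, ← i1, ← i2,
      integral_mainPart_mul_mainPart ha hN]
    ring
  have cR : ContinuousOn (fun x : ℝ => (rieszSum a N x : ℂ)) (Set.Icc 0 N) :=
    (continuous_ofReal.comp (continuous_rieszSum ha N)).continuousOn
  have cR' : ContinuousOn (fun x : ℝ => (rieszSum a N (N - x) : ℂ)) (Set.Icc 0 N) :=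
    cR.comp cS hmaps
  set T := (N : ℂ) ^ 2 / Gamma (((2 * a - 1 : ℝ) : ℂ) + 3)
        - 2 * ∑' ρ : zetaZeros, singleTerm (2 * a - 1) N ρ
        + ∑' ρ₁ : zetaZeros, ∑' ρ₂ : zetaZeros, doubleTerm (2 * a - 1) N ρ₁ ρ₂
  have hnorm : ‖J * ((goldbachCesaro (2 * a - 1) N : ℂ) - T)‖
      ≤ (2 * D * C + C ^ 2) * (N : ℝ) ^ (2 * a - 1) * |(N : ℝ) - 0| := by
    have jR : IntervalIntegrable (fun x : ℝ => (rieszSum a N x : ℂ) * (rieszSum a N (N - x) : ℂ))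
      volume 0 N := hI (cR.mul cR')
    have jG : IntervalIntegrable (fun x : ℝ => (mainPart a x - zeroPart a x)
      * (mainPart a (N - x) - zeroPart a (N - x))) volume 0 N :=
      hI ((cM.sub cZ).mul (cM'.sub cZ'))
    rw [mul_sub, i4, ← integral_rieszSum_eq_goldbachCesaro ha hN,
      ← intervalIntegral.integral_sub jR jG]
    refine intervalIntegral.norm_integral_le_of_norm_le_const fun x hx => ?_
    rw [Set.uIoc_of_le hN0.le] at hx
    have hx' : x ∈ Set.Icc (0 : ℝ) N := ⟨hx.1.le, hx.2⟩
    have hP : ∀ y ∈ Set.Icc (0 : ℝ) N, ‖(rieszSum a N y : ℂ)‖ ≤ D * N * (N : ℝ) ^ (a - 1) := by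
      intro y hy
      rw [norm_real, Real.norm_of_nonneg (rieszSum_nonneg _ _ _)]
      exact rieszSum_le ha hy.2
    refine (norm_mul_sub_mul_le (hP x hx') (hP _ (hmaps hx')) (hC N x hx')
      (hC N _ (hmaps hx'))).trans ?_
    have e : (N : ℝ) ^ (2 * a - 1) = (N : ℝ) ^ (a - 1) * (N : ℝ) ^ (a - 1) * N := by
      rw [← Real.rpow_add hN0, ← Real.rpow_add_one hN0.ne']
      ring_nf
    have hq : 0 ≤ C ^ 2 * ((N : ℝ) ^ (a - 1) * (N : ℝ) ^ (a - 1)) := by positivity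
    rw [e]
    nlinarith [mul_le_mul_of_nonneg_left hN1 hq]
  rw [norm_mul, hJ, norm_mul, norm_real, Real.norm_of_nonneg (by positivity), sub_zero,
    abs_of_pos hN0] at hnorm
  have hg : 0 < ‖Gamma (a : ℂ) ^ 2‖ := norm_pos_iff.2 (pow_ne_zero _ hGa)
  have hp : 0 < (N : ℝ) ^ (2 * a - 1) := by positivity
  rw [div_mul_eq_mul_div, le_div_iff₀ hg]
  refine le_of_mul_le_mul_right ?_ hp
  linarith
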